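/- **Setting.** Let $G=(V,E)$ be a finite simple bipartite graph with colour classes $F$ (firms) and $W$ (workers), positive real capacities $b(e)$, $e\in E$, positive real quotas $q(v)$, $v\in V$, and for each $v\in V$ a weak linear order $\ge_v$ on the set $E_v$ of edges at $v$; its equivalence classes are called ties. Write $|z_v|=\sum_{e\in E_v}z(e)$. For $0\le z\le b$ the mixed choice function $C_v$ is: $C_v(z)=z$ on $E_v$ if $|z_v|\le q(v)$; otherwise let the critical tie be the tie at which the total of $z$, summed from the best tie on, first reaches $q(v)$; $C_v(z)$ equals $z$ on better ties, $0$ on worse ties, and $\min(r,z(e))$ on the critical tie, with $r$ such that the total equals $q(v)$. An assignment $x$ with $0\le x\le b$ and $C_v(x)=x$ on $E_v$ for all $v$ is stable if there is no edge $fw$ that is interesting for both ends, where $e\in E_v$ is interesting for $v$ if some $z'\le b$ differing from $x$ only by a larger value at $e$ has $C_v(z')(e)>x(e)$. For stable $x,y$ write $x\succeq_W y$ if $C_w(x\vee y)=x$ on $E_w$ for all $w\in W$; $x^{\min}$ and $x^{\max}$ denote the minimal and maximal stable assignments for $\succeq_W$. **Active graph.** Let $x$ be stable. A vertex $v$ is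 fully filled if $|x_v|=q(v)$, and deficit otherwise. For $v$ fully filled, the head $H_v(x)$ is the set of edges of the critical tie where $x$ is maximal on that tie, and the tail $T_v(x)$ consists of the other edges of the critical tie and the edges of better ties; for $v$ deficit, $H_v(x)=\emptyset$, $T_v(x)=E_v$. An edge is unsaturated if $x(e)<b(e)$. For a fully filled firm $f$, consider the ties $\pi$ of $f$ for which $D^\pi=\{fw\in\pi \text{ unsaturated},\ fw\in T_w(x)\}$ is nonempty and no tie of $f$ better than or equal to $\pi$ contains an unsaturated edge to a deficit worker; $D_f(x)$ is $D^\pi$ for the best such tie, and $\emptyset$ if there is none. A fully filled vertex is singular if it is obtained by the following closure: a worker $w$ with an edge of $H_w(x)$ going to a deficit firm; a firm $f$ with $D_f(x)=\emptyset$; any fully filled $v$ having an edge of $D_v(x)$ (if $v\in F$) or $H_v(x)$ (if $v\in W$) to a singular vertex. The other fully filled vertices are regular. The directed active graph has arcs $(f,w)$ for regular $f$ and $fw\in D_f(x)$, and arcs $(w,f)$ for regular $w$ and $fw\in H_w(x)$. **Rotations.** Let $L$ be a strong component (with more than one vertex) of the active graph from which no other strong component is reachable. The rotation $\rho_L\in\mathbb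 Z^E$ for $x$ is the vector with coprime entries and connected support, with zero sum on every $E_v$, that is a positive multiple of $\Delta$, where $\Delta(fw)=\phi_f$ if $(f,w)$ is an arc, $\Delta(fw)=-\psi_w$ if $(w,f)$ is an arc, and $\Delta(fw)=0$ otherwise, and where $\phi,\psi\ge0$ is a nonzero solution, vanishing outside $L$, of $|D_f|\phi_f=\sum_{(w,f)}\psi_w$ and $|H_w|\psi_w=\sum_{(f,w)}\phi_f$ (sums over arcs entering $f$, respectively $w$) for all regular $f,w$. We say that $\rho_L$ is applicable to $x$. A weight $\lambda\ge0$ is admissible for it if $x'=x+\lambda\rho_L$ satisfies $0\le x'\le b$ and for each regular $w\in W$ either the critical ties of $x$ and $x'$ at $w$ coincide and $H_w(x)\subseteq H_w(x')$, or $x'$ vanishes on the critical tie of $x$ at $w$. A route is a sequence of stable assignments from $x^{\min}$ to $x^{\max}$ in which each term arises from the preceding one, $x$, by adding $\lambda\rho$ with $\rho$ applicable to $x$ and $\lambda>0$ admissible, all the rotations used being different. Let $\mathcal R$ be the set of rotations used in routes and $\tau(\rho)$ the weight with which $\rho\in\mathcal R$ is applied in a route (these do not depend on the route). For $\rho,\rho'\in\mathcal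 R$ write $\rho\lessdot\rho'$ if $\rho$ is applied earlier than $\rho'$ in all routes. Let $\mathcal E$ be the set of pairs $(\rho,\rho')$ in $\mathcal R$ for which there is a stable $x$ such that $\rho$ but not $\rho'$ is applicable to $x$, whereas $\rho'$ is applicable to $x+\tau(\rho)\rho$. **Proposition.** Let $\rho,\rho'\in\mathcal R$. If $\rho\lessdot\rho'$, then the directed graph $(\mathcal R,\mathcal E)$ has a directed path from $\rho$ to $\rho'$. Conversely, if $(\mathcal R,\mathcal E)$ has a directed path (with at least one edge) from $\rho$ to $\rho'$, then $\rho\lessdot\rho'$. Thus $(\mathcal R,\mathcal E)$ determines $\lessdot$. -/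

import Mathlib

/-- An instance of the mixed stability problem: a finite simple bipartite graph with colour classes
`F` (firms) and `W` (workers) and edge set `E`, positive capacities `b` and quotas `q`, and for
each vertex `v` a weak linear order `geq v` on the edges incident to `v`
(`geq v e e'` means that `e` is at least as good as `e'` for `v`). -/
structure SMP (F W E : Type*) where
  firm : E → F
  worker : E → W
  simple : ∀ e e', firm e = firm e' → worker e = worker e' → e = e'
  b : E → ℝ
  b_pos : ∀ e, 0 < b e
  q : F ⊕ W → ℝ
  q_pos : ∀ v, 0 < q v
  geq : F ⊕ W → E → E → Prop
  geq_total : ∀ v e e', (v = Sum.inl (firm e) ∨ v = Sum.inr (worker e)) →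
    (v = Sum.inl (firm e') ∨ v = Sum.inr (worker e')) → geq v e e' ∨ geq v e' e
  geq_trans : ∀ v e e' e'', (v = Sum.inl (firm e) ∨ v = Sum.inr (worker e)) →
    (v = Sum.inl (firm e') ∨ v = Sum.inr (worker e')) →
    (v = Sum.inl (firm e'') ∨ v = Sum.inr (worker e'')) →
    geq v e e' → geq v e' e'' → geq v e e''

namespace SMP

noncomputable section

open scoped Classical

variable {F W E : Type*} [Fintype F] [Fintype W] [Fintype E]

/-! ### Choice functions and stable assignments -/

/-- `E_v`: the set of edges incident to `v`. -/
def star (I : SMP F W E) (v : F ⊕ W) : Finset E :=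
  Finset.univ.filter fun e => v = Sum.inl (I.firm e) ∨ v = Sum.inr (I.worker e)

/-- The end of `e` other than `v`, for `e` incident to `v`. -/
def other (I : SMP F W E) : F ⊕ W → E → F ⊕ W
  | Sum.inl _, e => Sum.inr (I.worker e)
  | Sum.inr _, e => Sum.inl (I.firm e)

/-- `e >_v e'`. -/
def better (I : SMP F W E) (v : F ⊕ W) (e e' : E) : Prop := I.geq v e e' ∧ ¬ I.geq v e' e

/-- `|z_v|`. -/
def size (I : SMP F W E) (z : E → ℝ) (v : F ⊕ W) : ℝ := ∑ e ∈ I.star v, z e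

/-- The critical tie of `z` at `v`: the tie for which the total of `z` over all better ties is less
than `q v`, while the total over the better ties and this tie is at least `q v`.
It is empty if `|z_v| < q v`. -/
def crit (I : SMP F W E) (z : E → ℝ) (v : F ⊕ W) : Finset E :=
  (I.star v).filter fun e =>
    ∑ e' ∈ (I.star v).filter (fun e' => I.better v e' e), z e' < I.q v ∧
    I.q v ≤ ∑ e' ∈ (I.star v).filter (fun e' => I.geq v e' e), z e'

/-- The edges at `v` in the ties better than the critical one. -/
def beforeCrit (I : SMP F W E) (z : E → ℝ) (v : F ⊕ W) : Finset E :=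
  (I.star v).filter fun e => ∃ c ∈ I.crit z v, I.better v e c

/-- The cutting height `r` in the critical tie (the least one, if `|z|` is equal to the quota on the
ties up to the critical one, so that then `r` is the maximum of `z` on the critical tie). -/
def cutHeight (I : SMP F W E) (z : E → ℝ) (v : F ⊕ W) : ℝ :=
  sInf {r : ℝ | 0 ≤ r ∧
    ∑ e ∈ I.beforeCrit z v, z e + ∑ e ∈ I.crit z v, min r (z e) = I.q v}

/-- The mixed choice function `C_v`; it depends only on the values of `z` on the edges incident
to `v`, and only its values on these edges are meaningful. -/
def choice (I : SMP F W E) (v : F ⊕ W) (z : E → ℝ) (e : E) : ℝ :=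
  if I.size z v ≤ I.q v then z e
  else if e ∈ I.beforeCrit z v then z e
  else if e ∈ I.crit z v then min (I.cutHeight z v) (z e)
  else 0

/-- Fully stationary assignments. -/
def Stationary (I : SMP F W E) (x : E → ℝ) : Prop :=
  0 ≤ x ∧ x ≤ I.b ∧ ∀ v, ∀ e ∈ I.star v, I.choice v x e = x e

/-- The revealed preference `x_v ⪰_v y_v`. -/
def RevPref (I : SMP F W E) (v : F ⊕ W) (x y : E → ℝ) : Prop :=
  ∀ e ∈ I.star v, I.choice v (x ⊔ y) e = x e

/-- The edge `e` is interesting for its end `v` under `z`. -/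
def Interesting (I : SMP F W E) (v : F ⊕ W) (z : E → ℝ) (e : E) : Prop :=
  ∃ z' : E → ℝ, 0 ≤ z' ∧ z' ≤ I.b ∧ z e < z' e ∧ (∀ e', e' ≠ e → z' e' = z e') ∧
    z e < I.choice v z' e

/-- Stable assignments: fully stationary ones without blocking edges. -/
def Stable (I : SMP F W E) (x : E → ℝ) : Prop :=
  I.Stationary x ∧
    ¬ ∃ e, I.Interesting (Sum.inl (I.firm e)) x e ∧ I.Interesting (Sum.inr (I.worker e)) x e

/-- `x` is the minimal stable assignment `x^min` with respect to `⪰_W` (the worst for workers). -/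
def IsXmin (I : SMP F W E) (x : E → ℝ) : Prop :=
  I.Stable x ∧ ∀ y, I.Stable y → ∀ w : W, I.RevPref (Sum.inr w) y x

/-- `x` is the maximal stable assignment `x^max` with respect to `⪰_W` (the best for workers). -/
def IsXmax (I : SMP F W E) (x : E → ℝ) : Prop :=
  I.Stable x ∧ ∀ y, I.Stable y → ∀ w : W, I.RevPref (Sum.inr w) x y

/-! ### The active graph of a stable assignment -/

/-- `v` is fully filled by `x`; otherwise (for a stable `x`) it is deficit. -/
def Filled (I : SMP F W E) (x : E → ℝ) (v : F ⊕ W) : Prop := I.size x v = I.q v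

/-- The head `H_v(x)`; it is empty for a deficit `v`. -/
def head (I : SMP F W E) (x : E → ℝ) (v : F ⊕ W) : Finset E :=
  (I.crit x v).filter fun e => x e = I.cutHeight x v

/-- The tail `T_v(x)`; it is `E_v` for a deficit `v`. -/
def tail (I : SMP F W E) (x : E → ℝ) (v : F ⊕ W) : Finset E :=
  if I.size x v < I.q v then I.star v
  else I.beforeCrit x v ∪ (I.crit x v \ I.head x v)

/-- `e` is an unsaturated edge `fw` at `f` with `e ∈ T_w(x)`, and no tie of `f` better than or equal
to the tie of `e` contains an unsaturated edge incident to a deficit worker. -/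
def Candidate (I : SMP F W E) (x : E → ℝ) (f : F) (e : E) : Prop :=
  e ∈ I.star (Sum.inl f) ∧ x e < I.b e ∧ e ∈ I.tail x (Sum.inr (I.worker e)) ∧
  ∀ e' ∈ I.star (Sum.inl f), I.geq (Sum.inl f) e' e → x e' < I.b e' →
    I.Filled x (Sum.inr (I.worker e'))

/-- The potential head `D_f(x)` of a fully filled firm: all candidate edges in the best tie that
contains a candidate edge. -/
def potentialHead (I : SMP F W E) (x : E → ℝ) (f : F) : Finset E :=
  Finset.univ.filter fun e => I.Filled x (Sum.inl f) ∧ I.Candidate x f e ∧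
    ∀ e', I.Candidate x f e' → I.geq (Sum.inl f) e e'

/-- The set of potentially active edges at `v`: `D_f(x)` for a firm, `H_w(x)` for a worker. -/
def outHead (I : SMP F W E) (x : E → ℝ) : F ⊕ W → Finset E
  | Sum.inl f => I.potentialHead x f
  | Sum.inr w => I.head x (Sum.inr w)

/-- The singular vertices, i.e. those found by the cleaning procedure. -/
inductive Singular (I : SMP F W E) (x : E → ℝ) : F ⊕ W → Prop
  | worker (w : W) (e : E) : I.Filled x (Sum.inr w) → e ∈ I.head x (Sum.inr w) →
      ¬ I.Filled x (Sum.inl (I.firm e)) → Singular I x (Sum.inr w)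
  | firm (f : F) : I.Filled x (Sum.inl f) → I.potentialHead x f = ∅ →
      Singular I x (Sum.inl f)
  | step (v : F ⊕ W) (e : E) : I.Filled x v → e ∈ I.outHead x v →
      Singular I x (I.other v e) → Singular I x v

/-- The regular vertices: fully filled and not singular. -/
def Regular (I : SMP F W E) (x : E → ℝ) (v : F ⊕ W) : Prop :=
  I.Filled x v ∧ ¬ I.Singular x v

/-- `e` is an active edge leaving `v` in the directed active graph. -/
def Active (I : SMP F W E) (x : E → ℝ) (v : F ⊕ W) (e : E) : Prop :=
  I.Regular x v ∧ e ∈ I.outHead x v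

/-- `(u, v)` is an edge of the directed active graph. -/
def Arc (I : SMP F W E) (x : E → ℝ) (u v : F ⊕ W) : Prop :=
  ∃ e, I.Active x u e ∧ v = I.other u e

/-- Reachability in the directed active graph. -/
def Reach (I : SMP F W E) (x : E → ℝ) : F ⊕ W → F ⊕ W → Prop :=
  Relation.ReflTransGen (I.Arc x)

/-- `L` is the vertex set of a strong component (with more than one vertex). -/
def IsStrongComponent (I : SMP F W E) (x : E → ℝ) (L : Set (F ⊕ W)) : Prop :=
  L.Nontrivial ∧ ∃ u, L = {v | I.Reach x u v ∧ I.Reach x v u}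

/-- `L` is the vertex set of a maximal strong component, i.e. no other strong component is
reachable from it. -/
def IsMaxStrongComponent (I : SMP F W E) (x : E → ℝ) (L : Set (F ⊕ W)) : Prop :=
  I.IsStrongComponent x L ∧
    ∀ L', I.IsStrongComponent x L' → (∃ u ∈ L, ∃ v ∈ L', I.Reach x u v) → L' = L

/-! ### Rotations -/

/-- `y` combines `φ` (on regular firms) and `ψ` (on regular workers). It is a nonnegative function
satisfying the balance conditions at all regular vertices and having total mass `ε` on the active
edges. -/
def IsBalanced (I : SMP F W E) (x : E → ℝ) (ε : ℝ) (y : F ⊕ W → ℝ) : Prop :=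
  (∀ v, 0 ≤ y v) ∧ (∀ v, ¬ I.Regular x v → y v = 0) ∧
  (∀ v, I.Regular x v → ((I.outHead x v).card : ℝ) * y v =
    ∑ e ∈ (I.star v).filter (fun e => I.Active x (I.other v e) e), y (I.other v e)) ∧
  ∑ v, ((I.outHead x v).card : ℝ) * y v = ε

/-- The augmentation `Δ` on `E` determined by `y`. -/
def delta (I : SMP F W E) (x : E → ℝ) (y : F ⊕ W → ℝ) (e : E) : ℝ :=
  if I.Active x (Sum.inl (I.firm e)) e then y (Sum.inl (I.firm e))
  else if I.Active x (Sum.inr (I.worker e)) e then - y (Sum.inr (I.worker e))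
  else 0

/-- Pre-rotations: normalized aligned integer circulations with connected support. -/
def IsPreRotation (I : SMP F W E) (ρ : E → ℤ) : Prop :=
  ρ ≠ 0 ∧ (∀ v, ∑ e ∈ I.star v, ρ e = 0) ∧
  (∀ e e', I.firm e = I.firm e' → 0 < ρ e → 0 < ρ e' → ρ e = ρ e') ∧
  (∀ e e', I.worker e = I.worker e' → ρ e < 0 → ρ e' < 0 → ρ e = ρ e') ∧
  Finset.univ.gcd ρ = 1 ∧
  ∀ e e', ρ e ≠ 0 → ρ e' ≠ 0 →
    Relation.ReflTransGen (fun a c => ρ a ≠ 0 ∧ ρ c ≠ 0 ∧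
      (I.firm a = I.firm c ∨ I.worker a = I.worker c)) e e'

/-- `ρ` is the rotation `ρ_L` for `x` associated with the maximal strong component `L`: the
pre-rotation that is positively proportional to `Δ` for a solution of the balance system that
vanishes outside `L`. -/
def IsRotationOf (I : SMP F W E) (x : E → ℝ) (L : Set (F ⊕ W)) (ρ : E → ℤ) : Prop :=
  I.IsMaxStrongComponent x L ∧ I.IsPreRotation ρ ∧
    ∃ ε > 0, ∃ y, I.IsBalanced x ε y ∧ (∀ v, v ∉ L → y v = 0) ∧
      ∃ c > (0 : ℝ), ∀ e, (ρ e : ℝ) = c * I.delta x y e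

/-- `ρ` is a rotation applicable to the stable assignment `x`. -/
def Applicable (I : SMP F W E) (x : E → ℝ) (ρ : E → ℤ) : Prop :=
  I.Stable x ∧ ∃ L, I.IsRotationOf x L ρ

/-- The assignment `x + t ρ`. -/
def shift (x : E → ℝ) (t : ℝ) (ρ : E → ℤ) : E → ℝ := fun e => x e + t * (ρ e : ℝ)

/-- `t` is an admissible weight for the rotation `ρ` under `x`. -/
def Admissible (I : SMP F W E) (x : E → ℝ) (ρ : E → ℤ) (t : ℝ) : Prop :=
  0 ≤ t ∧ 0 ≤ shift x t ρ ∧ shift x t ρ ≤ I.b ∧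
  ∀ w : W, I.Regular x (Sum.inr w) →
    (I.crit (shift x t ρ) (Sum.inr w) = I.crit x (Sum.inr w) ∧
      I.head x (Sum.inr w) ⊆ I.head (shift x t ρ) (Sum.inr w)) ∨
    ∀ e ∈ I.crit x (Sum.inr w), shift x t ρ e = 0

/-! ### Routes and the rotation poset -/

/-- `IsShiftSequence I x T z`: there is a sequence of stable assignments from `x` to `z` in which
the consecutive steps are rotational shifts with the (weight, rotation) pairs listed in `T`. -/
inductive IsShiftSequence (I : SMP F W E) : (E → ℝ) → List (ℝ × (E → ℤ)) → (E → ℝ) → Prop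
  | nil (x : E → ℝ) : I.Stable x → IsShiftSequence I x [] x
  | cons (x : E → ℝ) (t : ℝ) (ρ : E → ℤ) (T : List (ℝ × (E → ℤ))) (z : E → ℝ) :
      I.Applicable x ρ → 0 < t → I.Admissible x ρ t →
      IsShiftSequence I (shift x t ρ) T z → IsShiftSequence I x ((t, ρ) :: T) z

/-- `T` is the list of (weight, rotation) pairs of a complete route: a sequence of rotational
shifts from `x^min` to `x^max` in which all rotations are different. -/
def IsRoute (I : SMP F W E) (T : List (ℝ × (E → ℤ))) : Prop :=
  (T.map Prod.snd).Nodup ∧ ∃ x z, I.IsXmin x ∧ I.IsXmax z ∧ I.IsShiftSequence x T z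

/-- The set `R` of rotations that are used in routes. -/
def rotations (I : SMP F W E) : Set (E → ℤ) :=
  {ρ | ∃ T, I.IsRoute T ∧ ρ ∈ T.map Prod.snd}

/-- The weight `τ(ρ)` with which `ρ` is applied in routes. (Along a route a rotation is applied only
once, so it is applied with its maximal admissible weight; this weight is the same for all
routes.) -/
def tau (I : SMP F W E) (ρ : E → ℤ) : ℝ :=
  sSup {t | ∃ T, I.IsRoute T ∧ (t, ρ) ∈ T}

/-- `ρ ⋖ ρ'`: both belong to `R`, and `ρ` is applied earlier than `ρ'` in all routes. -/
def Precedes (I : SMP F W E) (ρ ρ' : E → ℤ) : Prop :=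
  ρ ∈ I.rotations ∧ ρ' ∈ I.rotations ∧
    ∀ T, I.IsRoute T → List.Sublist [ρ, ρ'] (T.map Prod.snd)

/-- The edge set of the directed graph on `R`: pairs `(ρ, ρ')` such that for some stable `x`, the
rotation `ρ` but not `ρ'` is applicable to `x`, whereas `ρ'` is applicable to `x + τ(ρ) ρ`. -/
def HEdge (I : SMP F W E) (ρ ρ' : E → ℤ) : Prop :=
  ρ ∈ I.rotations ∧ ρ' ∈ I.rotations ∧
    ∃ x, I.Stable x ∧ I.Applicable x ρ ∧ ¬ I.Applicable x ρ' ∧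
      I.Applicable (shift x (I.tau ρ) ρ) ρ'

end

end SMP

namespace SMP

noncomputable section

open scoped Classical

set_option linter.unusedSectionVars false

variable {F W E : Type*} [Fintype F] [Fintype W] [Fintype E]

/-! ### Refused edges and the preference relation at a vertex -/

/-! The argument takes place in the lattice of stable assignments. Stability has a local form: every
unsaturated edge is refused by one of its ends (`stable_iff`). For stable `x`, `y`, the workers'
choice from the pointwise maximum is the join and the firms' choice is the meet. A count of totals
gives `(x ⊔ y) + (x ⊓ y) = x + y` as vectors and equal sizes at every vertex (`stable_counting`).

Rotations enter through two facts. If `z < y`, the vertices at which `z` and `y` differ are regular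
and closed under arcs of the active graph of `z`, so they contain a maximal strong component, whose
rotation moves `z` without passing `y` (`exists_rotation_of_lt`). Secondly, the interval between `z`
and `z + τρ` contains only the points `z + tρ` (`exists_shift_of_between`). As rotations are
primitive integer vectors, displacements along different rotations are proportional only if they
vanish.

It follows that steps along different rotations do not interact: for a step from `x` to `x'` along
`σ`, the vector `(x' ⊓ v) - (x ⊓ v)` is constant while `v` runs through steps along other rotations
(`RotStep.inf_sub_inf`). Along a route it grows from `0` to `x' - x`, so every route uses `σ`, and
with at least the weight of the given step. Hence `τ` is well defined.

An edge of the graph forces precedence: let `ρ` enable `ρ'` at `x`. If a route applied `ρ'` before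
`ρ`, intersecting with its term just after `ρ'` would give a stable assignment `x + rρ'` with `r >
0`, so `ρ'` would already be applicable to `x` (`HEdge.sublist`). Paths follow by transitivity.

Conversely, let `P` be the set of rotations reachable from `ρ`. In a route, a member of `P` followed
directly by a nonmember can be exchanged with it, since no edge leaves `P` (`RotStep.swap`). Sorting
produces a route in which nothing outside `P` comes after `ρ`. If `ρ` precedes `ρ'` in all routes,
then `ρ'` lies in `P`. -/

lemma mem_star {I : SMP F W E} {v : F ⊕ W} {e : E} :
    e ∈ I.star v ↔ v = Sum.inl (I.firm e) ∨ v = Sum.inr (I.worker e) := by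
  simp [star]

lemma mem_star_firm (I : SMP F W E) (e : E) : e ∈ I.star (Sum.inl (I.firm e)) := by
  simp [mem_star]

lemma mem_star_worker (I : SMP F W E) (e : E) : e ∈ I.star (Sum.inr (I.worker e)) := by
  simp [mem_star]

lemma mem_star_inl {I : SMP F W E} {f : F} {e : E} :
    e ∈ I.star (Sum.inl f) ↔ I.firm e = f := by
  simp [mem_star, eq_comm]

lemma mem_star_inr {I : SMP F W E} {w : W} {e : E} :
    e ∈ I.star (Sum.inr w) ↔ I.worker e = w := by
  simp [mem_star, eq_comm]

lemma geq_or {I : SMP F W E} {v : F ⊕ W} {e e' : E} (h : e ∈ I.star v) (h' : e' ∈ I.star v) :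
    I.geq v e e' ∨ I.geq v e' e :=
  I.geq_total v e e' (mem_star.1 h) (mem_star.1 h')

lemma geq_refl {I : SMP F W E} {v : F ⊕ W} {e : E} (h : e ∈ I.star v) : I.geq v e e :=
  (geq_or h h).elim id id

lemma geq_tr {I : SMP F W E} {v : F ⊕ W} {a b c : E} (ha : a ∈ I.star v) (hb : b ∈ I.star v)
    (hc : c ∈ I.star v) (hab : I.geq v a b) (hbc : I.geq v b c) : I.geq v a c :=
  I.geq_trans v a b c (mem_star.1 ha) (mem_star.1 hb) (mem_star.1 hc) hab hbc

/-- Every nonempty set of edges at `v` has a best element. -/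
lemma exists_best {I : SMP F W E} {v : F ⊕ W} (S : Finset E) (hS : S ⊆ I.star v)
    (hne : S.Nonempty) : ∃ e ∈ S, ∀ e' ∈ S, I.geq v e e' := by
  induction hne using Finset.Nonempty.cons_induction with
  | singleton a => exact ⟨a, by simp, by simpa using geq_refl (hS (by simp))⟩
  | cons a s ha hs ih =>
    obtain ⟨m, hm, hmax⟩ := ih fun e he => hS (Finset.mem_cons_of_mem he)
    have hmS := hS (Finset.mem_cons.2 (Or.inr hm))
    have haS := hS (Finset.mem_cons_self a s)
    rcases geq_or haS hmS with h | h
    · refine ⟨a, by simp, fun e' he' => ?_⟩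
      rcases Finset.mem_cons.1 he' with rfl | he''
      · exact geq_refl haS
      · exact geq_tr haS hmS (hS he') h (hmax _ he'')
    · refine ⟨m, by simp [hm], fun e' he' => ?_⟩
      rcases Finset.mem_cons.1 he' with rfl | he''
      · exact h
      · exact hmax _ he''

/-- Every nonempty set of edges at `v` has a worst element. -/
lemma exists_worst {I : SMP F W E} {v : F ⊕ W} (S : Finset E) (hS : S ⊆ I.star v)
    (hne : S.Nonempty) : ∃ e ∈ S, ∀ e' ∈ S, I.geq v e' e := by
  induction hne using Finset.Nonempty.cons_induction with
  | singleton a => exact ⟨a, by simp, by simpa using geq_refl (hS (by simp))⟩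
  | cons a s ha hs ih =>
    obtain ⟨m, hm, hmin⟩ := ih fun e he => hS (Finset.mem_cons_of_mem he)
    have hmS := hS (Finset.mem_cons.2 (Or.inr hm))
    have haS := hS (Finset.mem_cons_self a s)
    rcases geq_or haS hmS with h | h
    · refine ⟨m, by simp [hm], fun e' he' => ?_⟩
      rcases Finset.mem_cons.1 he' with rfl | he''
      · exact h
      · exact hmin _ he''
    · refine ⟨a, by simp, fun e' he' => ?_⟩
      rcases Finset.mem_cons.1 he' with rfl | he''
      · exact geq_refl haS
      · exact geq_tr (hS he') hmS haS (hmin _ he'') h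

/-- The vertex `v` is fully filled by `x` and gains nothing from a larger value at `e`: the edges
carrying `x` are at least as good as `e`, and those in the tie of `e` have values at most `x e`. -/
def Refuses (I : SMP F W E) (v : F ⊕ W) (x : E → ℝ) (e : E) : Prop :=
  I.size x v = I.q v ∧
    ∀ e' ∈ I.star v, 0 < x e' → I.geq v e' e ∧ (I.geq v e e' → x e' ≤ x e)

/-- `v` weakly prefers `x` to `y`, for assignments of equal size at `v`. -/
def Pref (I : SMP F W E) (v : F ⊕ W) (x y : E → ℝ) : Prop :=
  ∀ e ∈ I.star v, x e < y e → I.Refuses v x e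

lemma size_congr {I : SMP F W E} {v : F ⊕ W} {x y : E → ℝ} (h : ∀ e ∈ I.star v, x e = y e) :
    I.size x v = I.size y v :=
  Finset.sum_congr rfl h

lemma Refuses.congr {I : SMP F W E} {v : F ⊕ W} {x y : E → ℝ} {e : E} (he : e ∈ I.star v)
    (h : ∀ e ∈ I.star v, x e = y e) (hx : I.Refuses v x e) : I.Refuses v y e := by
  refine ⟨by rw [← size_congr h, hx.1], fun e' he' hp => ?_⟩
  rw [← h e' he', ← h e he] at *
  exact hx.2 e' he' hp

lemma exists_gt_of_exists_lt {I : SMP F W E} {v : F ⊕ W} {x y : E → ℝ} {e : E}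
    (hs : I.size y v ≤ I.size x v) (he : e ∈ I.star v) (h : x e < y e) :
    ∃ e' ∈ I.star v, y e' < x e' := by
  by_contra! hcon
  exact absurd hs (not_le.2 (Finset.sum_lt_sum hcon ⟨e, he, h⟩))

/-- If `x e > y e`, equality of sizes yields `e'` with `x e' < y e'`. Now `x` refuses `e'` and
carries `e`, while `y` refuses `e` and carries `e'`. So `e`, `e'` are tied and `x e ≤ x e' < y e' ≤
y e`, a contradiction. -/
lemma Pref.le_of_refuses {I : SMP F W E} {v : F ⊕ W} {x y : E → ℝ} {e : E} (h : I.Pref v x y)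
    (hx : 0 ≤ x) (hy : 0 ≤ y) (hs : I.size x v = I.size y v) (he : e ∈ I.star v)
    (hr : I.Refuses v y e) : x e ≤ y e := by
  by_contra! hlt
  obtain ⟨e', he', hlt'⟩ := exists_gt_of_exists_lt hs.le he hlt
  have h1 := (h e' he' hlt').2 e he ((hy e).trans_lt hlt)
  have h2 := hr.2 e' he' ((hx e').trans_lt hlt')
  have h3 := h1.2 h2.1
  have h4 := h2.2 h1.1
  linarith

/-- Refusal survives an improvement that does not lower the value at `e`. An edge `e'` that grows
from `y` to `x` is matched by an edge `a` that shrinks; `a` is refused by `x` and carried by `y`, so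
it lies between `e'` and `e` in the preference order. -/
lemma Pref.refuses {I : SMP F W E} {v : F ⊕ W} {x y : E → ℝ} {e : E} (h : I.Pref v x y)
    (hx : 0 ≤ x) (hs : I.size x v = I.size y v) (he : e ∈ I.star v)
    (hr : I.Refuses v y e) (hle : y e ≤ x e) : I.Refuses v x e := by
  refine ⟨hs.trans hr.1, fun e' he' hpos => ?_⟩
  rcases le_or_gt (x e') (y e') with hle' | hlt
  · have := hr.2 e' he' (hpos.trans_le hle')
    exact ⟨this.1, fun hg => hle'.trans ((this.2 hg).trans hle)⟩
  · obtain ⟨a, ha, hlta⟩ := exists_gt_of_exists_lt hs.le he' hlt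
    have h1 := (h a ha hlta).2 e' he' hpos
    have h2 := hr.2 a ha ((hx a).trans_lt hlta)
    refine ⟨geq_tr he' ha he h1.1 h2.1, fun hg => ?_⟩
    have h3 := h1.2 (geq_tr ha he he' h2.1 hg)
    have h4 := h2.2 (geq_tr he he' ha hg h1.1)
    linarith

lemma Pref.antisymm {I : SMP F W E} {v : F ⊕ W} {x y : E → ℝ} (h : I.Pref v x y)
    (h' : I.Pref v y x) (hx : 0 ≤ x) (hy : 0 ≤ y) (hs : I.size x v = I.size y v) {e : E}
    (he : e ∈ I.star v) : x e = y e := by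
  refine le_antisymm ?_ ?_
  · by_contra! hlt
    exact absurd (h.le_of_refuses hx hy hs he (h' e he hlt)) (not_le.2 hlt)
  · by_contra! hlt
    exact absurd (h'.le_of_refuses hy hx hs.symm he (h e he hlt)) (not_le.2 hlt)

lemma Pref.trans {I : SMP F W E} {v : F ⊕ W} {x y z : E → ℝ} (h : I.Pref v x y)
    (h' : I.Pref v y z) (hx : 0 ≤ x) (hs : I.size x v = I.size y v) : I.Pref v x z := by
  intro e he hlt
  rcases lt_or_ge (x e) (y e) with h1 | h1
  · exact h e he h1
  · exact h.refuses hx hs he (h' e he (h1.trans_lt hlt)) h1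

lemma Pref.refl (I : SMP F W E) (v : F ⊕ W) (x : E → ℝ) : I.Pref v x x :=
  fun _ _ h => absurd h (lt_irrefl _)

/-! ### The choice function -/

lemma better_or_geq {I : SMP F W E} {v : F ⊕ W} {e e' : E} (he : e ∈ I.star v)
    (he' : e' ∈ I.star v) : I.better v e e' ∨ I.geq v e' e := by
  by_cases h : I.geq v e' e
  · exact Or.inr h
  · exact Or.inl ⟨(geq_or he he').resolve_right h, h⟩

lemma mem_crit {I : SMP F W E} {z : E → ℝ} {v : F ⊕ W} {e : E} : e ∈ I.crit z v ↔
    e ∈ I.star v ∧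
    ∑ e' ∈ (I.star v).filter (fun e' => I.better v e' e), z e' < I.q v ∧
    I.q v ≤ ∑ e' ∈ (I.star v).filter (fun e' => I.geq v e' e), z e' := by
  simp [crit]

lemma geq_of_mem_crit {I : SMP F W E} {z : E → ℝ} {v : F ⊕ W} {e e' : E} (hz : 0 ≤ z)
    (he : e ∈ I.crit z v) (he' : e' ∈ I.crit z v) : I.geq v e e' := by
  rw [mem_crit] at he he'
  by_contra hg
  have hb : I.better v e' e := ⟨(geq_or he.1 he'.1).resolve_left hg, hg⟩
  have : ∑ a ∈ (I.star v).filter (fun a => I.geq v a e'), z a ≤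
      ∑ a ∈ (I.star v).filter (fun a => I.better v a e), z a := by
    refine Finset.sum_le_sum_of_subset_of_nonneg (fun a ha => ?_) fun a _ _ => hz a
    rw [Finset.mem_filter] at ha ⊢
    exact ⟨ha.1, geq_tr ha.1 he'.1 he.1 ha.2 hb.1,
      fun h => hg (geq_tr he.1 ha.1 he'.1 h ha.2)⟩
  linarith [he.2.1, he'.2.2]

lemma mem_crit_of_tie {I : SMP F W E} {z : E → ℝ} {v : F ⊕ W} {e e' : E}
    (he : e ∈ I.crit z v) (he' : e' ∈ I.star v) (h : I.geq v e e') (h' : I.geq v e' e) :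
    e' ∈ I.crit z v := by
  rw [mem_crit] at he ⊢
  refine ⟨he', ?_⟩
  have h1 : (I.star v).filter (fun a => I.better v a e') =
      (I.star v).filter (fun a => I.better v a e) := by
    refine Finset.filter_congr fun a ha => ⟨fun hb => ⟨geq_tr ha he' he.1 hb.1 h',
      fun hc => hb.2 (geq_tr he' he.1 ha h' hc)⟩, fun hb => ⟨geq_tr ha he.1 he' hb.1 h,
      fun hc => hb.2 (geq_tr he.1 he' ha h hc)⟩⟩
  have h2 : (I.star v).filter (fun a => I.geq v a e') =
      (I.star v).filter (fun a => I.geq v a e) :=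
    Finset.filter_congr fun a ha => ⟨fun hb => geq_tr ha he' he.1 hb h',
      fun hb => geq_tr ha he.1 he' hb h⟩
  rw [h1, h2]
  exact he.2

/-- The critical tie is the best tie at which the cumulative total reaches the quota. -/
lemma crit_nonempty {I : SMP F W E} {z : E → ℝ} {v : F ⊕ W} (h : I.q v ≤ I.size z v) :
    (I.crit z v).Nonempty := by
  let S := (I.star v).filter fun e =>
    I.q v ≤ ∑ e' ∈ (I.star v).filter (fun e' => I.geq v e' e), z e'
  have hstar : (I.star v).Nonempty := by
    by_contra hne
    rw [Finset.not_nonempty_iff_eq_empty] at hne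
    have := I.q_pos v
    rw [size, hne, Finset.sum_empty] at h
    linarith
  have hS : S.Nonempty := by
    obtain ⟨e, he, hmin⟩ := exists_worst (I.star v) subset_rfl hstar
    refine ⟨e, Finset.mem_filter.2 ⟨he, ?_⟩⟩
    rwa [Finset.filter_true_of_mem hmin]
  obtain ⟨e, he, hmax⟩ := exists_best S (Finset.filter_subset _ _) hS
  have he' := Finset.mem_filter.1 he
  refine ⟨e, mem_crit.2 ⟨he'.1, ?_, he'.2⟩⟩
  by_contra! hq
  have hB : ((I.star v).filter fun a => I.better v a e).Nonempty := by
    by_contra hne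
    rw [Finset.not_nonempty_iff_eq_empty] at hne
    have := I.q_pos v
    rw [hne, Finset.sum_empty] at hq
    linarith
  obtain ⟨a, ha, hmin⟩ := exists_worst _ (Finset.filter_subset _ _) hB
  have ha' := Finset.mem_filter.1 ha
  -- `a` lies in the tie just above that of `e`, so its cumulative total is the total strictly
  -- before `e`. If that already reached the quota, `a` would belong to `S` and be better than the
  -- best element of `S`.
  refine ha'.2.2 (hmax a (Finset.mem_filter.2 ⟨ha'.1, ?_⟩))
  have : (I.star v).filter (fun b => I.geq v b a) =
      (I.star v).filter (fun b => I.better v b e) := by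
    refine Finset.filter_congr fun b hb => ⟨fun h => ⟨geq_tr hb ha'.1 he'.1 h ha'.2.1, fun h' =>
      ha'.2.2 (geq_tr he'.1 hb ha'.1 h' h)⟩, fun h => hmin b (Finset.mem_filter.2 ⟨hb, h⟩)⟩
  rwa [this]

lemma mem_beforeCrit {I : SMP F W E} {z : E → ℝ} {v : F ⊕ W} {e c : E} (hz : 0 ≤ z)
    (hc : c ∈ I.crit z v) : e ∈ I.beforeCrit z v ↔ e ∈ I.star v ∧ I.better v e c := by
  rw [beforeCrit, Finset.mem_filter]
  refine and_congr_right fun he => ⟨?_, fun h => ⟨c, hc, h⟩⟩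
  rintro ⟨d, hd, hb⟩
  have hd' := (mem_crit.1 hd).1
  have hc' := (mem_crit.1 hc).1
  exact ⟨geq_tr he hd' hc' hb.1 (geq_of_mem_crit hz hd hc),
    fun h => hb.2 (geq_tr hd' hc' he (geq_of_mem_crit hz hd hc) h)⟩

lemma mem_crit_iff_tie {I : SMP F W E} {z : E → ℝ} {v : F ⊕ W} {e c : E} (hz : 0 ≤ z)
    (hc : c ∈ I.crit z v) :
    e ∈ I.crit z v ↔ e ∈ I.star v ∧ I.geq v e c ∧ I.geq v c e :=
  ⟨fun h => ⟨(mem_crit.1 h).1, geq_of_mem_crit hz h hc, geq_of_mem_crit hz hc h⟩,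
    fun h => mem_crit_of_tie hc h.1 h.2.2 h.2.1⟩

lemma beforeCrit_union_crit {I : SMP F W E} {z : E → ℝ} {v : F ⊕ W} {c : E} (hz : 0 ≤ z)
    (hc : c ∈ I.crit z v) :
    I.beforeCrit z v ∪ I.crit z v = (I.star v).filter fun e => I.geq v e c := by
  ext e
  rw [Finset.mem_union, mem_beforeCrit hz hc, mem_crit_iff_tie hz hc, Finset.mem_filter]
  unfold better
  tauto

lemma disjoint_beforeCrit_crit {I : SMP F W E} {z : E → ℝ} {v : F ⊕ W} {c : E} (hz : 0 ≤ z)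
    (hc : c ∈ I.crit z v) : Disjoint (I.beforeCrit z v) (I.crit z v) := by
  rw [Finset.disjoint_left]
  intro e he he'
  rw [mem_beforeCrit hz hc] at he
  rw [mem_crit_iff_tie hz hc] at he'
  exact he.2.2 he'.2.2

lemma beforeCrit_sum {I : SMP F W E} {z : E → ℝ} {v : F ⊕ W} {c : E} (hz : 0 ≤ z)
    (hc : c ∈ I.crit z v) : ∑ e ∈ I.beforeCrit z v, z e < I.q v := by
  have : I.beforeCrit z v = (I.star v).filter fun e => I.better v e c := by
    ext e
    rw [mem_beforeCrit hz hc, Finset.mem_filter]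
  rw [this]
  exact (mem_crit.1 hc).2.1

lemma cutHeight_nonneg (I : SMP F W E) (z : E → ℝ) (v : F ⊕ W) : 0 ≤ I.cutHeight z v :=
  Real.sInf_nonneg fun _ h => h.1

lemma cutHeight_le {I : SMP F W E} {z : E → ℝ} {v : F ⊕ W} {r : ℝ} (hr : 0 ≤ r)
    (h : ∑ e ∈ I.beforeCrit z v, z e + ∑ e ∈ I.crit z v, min r (z e) = I.q v) :
    I.cutHeight z v ≤ r :=
  csInf_le ⟨0, fun _ h => h.1⟩ ⟨hr, h⟩

/-- The total is continuous in the height, so a suitable height exists by the intermediate value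
theorem; the set of such heights is closed, so its infimum belongs to it. -/
lemma cutHeight_spec {I : SMP F W E} {z : E → ℝ} {v : F ⊕ W} (hz : 0 ≤ z)
    (h : I.q v ≤ I.size z v) :
    ∑ e ∈ I.beforeCrit z v, z e + ∑ e ∈ I.crit z v, min (I.cutHeight z v) (z e) = I.q v := by
  obtain ⟨c, hc⟩ := crit_nonempty h
  let g : ℝ → ℝ := fun r => ∑ e ∈ I.beforeCrit z v, z e + ∑ e ∈ I.crit z v, min r (z e)
  have hg : Continuous g := by fun_prop
  let S : Set ℝ := {r : ℝ | 0 ≤ r ∧ g r = I.q v}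
  have hclosed : IsClosed S :=
    (isClosed_le continuous_const continuous_id).inter (isClosed_eq hg continuous_const)
  let M := ∑ e ∈ I.crit z v, z e
  have hM : 0 ≤ M := Finset.sum_nonneg fun e _ => hz e
  have h0 : g 0 ≤ I.q v := by
    have : ∑ e ∈ I.crit z v, min 0 (z e) = 0 :=
      Finset.sum_eq_zero fun e _ => min_eq_left (hz e)
    simp only [g, this, add_zero]
    exact (beforeCrit_sum hz hc).le
  have h1 : I.q v ≤ g M := by
    have : ∑ e ∈ I.crit z v, min M (z e) = ∑ e ∈ I.crit z v, z e :=
      Finset.sum_congr rfl fun e he =>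
        min_eq_right (Finset.single_le_sum (f := z) (fun e _ => hz e) he)
    simp only [g, this]
    rw [← Finset.sum_union (disjoint_beforeCrit_crit hz hc), beforeCrit_union_crit hz hc]
    exact (mem_crit.1 hc).2.2
  obtain ⟨r, hr, hgr⟩ := intermediate_value_Icc hM hg.continuousOn ⟨h0, h1⟩
  have hmem : sInf S ∈ S := hclosed.csInf_mem ⟨r, hr.1, hgr⟩ ⟨0, fun _ h => h.1⟩
  exact hmem.2

lemma choice_of_size_le {I : SMP F W E} {z : E → ℝ} {v : F ⊕ W} (h : I.size z v ≤ I.q v) (e : E) :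
    I.choice v z e = z e := by
  simp [choice, h]

lemma choice_nonneg {I : SMP F W E} {z : E → ℝ} (hz : 0 ≤ z) (v : F ⊕ W) (e : E) :
    0 ≤ I.choice v z e := by
  have h1 := hz e
  have h2 := I.cutHeight_nonneg z v
  simp only [Pi.zero_apply] at h1
  unfold choice
  split_ifs <;> simp [*]

lemma choice_le {I : SMP F W E} {z : E → ℝ} (hz : 0 ≤ z) (v : F ⊕ W) (e : E) :
    I.choice v z e ≤ z e := by
  have h1 := hz e
  unfold choice
  split_ifs <;> simp_all

lemma size_choice {I : SMP F W E} {z : E → ℝ} (hz : 0 ≤ z) (v : F ⊕ W) :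
    I.size (I.choice v z) v = min (I.q v) (I.size z v) := by
  rcases le_or_gt (I.size z v) (I.q v) with h | h
  · rw [min_eq_right h]
    exact size_congr fun e _ => choice_of_size_le h e
  · rw [min_eq_left h.le, ← cutHeight_spec hz h.le]
    obtain ⟨c, hc⟩ := crit_nonempty h.le
    have hd := disjoint_beforeCrit_crit hz hc
    have hsub : I.beforeCrit z v ∪ I.crit z v ⊆ I.star v := by
      rw [beforeCrit_union_crit hz hc]; exact Finset.filter_subset _ _
    rw [size, ← Finset.sum_subset hsub, Finset.sum_union hd]
    · congr 1
      · refine Finset.sum_congr rfl fun e he => ?_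
        simp [choice, he]
      · refine Finset.sum_congr rfl fun e he => ?_
        simp [choice, he, not_le.2 h, Finset.disjoint_right.1 hd he]
    · intro e _ he
      rw [Finset.mem_union, not_or] at he
      simp [choice, he, not_le.2 h]

/-- An edge that is cut lies in the critical tie or below it, everything chosen lies in that tie or
above it, and a cut edge of the critical tie gets exactly the cutting height. Together with
`size_choice` this determines the choice function (`choice_eq`), so that the lattice part needs no
cutting heights. -/
lemma choice_pref {I : SMP F W E} {z : E → ℝ} (hz : 0 ≤ z) (v : F ⊕ W) :
    I.Pref v (I.choice v z) z := by
  intro e he hlt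
  have h : I.q v < I.size z v := by
    by_contra! h
    rw [choice_of_size_le h] at hlt
    exact lt_irrefl _ hlt
  refine ⟨by rw [size_choice hz, min_eq_left h.le], fun a ha hpos => ?_⟩
  obtain ⟨c, hc⟩ := crit_nonempty h.le
  have hcs := (mem_crit.1 hc).1
  have hac : I.geq v a c := by
    by_contra hac
    have h1 : a ∉ I.beforeCrit z v := by rw [mem_beforeCrit hz hc]; exact fun h => hac h.2.1
    have h2 : a ∉ I.crit z v := by rw [mem_crit_iff_tie hz hc]; exact fun h => hac h.2.1
    simp [choice, not_le.2 h, h1, h2] at hpos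
  have heb : e ∉ I.beforeCrit z v := fun heb => by simp [choice, heb] at hlt
  have hce : I.geq v c e :=
    (better_or_geq he hcs).resolve_left fun hb => heb ((mem_beforeCrit hz hc).2 ⟨he, hb⟩)
  refine ⟨geq_tr ha hcs he hac hce, fun hea => ?_⟩
  have hca : I.geq v c a := geq_tr hcs he ha hce hea
  have hec : I.geq v e c := geq_tr he ha hcs hea hac
  have hacr : a ∈ I.crit z v := (mem_crit_iff_tie hz hc).2 ⟨ha, hac, hca⟩
  have hecr : e ∈ I.crit z v := (mem_crit_iff_tie hz hc).2 ⟨he, hec, hce⟩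
  have hab : a ∉ I.beforeCrit z v := Finset.disjoint_right.1 (disjoint_beforeCrit_crit hz hc) hacr
  simp only [choice, not_le.2 h, hab, heb, hacr, hecr, if_true, if_false] at hlt ⊢
  have : I.cutHeight z v ≤ z e := by
    by_contra! hc
    rw [min_eq_right hc.le] at hlt
    exact lt_irrefl _ hlt
  rw [min_eq_left this]
  exact min_le_left _ _

/-- Characterization of the choice function. -/
lemma choice_eq {I : SMP F W E} {v : F ⊕ W} {z c : E → ℝ} (hz : 0 ≤ z) (hc : 0 ≤ c)
    (hcz : ∀ e ∈ I.star v, c e ≤ z e) (hs : I.size c v = min (I.q v) (I.size z v))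
    (hp : I.Pref v c z) {e : E} (he : e ∈ I.star v) : I.choice v z e = c e := by
  refine Pref.antisymm (fun a ha h => choice_pref hz v a ha (h.trans_le (hcz a ha)))
    (fun a ha h => hp a ha (h.trans_le (choice_le hz v a))) (fun a => choice_nonneg hz v a) hc
    ((size_choice hz v).trans hs.symm) he

/-- Persistence: a vertex that refuses `e` under `y` chooses at most `y e` from a larger offer. -/
lemma choice_le_of_refuses {I : SMP F W E} {v : F ⊕ W} {y z : E → ℝ} {e : E} (hy : 0 ≤ y)
    (hyz : y ≤ z) (he : e ∈ I.star v) (hr : I.Refuses v y e) : I.choice v z e ≤ y e := by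
  have hz := hy.trans hyz
  refine Pref.le_of_refuses (v := v) (fun a ha h => choice_pref hz v a ha (h.trans_le (hyz a)))
    (fun a => choice_nonneg hz v a) hy ?_ he hr
  rw [size_choice hz, hr.1, min_eq_left]
  rw [← hr.1]
  exact Finset.sum_le_sum fun a _ => hyz a

/-! ### Stationary and stable assignments -/

lemma stationary_iff {I : SMP F W E} {x : E → ℝ} :
    I.Stationary x ↔ 0 ≤ x ∧ x ≤ I.b ∧ ∀ v, I.size x v ≤ I.q v := by
  refine ⟨fun h => ⟨h.1, h.2.1, fun v => ?_⟩, fun h => ⟨h.1, h.2.1, fun v e _ =>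
    choice_of_size_le (h.2.2 v) e⟩⟩
  rw [← size_congr (h.2.2 v), size_choice h.1]
  exact min_le_left _ _

lemma interesting_iff {I : SMP F W E} {x : E → ℝ} {v : F ⊕ W} {e : E} (hx : I.Stationary x)
    (he : e ∈ I.star v) : I.Interesting v x e ↔ x e < I.b e ∧ ¬ I.Refuses v x e := by
  have hx' := stationary_iff.1 hx
  constructor
  · rintro ⟨z, hz0, hzb, hlt, hne, hc⟩
    refine ⟨hlt.trans_le (hzb e), fun hr => ?_⟩
    refine absurd (choice_le_of_refuses hx.1 (fun a => ?_) he hr) (not_le.2 hc)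
    by_cases ha : a = e
    · rw [ha]; exact hlt.le
    · rw [hne a ha]
  · rintro ⟨hlt, hr⟩
    -- The largest possible offer at `e` is used as the witness. If it did not raise the chosen
    -- value, the choice would be at most `x` at every edge of `v`. Since it fills the quota, it
    -- would equal `x` there, and `x` would refuse `e`.
    let z := Function.update x e (I.b e)
    have hze : z e = I.b e := by simp [z]
    have hza : ∀ a, a ≠ e → z a = x a := fun a ha => by simp [z, ha]
    have hxz : x ≤ z := fun a => by
      by_cases ha : a = e
      · rw [ha, hze]; exact hlt.le
      · rw [hza a ha]
    have hz0 := hx.1.trans hxz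
    refine ⟨z, hz0, fun a => ?_, by rwa [hze], hza, ?_⟩
    · by_cases ha : a = e
      · rw [ha, hze]
      · rw [hza a ha]; exact hx.2.1 a
    · by_contra! hle
      have hR := choice_pref hz0 v e he (hle.trans_lt (by rwa [hze]))
      have hcx : ∀ a ∈ I.star v, I.choice v z a ≤ x a := fun a _ => by
        by_cases ha : a = e
        · rwa [ha]
        · rw [← hza a ha]; exact choice_le hz0 v a
      have heq : ∀ a ∈ I.star v, I.choice v z a = x a := by
        rw [← Finset.sum_eq_sum_iff_of_le hcx]
        refine le_antisymm (Finset.sum_le_sum hcx) ?_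
        exact (hx'.2.2 v).trans hR.1.ge
      exact hr (hR.congr he heq)

/-- The vertex of `e` on the side of the firms (`true`) or of the workers (`false`). -/
def side (I : SMP F W E) : Bool → E → F ⊕ W
  | true, e => Sum.inl (I.firm e)
  | false, e => Sum.inr (I.worker e)

lemma mem_star_side (I : SMP F W E) (i : Bool) (e : E) : e ∈ I.star (I.side i e) := by
  cases i <;> simp [side, mem_star]

/-- The working form of stability: blocking edges, defined by choices from modified assignments, are
replaced by refusals under `x` itself. -/
lemma stable_iff {I : SMP F W E} {x : E → ℝ} : I.Stable x ↔
    0 ≤ x ∧ x ≤ I.b ∧ (∀ v, I.size x v ≤ I.q v) ∧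
      ∀ e, x e < I.b e → I.Refuses (Sum.inl (I.firm e)) x e ∨
        I.Refuses (Sum.inr (I.worker e)) x e := by
  constructor
  · rintro ⟨h, hb⟩
    obtain ⟨h0, h1, h2⟩ := stationary_iff.1 h
    refine ⟨h0, h1, h2, fun e he => ?_⟩
    by_contra! hcon
    exact hb ⟨e, (interesting_iff h (I.mem_star_firm e)).2 ⟨he, hcon.1⟩,
      (interesting_iff h (I.mem_star_worker e)).2 ⟨he, hcon.2⟩⟩
  · rintro ⟨h0, h1, h2, h3⟩
    have h := stationary_iff.2 ⟨h0, h1, h2⟩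
    refine ⟨h, fun ⟨e, hf, hw⟩ => ?_⟩
    rw [interesting_iff h (I.mem_star_firm e)] at hf
    rw [interesting_iff h (I.mem_star_worker e)] at hw
    exact (h3 e hf.1).elim hf.2 hw.2

lemma Stable.refuses_side {I : SMP F W E} {x : E → ℝ} (h : I.Stable x) (i : Bool) {e : E}
    (he : x e < I.b e) : I.Refuses (I.side i e) x e ∨ I.Refuses (I.side (!i) e) x e := by
  have := (stable_iff.1 h).2.2.2 e he
  cases i
  · exact this.symm
  · exact this

lemma Stable.nonneg {I : SMP F W E} {x : E → ℝ} (h : I.Stable x) : 0 ≤ x := (stable_iff.1 h).1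

lemma Stable.le_cap {I : SMP F W E} {x : E → ℝ} (h : I.Stable x) : x ≤ I.b := (stable_iff.1 h).2.1

lemma Stable.size_le {I : SMP F W E} {x : E → ℝ} (h : I.Stable x) (v : F ⊕ W) :
    I.size x v ≤ I.q v := (stable_iff.1 h).2.2.1 v

/-! ### Heads and tails -/

lemma refuses_of_geq {I : SMP F W E} {x : E → ℝ} {v : F ⊕ W} {e e' : E} (he : e ∈ I.star v)
    (he' : e' ∈ I.star v) (h : I.Refuses v x e) (hb : I.better v e e') : I.Refuses v x e' :=
  ⟨h.1, fun a ha hpos => ⟨geq_tr ha he he' (h.2 a ha hpos).1 hb.1,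
    fun h' => absurd (geq_tr he' ha he h' (h.2 a ha hpos).1) hb.2⟩⟩

/-- When the total equals the quota, reaching the quota at a tie means that nothing below it is
carried, and not reaching it earlier means that something in the tie is carried. So the critical tie
is the worst tie carrying a positive value. -/
lemma mem_crit_filled {I : SMP F W E} {x : E → ℝ} {v : F ⊕ W} {e : E} (hx : 0 ≤ x)
    (hf : I.size x v = I.q v) : e ∈ I.crit x v ↔ e ∈ I.star v ∧
      (∀ e' ∈ I.star v, 0 < x e' → I.geq v e' e) ∧
      ∃ e' ∈ I.star v, I.geq v e e' ∧ I.geq v e' e ∧ 0 < x e' := by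
  rw [mem_crit]
  refine and_congr_right fun he => ?_
  have key : (I.q v ≤ ∑ e' ∈ (I.star v).filter (fun e' => I.geq v e' e), x e') ↔
      ∀ e' ∈ I.star v, 0 < x e' → I.geq v e' e := by
    have hsum := Finset.sum_filter_add_sum_filter_not (I.star v) (fun e' => I.geq v e' e) x
    rw [← hf, size, ← hsum]
    constructor
    · intro h a ha hpos
      by_contra hg
      have : 0 < ∑ e' ∈ (I.star v).filter (fun e' => ¬ I.geq v e' e), x e' :=
        Finset.sum_pos' (fun b _ => hx b) ⟨a, Finset.mem_filter.2 ⟨ha, hg⟩, hpos⟩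
      linarith
    · intro h
      have : ∑ e' ∈ (I.star v).filter (fun e' => ¬ I.geq v e' e), x e' = 0 := by
        refine Finset.sum_eq_zero fun a ha => ?_
        rw [Finset.mem_filter] at ha
        exact le_antisymm (not_lt.1 fun hpos => ha.2 (h a ha.1 hpos)) (hx a)
      rw [this, add_zero]
  rw [key, and_comm]
  refine and_congr_right fun hzero => ?_
  have hsum := Finset.sum_filter_add_sum_filter_not (I.star v) (fun e' => I.better v e' e) x
  rw [← hf, size, ← hsum]
  constructor
  · intro h
    by_contra! hcon
    have : ∑ e' ∈ (I.star v).filter (fun e' => ¬ I.better v e' e), x e' = 0 := by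
      refine Finset.sum_eq_zero fun a ha => ?_
      rw [Finset.mem_filter] at ha
      refine le_antisymm (not_lt.1 fun hpos => ?_) (hx a)
      have h1 := hzero a ha.1 hpos
      exact absurd (hcon a ha.1 ((better_or_geq ha.1 he).resolve_left ha.2) h1) (not_le.2 hpos)
    linarith
  · rintro ⟨a, ha, h1, h2, hpos⟩
    have : 0 < ∑ e' ∈ (I.star v).filter (fun e' => ¬ I.better v e' e), x e' :=
      Finset.sum_pos' (fun b _ => hx b) ⟨a, Finset.mem_filter.2 ⟨ha, fun hb => hb.2 h1⟩, hpos⟩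
    linarith

lemma cutHeight_filled {I : SMP F W E} {x : E → ℝ} {v : F ⊕ W} (hx : 0 ≤ x)
    (hf : I.size x v = I.q v) : (∀ e ∈ I.crit x v, x e ≤ I.cutHeight x v) ∧
      ∃ e ∈ I.crit x v, x e = I.cutHeight x v := by
  have hspec := cutHeight_spec hx hf.ge
  obtain ⟨c, hc⟩ := crit_nonempty hf.ge
  have hfull : ∑ e ∈ I.beforeCrit x v, x e + ∑ e ∈ I.crit x v, x e = I.q v := by
    rw [← Finset.sum_union (disjoint_beforeCrit_crit hx hc), beforeCrit_union_crit hx hc, ← hf]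
    refine Finset.sum_subset (Finset.filter_subset _ _) fun a ha hna => ?_
    refine le_antisymm (not_lt.1 fun hpos => hna ?_) (hx a)
    exact Finset.mem_filter.2 ⟨ha, ((mem_crit_filled hx hf).1 hc).2.1 a ha hpos⟩
  have hmin : ∀ e ∈ I.crit x v, min (I.cutHeight x v) (x e) = x e := by
    rw [← Finset.sum_eq_sum_iff_of_le fun e _ => min_le_right _ _]
    linarith
  have hle : ∀ e ∈ I.crit x v, x e ≤ I.cutHeight x v := fun e he => min_eq_right_iff.1 (hmin e he)
  refine ⟨hle, ?_⟩
  obtain ⟨m, hm, hmax⟩ := Finset.exists_max_image (I.crit x v) x ⟨c, hc⟩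
  refine ⟨m, hm, le_antisymm (hle m hm) (cutHeight_le (hx m) ?_)⟩
  rw [← hfull]
  congr 1
  exact Finset.sum_congr rfl fun e he => min_eq_right (hmax e he)

/-- With `mem_tail`, this expresses heads and tails through refusals, so that `Pref` and the
stability criterion apply to the active graph. -/
lemma mem_head {I : SMP F W E} {x : E → ℝ} {v : F ⊕ W} {e : E} (hx : 0 ≤ x)
    (hs : I.size x v ≤ I.q v) :
    e ∈ I.head x v ↔ e ∈ I.star v ∧ I.Refuses v x e ∧ 0 < x e := by
  rw [head, Finset.mem_filter]
  constructor
  · rintro ⟨hc, hcut⟩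
    have hf : I.size x v = I.q v := by
      refine le_antisymm hs ((mem_crit.1 hc).2.2.trans ?_)
      exact Finset.sum_le_sum_of_subset_of_nonneg (Finset.filter_subset _ _) fun a _ _ => hx a
    obtain ⟨he, h1, a, ha, h2, h3, hpos⟩ := (mem_crit_filled hx hf).1 hc
    have hle := (cutHeight_filled hx hf).1
    refine ⟨he, ⟨hf, fun a ha hpos => ⟨h1 a ha hpos, fun h => ?_⟩⟩, ?_⟩
    · rw [hcut]
      exact hle a (mem_crit_of_tie hc ha h (h1 a ha hpos))
    · rw [hcut]
      exact hpos.trans_le (hle a (mem_crit_of_tie hc ha h2 h3))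
  · rintro ⟨he, hr, hpos⟩
    have hc : e ∈ I.crit x v := (mem_crit_filled hx hr.1).2
      ⟨he, fun a ha hp => (hr.2 a ha hp).1, e, he, geq_refl he, geq_refl he, hpos⟩
    refine ⟨hc, ?_⟩
    obtain ⟨hle, m, hm, hmc⟩ := cutHeight_filled hx hr.1
    refine le_antisymm (hle e hc) ?_
    rw [← hmc]
    rcases (hx m).lt_or_eq with h | h
    · exact (hr.2 m (mem_crit.1 hm).1 h).2 (geq_of_mem_crit hx hc hm)
    · rw [← h]; exact hpos.le

lemma mem_tail {I : SMP F W E} {x : E → ℝ} {v : F ⊕ W} {e : E} (hx : 0 ≤ x)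
    (hs : I.size x v ≤ I.q v) : e ∈ I.tail x v ↔ e ∈ I.star v ∧ ¬ I.Refuses v x e := by
  rcases hs.lt_or_eq with hlt | hf
  · simp only [tail, hlt, if_true]
    exact ⟨fun h => ⟨h, fun hr => hlt.ne hr.1⟩, fun h => h.1⟩
  · rw [tail, if_neg hf.ge.not_gt, Finset.mem_union, Finset.mem_sdiff, mem_head hx hs]
    obtain ⟨c, hc⟩ := crit_nonempty hf.ge
    rw [mem_beforeCrit hx hc]
    have hc' := (mem_crit_filled hx hf).1 hc
    constructor
    · rintro (⟨he, hb⟩ | ⟨he, hh⟩)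
      · refine ⟨he, fun hr => ?_⟩
        obtain ⟨a, ha, h1, h2, hpos⟩ := hc'.2.2
        exact hb.2 (geq_tr hc'.1 ha he h1 (hr.2 a ha hpos).1)
      · have hes := (mem_crit.1 he).1
        refine ⟨hes, fun hr => hh ⟨hes, hr, ?_⟩⟩
        obtain ⟨a, ha, h1, h2, hpos⟩ := ((mem_crit_filled hx hf).1 he).2.2
        exact hpos.trans_le ((hr.2 a ha hpos).2 h1)
    · rintro ⟨he, hr⟩
      rcases better_or_geq he hc'.1 with hb | hce
      · exact Or.inl ⟨he, hb⟩
      · by_cases hec : I.geq v e c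
        · exact Or.inr ⟨(mem_crit_iff_tie hx hc).2 ⟨he, hec, hce⟩, fun h => hr h.2.1⟩
        · exact absurd (⟨hf, fun a ha hpos => ⟨geq_tr ha hc'.1 he (hc'.2.1 a ha hpos) hce,
            fun h => absurd (geq_tr he ha hc'.1 h (hc'.2.1 a ha hpos)) hec⟩⟩ :
            I.Refuses v x e) hr

lemma head_nonempty {I : SMP F W E} {x : E → ℝ} {v : F ⊕ W} (hx : 0 ≤ x)
    (hf : I.size x v = I.q v) : (I.head x v).Nonempty := by
  obtain ⟨_, m, hm, hmc⟩ := cutHeight_filled hx hf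
  exact ⟨m, Finset.mem_filter.2 ⟨hm, hmc⟩⟩

/-! ### The lattice of stable assignments -/

lemma sum_size_firms (I : SMP F W E) (z : E → ℝ) :
    ∑ f : F, I.size z (Sum.inl f) = ∑ e, z e := by
  rw [← Finset.sum_fiberwise Finset.univ I.firm z]
  refine Finset.sum_congr rfl fun f _ => Finset.sum_congr ?_ fun _ _ => rfl
  ext e
  simp [mem_star_inl]

lemma sum_size_workers (I : SMP F W E) (z : E → ℝ) :
    ∑ w : W, I.size z (Sum.inr w) = ∑ e, z e := by
  rw [← Finset.sum_fiberwise Finset.univ I.worker z]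
  refine Finset.sum_congr rfl fun f _ => Finset.sum_congr ?_ fun _ _ => rfl
  ext e
  simp [mem_star_inr]

/-- The result of the choices from `x ⊔ y` by the vertices on one side. -/
def sideChoice (I : SMP F W E) (i : Bool) (x y : E → ℝ) (e : E) : ℝ :=
  I.choice (I.side i e) (x ⊔ y) e

lemma sideChoice_comm (I : SMP F W E) (i : Bool) (x y : E → ℝ) :
    I.sideChoice i x y = I.sideChoice i y x := by
  funext e
  rw [sideChoice, sideChoice, sup_comm]

lemma side_eq_of_mem_star {I : SMP F W E} {i : Bool} {e e' : E}
    (h : e' ∈ I.star (I.side i e)) : I.side i e' = I.side i e := by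
  cases i
  · simpa [side] using mem_star_inr.1 h
  · simpa [side] using mem_star_inl.1 h

lemma sideChoice_apply {I : SMP F W E} {i : Bool} {x y : E → ℝ} {e e' : E}
    (h : e' ∈ I.star (I.side i e)) :
    I.sideChoice i x y e' = I.choice (I.side i e) (x ⊔ y) e' := by
  rw [sideChoice, side_eq_of_mem_star h]

lemma sideChoice_le (I : SMP F W E) (i : Bool) {x y : E → ℝ} (hx : 0 ≤ x) (e : E) :
    I.sideChoice i x y e ≤ max (x e) (y e) :=
  choice_le (hx.trans le_sup_left) _ e

lemma sideChoice_nonneg (I : SMP F W E) (i : Bool) {x y : E → ℝ} (hx : 0 ≤ x) :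
    0 ≤ I.sideChoice i x y :=
  fun e => choice_nonneg (hx.trans le_sup_left) _ e

lemma sideChoice_le_of_refuses {I : SMP F W E} {i : Bool} {x y : E → ℝ} {e : E} (hx : 0 ≤ x)
    (h : I.Refuses (I.side i e) x e) : I.sideChoice i x y e ≤ x e :=
  choice_le_of_refuses hx le_sup_left (I.mem_star_side i e) h

/-- Where `x` and `y` differ, the smaller of the two values is unsaturated, so one end of `e`
refuses it; by persistence that end chooses no more from `x ⊔ y`. -/
lemma sideChoice_le_min {I : SMP F W E} {x y : E → ℝ} (hx : I.Stable x) (hy : I.Stable y) (e : E) :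
    ∃ i, I.sideChoice i x y e ≤ min (x e) (y e) := by
  have h0 := hx.nonneg
  have aux : ∀ {x y : E → ℝ}, I.Stable x → I.Stable y → x e < y e →
      ∃ i, I.sideChoice i x y e ≤ min (x e) (y e) := by
    intro x y hx hy hlt
    rw [min_eq_left hlt.le]
    exact (hx.refuses_side true (hlt.trans_le (hy.le_cap e))).elim
      (fun h => ⟨_, sideChoice_le_of_refuses hx.nonneg h⟩)
      (fun h => ⟨_, sideChoice_le_of_refuses hx.nonneg h⟩)
  rcases lt_trichotomy (x e) (y e) with h | h | h
  · exact aux hx hy h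
  · refine ⟨true, (I.sideChoice_le true h0 e).trans ?_⟩
    rw [h, max_self, min_self]
  · obtain ⟨i, hi⟩ := aux hy hx h
    exact ⟨i, by rwa [sideChoice_comm, min_comm]⟩

lemma sideChoice_add_le {I : SMP F W E} {x y : E → ℝ} (hx : I.Stable x) (hy : I.Stable y) (e : E) :
    I.sideChoice true x y e + I.sideChoice false x y e ≤ x e + y e := by
  obtain ⟨i, hi⟩ := sideChoice_le_min hx hy e
  have h1 := I.sideChoice_le true (y := y) hx.nonneg e
  have h2 := I.sideChoice_le false (y := y) hx.nonneg e
  have := min_add_max (x e) (y e)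
  cases i <;> linarith

lemma size_sideChoice_firm {I : SMP F W E} {x y : E → ℝ} (hx : 0 ≤ x) (f : F) :
    I.size (I.sideChoice true x y) (Sum.inl f) = min (I.q (Sum.inl f))
      (I.size (x ⊔ y) (Sum.inl f)) := by
  rw [← size_choice (hx.trans le_sup_left)]
  refine size_congr fun e he => ?_
  rw [sideChoice, side, mem_star_inl.1 he]

lemma size_sideChoice_worker {I : SMP F W E} {x y : E → ℝ} (hx : 0 ≤ x) (w : W) :
    I.size (I.sideChoice false x y) (Sum.inr w) = min (I.q (Sum.inr w))
      (I.size (x ⊔ y) (Sum.inr w)) := by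
  rw [← size_choice (hx.trans le_sup_left)]
  refine size_congr fun e he => ?_
  rw [sideChoice, side, mem_star_inr.1 he]

lemma size_mono (I : SMP F W E) (v : F ⊕ W) {x y : E → ℝ} (h : x ≤ y) :
    I.size x v ≤ I.size y v :=
  Finset.sum_le_sum fun e _ => h e

/-- Complementarity and equality of sizes for stable assignments. -/
lemma stable_counting {I : SMP F W E} {x y : E → ℝ} (hx : I.Stable x) (hy : I.Stable y) :
    (∀ e, I.sideChoice true x y e + I.sideChoice false x y e = x e + y e) ∧
    (∀ v, min (I.q v) (I.size (x ⊔ y) v) = I.size x v) ∧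
    (∀ v, min (I.q v) (I.size (x ⊔ y) v) = I.size y v) := by
  have hxv : ∀ v, I.size x v ≤ min (I.q v) (I.size (x ⊔ y) v) := fun v =>
    le_min (hx.size_le v) (I.size_mono v le_sup_left)
  have hyv : ∀ v, I.size y v ≤ min (I.q v) (I.size (x ⊔ y) v) := fun v =>
    le_min (hy.size_le v) (I.size_mono v le_sup_right)
  have tx : ∑ e, x e ≤ ∑ e, I.sideChoice true x y e := by
    rw [← sum_size_firms I x, ← sum_size_firms I (I.sideChoice true x y)]
    simp_rw [size_sideChoice_firm hx.nonneg]
    exact Finset.sum_le_sum fun f _ => hxv _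
  have ty : ∑ e, y e ≤ ∑ e, I.sideChoice true x y e := by
    rw [← sum_size_firms I y, ← sum_size_firms I (I.sideChoice true x y)]
    simp_rw [size_sideChoice_firm hx.nonneg]
    exact Finset.sum_le_sum fun f _ => hyv _
  have fx : ∑ e, x e ≤ ∑ e, I.sideChoice false x y e := by
    rw [← sum_size_workers I x, ← sum_size_workers I (I.sideChoice false x y)]
    simp_rw [size_sideChoice_worker hx.nonneg]
    exact Finset.sum_le_sum fun f _ => hxv _
  have fy : ∑ e, y e ≤ ∑ e, I.sideChoice false x y e := by
    rw [← sum_size_workers I y, ← sum_size_workers I (I.sideChoice false x y)]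
    simp_rw [size_sideChoice_worker hx.nonneg]
    exact Finset.sum_le_sum fun f _ => hyv _
  -- Each side's choice has at least the total of `x` and the total of `y`, while the two choices
  -- together have at most the sum of these totals. Hence equality holds throughout, and then in
  -- every summand.
  have hle : ∑ e, (I.sideChoice true x y e + I.sideChoice false x y e) ≤ ∑ e, (x e + y e) :=
    Finset.sum_le_sum fun e _ => sideChoice_add_le hx hy e
  rw [Finset.sum_add_distrib, Finset.sum_add_distrib] at hle
  have h1 : ∑ e, x e = ∑ e, I.sideChoice true x y e := by linarith
  have h2 : ∑ e, y e = ∑ e, I.sideChoice true x y e := by linarith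
  have h3 : ∑ e, x e = ∑ e, I.sideChoice false x y e := by linarith
  have h4 : ∑ e, y e = ∑ e, I.sideChoice false x y e := by linarith
  refine ⟨?_, ?_, ?_⟩
  · have := (Finset.sum_eq_sum_iff_of_le (s := Finset.univ) fun e _ =>
      sideChoice_add_le hx hy e).1
      (by rw [Finset.sum_add_distrib, Finset.sum_add_distrib]; linarith)
    exact fun e => this e (Finset.mem_univ e)
  · rintro (f | w)
    · rw [← sum_size_firms I x, ← sum_size_firms I (I.sideChoice true x y)] at h1
      simp_rw [size_sideChoice_firm hx.nonneg] at h1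
      exact ((Finset.sum_eq_sum_iff_of_le fun f _ => hxv _).1 h1 f (Finset.mem_univ f)).symm
    · rw [← sum_size_workers I x, ← sum_size_workers I (I.sideChoice false x y)] at h3
      simp_rw [size_sideChoice_worker hx.nonneg] at h3
      exact ((Finset.sum_eq_sum_iff_of_le fun f _ => hxv _).1 h3 w (Finset.mem_univ w)).symm
  · rintro (f | w)
    · rw [← sum_size_firms I y, ← sum_size_firms I (I.sideChoice true x y)] at h2
      simp_rw [size_sideChoice_firm hx.nonneg] at h2
      exact ((Finset.sum_eq_sum_iff_of_le fun f _ => hyv _).1 h2 f (Finset.mem_univ f)).symm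
    · rw [← sum_size_workers I y, ← sum_size_workers I (I.sideChoice false x y)] at h4
      simp_rw [size_sideChoice_worker hx.nonneg] at h4
      exact ((Finset.sum_eq_sum_iff_of_le fun f _ => hyv _).1 h4 w (Finset.mem_univ w)).symm

lemma Stable.size_eq {I : SMP F W E} {x y : E → ℝ} (hx : I.Stable x) (hy : I.Stable y)
    (v : F ⊕ W) : I.size x v = I.size y v :=
  ((stable_counting hx hy).2.1 v).symm.trans ((stable_counting hx hy).2.2 v)

lemma sideChoice_add {I : SMP F W E} {x y : E → ℝ} (hx : I.Stable x) (hy : I.Stable y) (i : Bool)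
    (e : E) : I.sideChoice i x y e + I.sideChoice (!i) x y e = x e + y e := by
  have := (stable_counting hx hy).1 e
  cases i
  · rw [add_comm]; exact this
  · exact this

lemma sideChoice_cases {I : SMP F W E} {x y : E → ℝ} (hx : I.Stable x) (hy : I.Stable y) (i : Bool)
    (e : E) : (I.sideChoice i x y e = x e ∧ I.sideChoice (!i) x y e = y e) ∨
      (I.sideChoice i x y e = y e ∧ I.sideChoice (!i) x y e = x e) := by
  obtain ⟨j, hj⟩ := sideChoice_le_min hx hy e
  have h1 := I.sideChoice_le true (y := y) hx.nonneg e
  have h2 := I.sideChoice_le false (y := y) hx.nonneg e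
  have h3 := sideChoice_add hx hy true e
  rw [Bool.not_true] at h3
  rcases le_total (x e) (y e) with h | h
  · rw [min_eq_left h] at hj
    rw [max_eq_right h] at h1 h2
    cases i <;> cases j <;> simp only [Bool.not_true, Bool.not_false]
    · left; constructor <;> linarith
    · right; constructor <;> linarith
    · right; constructor <;> linarith
    · left; constructor <;> linarith
  · rw [min_eq_right h] at hj
    rw [max_eq_left h] at h1 h2
    cases i <;> cases j <;> simp only [Bool.not_true, Bool.not_false]
    · right; constructor <;> linarith
    · left; constructor <;> linarith
    · left; constructor <;> linarith
    · right; constructor <;> linarith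

lemma size_sideChoice {I : SMP F W E} {x y : E → ℝ} (hx : I.Stable x) (hy : I.Stable y) (i : Bool)
    (v : F ⊕ W) : I.size (I.sideChoice i x y) v = I.size x v := by
  have hsum : I.size (I.sideChoice true x y) v + I.size (I.sideChoice false x y) v =
      I.size x v + I.size y v := by
    rw [size, size, size, size, ← Finset.sum_add_distrib, ← Finset.sum_add_distrib]
    exact Finset.sum_congr rfl fun e _ => sideChoice_add hx hy true e
  have hxy := hx.size_eq hy v
  have hm := (stable_counting hx hy).2.1
  rcases v with f | w
  · have := (size_sideChoice_firm (y := y) hx.nonneg f).trans (hm _)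
    cases i <;> linarith
  · have := (size_sideChoice_worker (y := y) hx.nonneg w).trans (hm _)
    cases i <;> linarith

lemma sideChoice_pref {I : SMP F W E} {x y : E → ℝ} (hx : 0 ≤ x) (i : Bool) (e : E) :
    I.Pref (I.side i e) (I.sideChoice i x y) x := by
  intro a ha hlt
  rw [sideChoice_apply ha] at hlt
  refine (choice_pref (hx.trans le_sup_left) _ a ha (hlt.trans_le ?_)).congr ha fun a ha =>
    (sideChoice_apply ha).symm
  exact le_max_left _ _

lemma sideChoice_refuses_of_lt {I : SMP F W E} {x y : E → ℝ} (hx : 0 ≤ x) (i : Bool) {e : E}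
    (h : I.sideChoice i x y e < max (x e) (y e)) :
    I.Refuses (I.side i e) (I.sideChoice i x y) e :=
  (choice_pref (hx.trans le_sup_left) _ e (I.mem_star_side i e) h).congr (I.mem_star_side i e)
    fun _ ha => (sideChoice_apply ha).symm

/-- Let `p` be the choice and suppose that side `i` does not refuse `e` under `p`. Then `p e` is the
larger of `x e` and `y e`, and by `Pref.refuses` side `i` refuses `e` neither under `x` nor under
`y`. So the other end refuses `e` under both. Since `p` agrees with `x` or with `y` at each edge,
that end also refuses `e` under `p`. -/
lemma stable_sideChoice {I : SMP F W E} {x y : E → ℝ} (hx : I.Stable x) (hy : I.Stable y)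
    (i : Bool) : I.Stable (I.sideChoice i x y) := by
  set p := I.sideChoice i x y with hp
  have hp0 : 0 ≤ p := I.sideChoice_nonneg i hx.nonneg
  have hps := size_sideChoice hx hy i
  have key : ∀ {x y : E → ℝ}, I.Stable x → I.Stable y → p = I.sideChoice i x y → ∀ e,
      p e = x e → x e < I.b e → I.Refuses (I.side i e) p e ∨ I.Refuses (I.side (!i) e) p e := by
    intro x y hx hy hp e hpe hlt
    have hps : ∀ v, I.size p v = I.size x v := fun v => by rw [hp, size_sideChoice hx hy]
    by_contra! hcon
    have hmax : max (x e) (y e) ≤ p e := by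
      by_contra! h
      rw [hp] at h hcon
      exact hcon.1 (sideChoice_refuses_of_lt hx.nonneg i h)
    have hyx : y e ≤ x e := (le_max_right _ _).trans (hmax.trans hpe.le)
    have hpx : I.Pref (I.side i e) p x := hp ▸ sideChoice_pref hx.nonneg i e
    have hpy : I.Pref (I.side i e) p y := by
      rw [hp, sideChoice_comm]; exact sideChoice_pref hy.nonneg i e
    have hst := I.mem_star_side i e
    have h1 : ¬ I.Refuses (I.side i e) x e := fun h =>
      hcon.1 (hpx.refuses hp0 (hps _) hst h hpe.ge)
    have h2 : ¬ I.Refuses (I.side i e) y e := fun h =>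
      hcon.1 (hpy.refuses hp0 ((hps _).trans (hx.size_eq hy _)) hst h (hyx.trans hpe.ge))
    have h3 := (hx.refuses_side i hlt).resolve_left h1
    have h4 := (hy.refuses_side i (hyx.trans_lt hlt)).resolve_left h2
    refine hcon.2 ⟨(hps _).trans h3.1, fun a ha hpos => ?_⟩
    have : p a = x a ∨ p a = y a := by
      rw [hp]
      exact (sideChoice_cases hx hy i a).imp And.left And.left
    rcases this with h | h
    · rw [h] at hpos ⊢
      rw [hpe]
      exact h3.2 a ha hpos
    · rw [h] at hpos ⊢
      rw [hpe]
      exact ⟨(h4.2 a ha hpos).1, fun hg => ((h4.2 a ha hpos).2 hg).trans hyx⟩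
  refine stable_iff.2 ⟨hp0, fun e => (I.sideChoice_le i hx.nonneg e).trans
    (max_le (hx.le_cap e) (hy.le_cap e)), fun v => (hps v).trans_le (hx.size_le v), fun e he => ?_⟩
  have : I.Refuses (I.side i e) p e ∨ I.Refuses (I.side (!i) e) p e := by
    rcases sideChoice_cases hx hy i e with h | h
    · exact key hx hy rfl e h.1 (h.1 ▸ he)
    · exact key hy hx (sideChoice_comm I i x y) e h.1 (h.1 ▸ he)
  cases i
  · exact this.symm
  · exact this

lemma revPref_iff {I : SMP F W E} {x y : E → ℝ} (hx : I.Stable x) (hy : I.Stable y) (v : F ⊕ W) :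
    I.RevPref v x y ↔ I.Pref v x y := by
  have hs : 0 ≤ x ⊔ y := hx.nonneg.trans le_sup_left
  constructor
  · intro h e he hlt
    refine (choice_pref hs v e he ?_).congr he h
    rw [h e he]
    exact hlt.trans_le (le_max_right _ _)
  · intro h e he
    refine choice_eq hs hx.nonneg (fun a _ => le_max_left _ _)
      ((stable_counting hx hy).2.1 v).symm (fun a ha hlt => h a ha ?_) he
    rcases lt_max_iff.1 hlt with h' | h'
    · exact absurd h' (lt_irrefl _)
    · exact h'

/-- Polarity: an improvement for one side is a deterioration for the other. -/
lemma Pref.polar {I : SMP F W E} {x y : E → ℝ} (hx : I.Stable x) (hy : I.Stable y) (i : Bool)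
    (h : ∀ e, I.Pref (I.side i e) x y) (e : E) : I.Pref (I.side (!i) e) y x := by
  intro a ha hlt
  rw [← side_eq_of_mem_star ha]
  refine (hy.refuses_side i (hlt.trans_le (hx.le_cap a))).resolve_left fun hr => ?_
  exact absurd ((h a).le_of_refuses hx.nonneg hy.nonneg (hx.size_eq hy _) (I.mem_star_side i a) hr)
    (not_le.2 hlt)

/-- The stable assignments, ordered by the preferences of the workers. -/
structure StableAssignment (I : SMP F W E) where
  val : E → ℝ
  stable : I.Stable val

namespace StableAssignment

variable {I : SMP F W E}

lemma eq_of_val_eq {x y : I.StableAssignment} (h : x.val = y.val) : x = y := by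
  cases x; cases y; congr

instance : PartialOrder I.StableAssignment where
  le x y := ∀ e, I.Pref (I.side false e) y.val x.val
  le_refl x e := Pref.refl I _ _
  le_trans x y z hxy hyz e :=
    (hyz e).trans (hxy e) z.stable.nonneg (z.stable.size_eq y.stable _)
  le_antisymm x y hxy hyx := eq_of_val_eq <| funext fun e =>
    (hyx e).antisymm (hxy e) x.stable.nonneg y.stable.nonneg (x.stable.size_eq y.stable _)
      (I.mem_star_side false e)

lemma le_def {x y : I.StableAssignment} : x ≤ y ↔ ∀ e, I.Pref (I.side false e) y.val x.val :=
  Iff.rfl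

lemma le_iff_refuses {x y : I.StableAssignment} :
    x ≤ y ↔ ∀ e, y.val e < x.val e → I.Refuses (Sum.inr (I.worker e)) y.val e := by
  refine ⟨fun h e => h e e (I.mem_star_side false e), fun h e a ha hlt => ?_⟩
  rw [← side_eq_of_mem_star ha]
  exact h a hlt

lemma le_iff_pref_firm {x y : I.StableAssignment} :
    x ≤ y ↔ ∀ e, I.Pref (I.side true e) x.val y.val :=
  ⟨Pref.polar y.stable x.stable false, Pref.polar x.stable y.stable true⟩

/-- By polarity the firms' preference is the reverse order, so the firms' choice is the meet. The
universal properties hold because each choice takes at every edge one of the two given values. -/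
instance : Lattice I.StableAssignment where
  sup x y := ⟨I.sideChoice false x.val y.val, stable_sideChoice x.stable y.stable false⟩
  inf x y := ⟨I.sideChoice true x.val y.val, stable_sideChoice x.stable y.stable true⟩
  le_sup_left x y := sideChoice_pref x.stable.nonneg false
  le_sup_right x y := fun e => by
    change I.Pref _ (I.sideChoice _ _ _) _
    rw [sideChoice_comm]
    exact sideChoice_pref y.stable.nonneg false e
  sup_le x y z hx hy := fun e a ha hlt => by
    change z.val a < I.sideChoice _ _ _ a at hlt
    rcases sideChoice_cases x.stable y.stable false a with h | h
    · rw [h.1] at hlt; exact hx e a ha hlt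
    · rw [h.1] at hlt; exact hy e a ha hlt
  inf_le_left x y := le_iff_pref_firm.2 (sideChoice_pref x.stable.nonneg true)
  inf_le_right x y := le_iff_pref_firm.2 fun e => by
    change I.Pref _ (I.sideChoice _ _ _) _
    rw [sideChoice_comm]
    exact sideChoice_pref y.stable.nonneg true e
  le_inf x y z hy hz := le_iff_pref_firm.2 fun e a ha hlt => by
    rw [le_iff_pref_firm] at hy hz
    change x.val a < I.sideChoice _ _ _ a at hlt
    rcases sideChoice_cases y.stable z.stable true a with h | h
    · rw [h.1] at hlt; exact hy e a ha hlt
    · rw [h.1] at hlt; exact hz e a ha hlt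

lemma sup_add_inf (x y : I.StableAssignment) : (x ⊔ y).val + (x ⊓ y).val = x.val + y.val :=
  funext fun e => sideChoice_add x.stable y.stable false e

end StableAssignment

/-! ### The active graph -/

/-- Among the elements reachable from `a`, one with the fewest reachable elements works: passing to
anything reachable from it cannot shrink that set. -/
lemma exists_terminal {α : Type*} [Fintype α] (r : α → α → Prop) (a : α) :
    ∃ t, Relation.ReflTransGen r a t ∧
      ∀ u, Relation.ReflTransGen r t u → Relation.ReflTransGen r u t := by
  let R : α → Finset α := fun t => Finset.univ.filter fun u => Relation.ReflTransGen r t u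
  obtain ⟨t, ht, hmin⟩ := Finset.exists_min_image (R a) (fun t => (R t).card)
    ⟨a, by simp [R, Relation.ReflTransGen.refl]⟩
  have hat : Relation.ReflTransGen r a t := by simpa [R] using ht
  refine ⟨t, hat, fun u hu => ?_⟩
  have hsub : R u ⊆ R t := fun b hb => by
    simp only [R, Finset.mem_filter, Finset.mem_univ, true_and] at hb ⊢
    exact hu.trans hb
  have heq := Finset.eq_of_subset_of_card_le hsub (hmin u (by simpa [R] using hat.trans hu))
  have : t ∈ R u := by rw [heq]; simp [R, Relation.ReflTransGen.refl]
  simpa [R] using this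

lemma other_mem_star {I : SMP F W E} (v : F ⊕ W) (e : E) : e ∈ I.star (I.other v e) := by
  cases v <;> simp [other, mem_star]

lemma other_other {I : SMP F W E} {v : F ⊕ W} {e : E} (he : e ∈ I.star v) :
    I.other (I.other v e) e = v := by
  cases v
  · simpa [other] using mem_star_inl.1 he
  · simpa [other] using mem_star_inr.1 he

lemma other_ne {I : SMP F W E} (v : F ⊕ W) (e : E) : I.other v e ≠ v := by
  cases v <;> simp [other]

lemma candidate_iff {I : SMP F W E} {x : E → ℝ} (hx : I.Stable x) {f : F} {e : E} :
    I.Candidate x f e ↔ I.firm e = f ∧ x e < I.b e ∧ ¬ I.Refuses (Sum.inr (I.worker e)) x e ∧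
      ∀ e', I.firm e' = f → I.geq (Sum.inl f) e' e → x e' < I.b e' →
        I.Filled x (Sum.inr (I.worker e')) := by
  simp only [Candidate, mem_star_inl, mem_tail hx.nonneg (hx.size_le _), mem_star_worker,
    true_and]

lemma mem_potentialHead {I : SMP F W E} {x : E → ℝ} {f : F} {e : E} :
    e ∈ I.potentialHead x f ↔ I.Filled x (Sum.inl f) ∧ I.Candidate x f e ∧
      ∀ e', I.Candidate x f e' → I.geq (Sum.inl f) e e' := by
  simp [potentialHead]

lemma mem_head_iff {I : SMP F W E} {x : E → ℝ} (hx : I.Stable x) {v : F ⊕ W} {e : E} :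
    e ∈ I.head x v ↔ e ∈ I.star v ∧ I.Refuses v x e ∧ 0 < x e :=
  mem_head hx.nonneg (hx.size_le v)

lemma firm_of_mem_potentialHead {I : SMP F W E} {x : E → ℝ} {f : F} {e : E}
    (h : e ∈ I.potentialHead x f) : I.firm e = f :=
  mem_star_inl.1 (mem_potentialHead.1 h).2.1.1

lemma lt_cap_of_mem_potentialHead {I : SMP F W E} {x : E → ℝ} {f : F} {e : E}
    (h : e ∈ I.potentialHead x f) : x e < I.b e :=
  (mem_potentialHead.1 h).2.1.2.1

lemma not_refuses_of_mem_potentialHead {I : SMP F W E} {x : E → ℝ} (hx : I.Stable x) {f : F}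
    {e : E} (h : e ∈ I.potentialHead x f) : ¬ I.Refuses (Sum.inr (I.worker e)) x e :=
  ((candidate_iff hx).1 (mem_potentialHead.1 h).2.1).2.2.1

/-- A candidate edge at least as good as an edge of the potential head belongs to it. -/
lemma mem_potentialHead_of_geq {I : SMP F W E} {x : E → ℝ} (hx : I.Stable x) {f : F} {d e : E}
    (hd : d ∈ I.potentialHead x f) (he : I.firm e = f) (hg : I.geq (Sum.inl f) e d)
    (hlt : x e < I.b e) (hr : ¬ I.Refuses (Sum.inr (I.worker e)) x e) :
    e ∈ I.potentialHead x f := by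
  obtain ⟨hf, hc, hmax⟩ := mem_potentialHead.1 hd
  have hc' := (candidate_iff hx).1 hc
  have hes : e ∈ I.star (Sum.inl f) := mem_star_inl.2 he
  have hds : d ∈ I.star (Sum.inl f) := mem_star_inl.2 hc'.1
  exact mem_potentialHead.2 ⟨hf, (candidate_iff hx).2 ⟨he, hlt, hr, fun e' he' hg' hlt' =>
    hc'.2.2.2 e' he' (geq_tr (mem_star_inl.2 he') hes hds hg' hg) hlt'⟩, fun e' he' =>
    geq_tr hes hds he'.1 hg (hmax e' he')⟩

lemma mem_star_of_mem_outHead {I : SMP F W E} {x : E → ℝ} {v : F ⊕ W} {e : E}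
    (h : e ∈ I.outHead x v) : e ∈ I.star v := by
  cases v
  · exact (mem_potentialHead.1 h).2.1.1
  · exact (mem_crit.1 (Finset.mem_filter.1 h).1).1

lemma filled_other {I : SMP F W E} {x : E → ℝ} (hx : I.Stable x) {v : F ⊕ W} {e : E}
    (hv : I.Active x v e) : I.Filled x (I.other v e) := by
  obtain ⟨⟨hf, hs⟩, he⟩ := hv
  cases v with
  | inl f =>
    have hfe := firm_of_mem_potentialHead he
    have hc := (candidate_iff hx).1 (mem_potentialHead.1 he).2.1
    exact hc.2.2.2 e hfe (geq_refl (mem_star_inl.2 hfe)) hc.2.1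
  | inr w =>
    by_contra hcon
    exact hs (Singular.worker w e hf he hcon)

lemma regular_other {I : SMP F W E} {x : E → ℝ} (hx : I.Stable x) {v : F ⊕ W} {e : E}
    (hv : I.Active x v e) : I.Regular x (I.other v e) :=
  ⟨filled_other hx hv, fun hs => hv.1.2 (Singular.step v e hv.1.1 hv.2 hs)⟩

lemma regular_of_arc {I : SMP F W E} {x : E → ℝ} (hx : I.Stable x) {u v : F ⊕ W}
    (h : I.Arc x u v) : I.Regular x v := by
  obtain ⟨e, he, rfl⟩ := h
  exact regular_other hx he

lemma outHead_nonempty {I : SMP F W E} {x : E → ℝ} (hx : I.Stable x) {v : F ⊕ W}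
    (hv : I.Regular x v) : (I.outHead x v).Nonempty := by
  cases v with
  | inl f =>
    by_contra hne
    exact hv.2 (Singular.firm f hv.1 (Finset.not_nonempty_iff_eq_empty.1 hne))
  | inr w => exact head_nonempty hx.nonneg hv.1

lemma exists_arc {I : SMP F W E} {x : E → ℝ} (hx : I.Stable x) {v : F ⊕ W}
    (hv : I.Regular x v) : ∃ u, I.Arc x v u ∧ u ≠ v := by
  obtain ⟨e, he⟩ := outHead_nonempty hx hv
  exact ⟨_, ⟨e, ⟨hv, he⟩, rfl⟩, other_ne v e⟩

lemma regular_of_reach {I : SMP F W E} {x : E → ℝ} (hx : I.Stable x) {u v : F ⊕ W}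
    (hu : I.Regular x u) (h : I.Reach x u v) : I.Regular x v := by
  induction h with
  | refl => exact hu
  | tail _ h _ => exact regular_of_arc hx h

/-- A regular vertex has an arc to another vertex, which is again regular, so a terminal class of
the active graph has more than one vertex. -/
lemma exists_strongComponent {I : SMP F W E} {x : E → ℝ} (hx : I.Stable x) {u : F ⊕ W}
    (hu : I.Regular x u) : ∃ L, I.IsStrongComponent x L ∧
      (∀ v ∈ L, ∀ w, I.Reach x v w → w ∈ L) ∧ ∀ v ∈ L, I.Reach x u v := by
  obtain ⟨t, hut, ht⟩ := exists_terminal (I.Arc x) u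
  refine ⟨{v | I.Reach x t v ∧ I.Reach x v t}, ⟨?_, t, rfl⟩, fun v hv w hw =>
    ⟨hv.1.trans hw, ht w (hv.1.trans hw)⟩, fun v hv => hut.trans hv.1⟩
  obtain ⟨s, hs, hne⟩ := exists_arc hx (regular_of_reach hx hu hut)
  have hts : I.Reach x t s := Relation.ReflTransGen.single hs
  exact ⟨s, ⟨hts, ht s hts⟩, t, ⟨Relation.ReflTransGen.refl, Relation.ReflTransGen.refl⟩, hne⟩

lemma IsStrongComponent.reach {I : SMP F W E} {x : E → ℝ} {L : Set (F ⊕ W)}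
    (hL : I.IsStrongComponent x L) {u v : F ⊕ W} (hu : u ∈ L) (hv : v ∈ L) : I.Reach x u v := by
  obtain ⟨_, a, rfl⟩ := hL
  exact hu.2.trans hv.1

lemma IsStrongComponent.eq {I : SMP F W E} {x : E → ℝ} {L L' : Set (F ⊕ W)}
    (hL : I.IsStrongComponent x L) (hL' : I.IsStrongComponent x L') {u : F ⊕ W} (hu : u ∈ L)
    (hu' : u ∈ L') : L = L' := by
  obtain ⟨_, a, rfl⟩ := hL
  obtain ⟨_, b, rfl⟩ := hL'
  ext v
  exact ⟨fun h => ⟨hu'.1.trans (hu.2.trans h.1), h.2.trans (hu.1.trans hu'.2)⟩,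
    fun h => ⟨hu.1.trans (hu'.2.trans h.1), h.2.trans (hu'.1.trans hu.2)⟩⟩

lemma IsStrongComponent.regular {I : SMP F W E} {x : E → ℝ} {L : Set (F ⊕ W)}
    (hL : I.IsStrongComponent x L) {v : F ⊕ W} (hv : v ∈ L) : I.Regular x v := by
  obtain ⟨u, hu, hne⟩ := hL.1.exists_ne v
  obtain h | ⟨a, ⟨e, he, -⟩, -⟩ := Relation.ReflTransGen.cases_head (hL.reach hv hu)
  · exact absurd h.symm hne
  · exact he.1

lemma IsMaxStrongComponent.closed {I : SMP F W E} {x : E → ℝ} (hx : I.Stable x)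
    {L : Set (F ⊕ W)} (hL : I.IsMaxStrongComponent x L) {u v : F ⊕ W} (hu : u ∈ L)
    (h : I.Arc x u v) : v ∈ L := by
  obtain ⟨L', hL', -, hreach⟩ := exists_strongComponent hx (regular_of_arc hx h)
  obtain ⟨a, ha⟩ := hL'.1.nonempty
  have hva := hreach a ha
  have heq : L' = L := hL.2 L' hL' ⟨u, hu, a, ha, hva.head h⟩
  obtain ⟨-, c, hc⟩ := hL.1
  rw [heq, hc] at ha
  rw [hc] at hu ⊢
  exact ⟨hu.1.tail h, hva.trans ha.2⟩

lemma isMaxStrongComponent_of_closed {I : SMP F W E} {x : E → ℝ} {L : Set (F ⊕ W)}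
    (hn : L.Nontrivial) (hr : ∀ u ∈ L, ∀ v ∈ L, I.Reach x u v)
    (hc : ∀ u ∈ L, ∀ v, I.Arc x u v → v ∈ L) : I.IsMaxStrongComponent x L := by
  have hclosed : ∀ u ∈ L, ∀ v, I.Reach x u v → v ∈ L := by
    intro u hu v h
    induction h with
    | refl => exact hu
    | tail _ h ih => exact hc _ ih _ h
  have hL : I.IsStrongComponent x L := by
    refine ⟨hn, hn.nonempty.some, ?_⟩
    ext v
    exact ⟨fun h => ⟨hr _ hn.nonempty.some_mem _ h, hr _ h _ hn.nonempty.some_mem⟩,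
      fun h => hclosed _ hn.nonempty.some_mem _ h.1⟩
  refine ⟨hL, fun L' hL' ⟨u, hu, v, hv, huv⟩ => ?_⟩
  exact hL'.eq hL hv (hclosed u hu v huv)

lemma exists_maxStrongComponent {I : SMP F W E} {x : E → ℝ} (hx : I.Stable x) {u : F ⊕ W}
    (hu : I.Regular x u) : ∃ L, I.IsMaxStrongComponent x L ∧ ∀ v ∈ L, I.Reach x u v := by
  obtain ⟨L, hL, hc, hr⟩ := exists_strongComponent hx hu
  exact ⟨L, isMaxStrongComponent_of_closed hL.1 (fun u hu v hv => hL.reach hu hv)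
    fun u hu v h => hc u hu v (Relation.ReflTransGen.single h), hr⟩

/-! ### Structure of a rotation -/

/-- Balance at the head of an arc passes positivity on. A nonzero solution supported in a strong
component is therefore positive on all of it, which makes the signs of a rotation readable from
`outHead` (`IsRotationOf.sign`). -/
lemma IsBalanced.pos_of_arc {I : SMP F W E} {x : E → ℝ} (hx : I.Stable x) {ε : ℝ}
    {y : F ⊕ W → ℝ} (hy : I.IsBalanced x ε y) {u v : F ⊕ W} (h : I.Arc x u v) (hu : 0 < y u) :
    0 < y v := by
  have hv := regular_of_arc hx h
  obtain ⟨e, he, rfl⟩ := h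
  have heu := mem_star_of_mem_outHead he.2
  have hsum := hy.2.2.1 _ hv
  have hpos : 0 < ∑ a ∈ (I.star (I.other u e)).filter
      (fun a => I.Active x (I.other (I.other u e) a) a), y (I.other (I.other u e) a) := by
    refine Finset.sum_pos' (fun a _ => hy.1 _) ⟨e, ?_, ?_⟩
    · rw [Finset.mem_filter, other_other heu]
      exact ⟨other_mem_star u e, he⟩
    · rwa [other_other heu]
  rw [← hsum] at hpos
  exact pos_of_mul_pos_right hpos (Nat.cast_nonneg _)

lemma IsBalanced.pos_of_reach {I : SMP F W E} {x : E → ℝ} (hx : I.Stable x) {ε : ℝ}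
    {y : F ⊕ W → ℝ} (hy : I.IsBalanced x ε y) {u v : F ⊕ W} (h : I.Reach x u v) (hu : 0 < y u) :
    0 < y v := by
  induction h with
  | refl => exact hu
  | tail _ h ih => exact hy.pos_of_arc hx h ih

lemma not_active_worker {I : SMP F W E} {x : E → ℝ} (hx : I.Stable x) {e : E}
    (h : I.Active x (Sum.inl (I.firm e)) e) : ¬ I.Active x (Sum.inr (I.worker e)) e := fun h' =>
  not_refuses_of_mem_potentialHead hx h.2 ((mem_head_iff hx).1 h'.2).2.1

namespace IsRotationOf

variable {I : SMP F W E} {x : E → ℝ} {L : Set (F ⊕ W)} {ρ : E → ℤ}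

lemma sign (h : I.IsRotationOf x L ρ) (hx : I.Stable x) (e : E) :
    (0 < ρ e ↔ Sum.inl (I.firm e) ∈ L ∧ e ∈ I.potentialHead x (I.firm e)) ∧
    (ρ e < 0 ↔ Sum.inr (I.worker e) ∈ L ∧ e ∈ I.head x (Sum.inr (I.worker e))) := by
  obtain ⟨hL, hpre, ε, hε, y, hy, hyL, c, hc, hρ⟩ := h
  have hyne : ∃ v, 0 < y v := by
    by_contra! hcon
    refine hpre.1 (funext fun e => ?_)
    have h0 : ∀ v, y v = 0 := fun v => le_antisymm (hcon v) (hy.1 v)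
    have : (ρ e : ℝ) = 0 := by rw [hρ]; simp [delta, h0]
    exact_mod_cast this
  obtain ⟨u, hu⟩ := hyne
  have huL : u ∈ L := by
    by_contra hn
    exact hu.ne' (hyL u hn)
  have hpos : ∀ v ∈ L, 0 < y v := fun v hv => hy.pos_of_reach hx (hL.1.reach huL hv) hu
  have hyiff : ∀ v, 0 < y v ↔ v ∈ L :=
    fun v => ⟨fun hv => by by_contra hn; exact hv.ne' (hyL v hn), hpos v⟩
  have h1 : 0 < ρ e ↔ 0 < I.delta x y e := by
    rw [← Int.cast_pos (R := ℝ), hρ, mul_pos_iff_of_pos_left hc]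
  have h2 : ρ e < 0 ↔ I.delta x y e < 0 := by
    rw [← Int.cast_lt_zero (R := ℝ), hρ, ← neg_pos, ← mul_neg, mul_pos_iff_of_pos_left hc, neg_pos]
  have hreg : ∀ v ∈ L, I.Regular x v := fun v hv => hL.1.regular hv
  rw [h1, h2]
  unfold delta
  split_ifs with hf hw
  · refine ⟨⟨fun h => ⟨(hyiff _).1 h, hf.2⟩, fun h => hpos _ h.1⟩, ⟨fun h => absurd h
      (not_lt.2 (hy.1 _)), fun h => absurd ⟨hreg _ h.1, h.2⟩ (not_active_worker hx hf)⟩⟩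
  · rw [neg_lt_zero, Left.neg_pos_iff]
    refine ⟨⟨fun h => absurd h (not_lt.2 (hy.1 _)), fun h => absurd ⟨hreg _ h.1, h.2⟩ hf⟩,
      ⟨fun h => ⟨(hyiff _).1 h, hw.2⟩, fun h => hpos _ h.1⟩⟩
  · exact ⟨⟨fun h => absurd h (lt_irrefl _), fun h => absurd ⟨hreg _ h.1, h.2⟩ hf⟩,
      ⟨fun h => absurd h (lt_irrefl _), fun h => absurd ⟨hreg _ h.1, h.2⟩ hw⟩⟩

lemma pos_iff (h : I.IsRotationOf x L ρ) (hx : I.Stable x) {e : E} :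
    0 < ρ e ↔ Sum.inl (I.firm e) ∈ L ∧ e ∈ I.potentialHead x (I.firm e) := (h.sign hx e).1

lemma neg_iff (h : I.IsRotationOf x L ρ) (hx : I.Stable x) {e : E} :
    ρ e < 0 ↔ Sum.inr (I.worker e) ∈ L ∧ e ∈ I.head x (Sum.inr (I.worker e)) := (h.sign hx e).2

lemma not_refuses (h : I.IsRotationOf x L ρ) (hx : I.Stable x) {e : E} (hp : 0 < ρ e) :
    ¬ I.Refuses (Sum.inr (I.worker e)) x e :=
  not_refuses_of_mem_potentialHead hx ((h.pos_iff hx).1 hp).2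

lemma refuses (h : I.IsRotationOf x L ρ) (hx : I.Stable x) {e : E} (hp : ρ e < 0) :
    I.Refuses (Sum.inr (I.worker e)) x e :=
  ((mem_head_iff hx).1 ((h.neg_iff hx).1 hp).2).2.1

lemma val_pos (h : I.IsRotationOf x L ρ) (hx : I.Stable x) {e : E} (hp : ρ e < 0) : 0 < x e :=
  ((mem_head_iff hx).1 ((h.neg_iff hx).1 hp).2).2.2

lemma regular (h : I.IsRotationOf x L ρ) {v : F ⊕ W} (hv : v ∈ L) : I.Regular x v :=
  h.1.1.regular hv

lemma other_mem (h : I.IsRotationOf x L ρ) (hx : I.Stable x) {v : F ⊕ W} (hv : v ∈ L) {e : E}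
    (he : e ∈ I.outHead x v) : I.other v e ∈ L :=
  h.1.closed hx hv ⟨e, ⟨h.regular hv, he⟩, rfl⟩

lemma ends_mem (h : I.IsRotationOf x L ρ) (hx : I.Stable x) {e : E} (hne : ρ e ≠ 0) :
    Sum.inl (I.firm e) ∈ L ∧ Sum.inr (I.worker e) ∈ L := by
  rcases lt_or_gt_of_ne hne with hn | hp
  · have := (h.neg_iff hx).1 hn
    exact ⟨h.other_mem hx this.1 this.2, this.1⟩
  · have := (h.pos_iff hx).1 hp
    exact ⟨this.1, h.other_mem hx this.1 this.2⟩

lemma mem_of_ne_zero (h : I.IsRotationOf x L ρ) (hx : I.Stable x) {v : F ⊕ W} {e : E}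
    (he : e ∈ I.star v) (hne : ρ e ≠ 0) : v ∈ L := by
  rcases mem_star.1 he with rfl | rfl
  · exact (h.ends_mem hx hne).1
  · exact (h.ends_mem hx hne).2

lemma exists_pos (h : I.IsRotationOf x L ρ) (hx : I.Stable x) {f : F} (hf : Sum.inl f ∈ L) :
    ∃ e ∈ I.potentialHead x f, 0 < ρ e := by
  obtain ⟨e, he⟩ := outHead_nonempty hx (h.regular hf)
  refine ⟨e, he, (h.pos_iff hx).2 ?_⟩
  rw [firm_of_mem_potentialHead he]
  exact ⟨hf, he⟩

lemma exists_neg (h : I.IsRotationOf x L ρ) (hx : I.Stable x) {w : W} (hw : Sum.inr w ∈ L) :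
    ∃ e ∈ I.head x (Sum.inr w), ρ e < 0 := by
  obtain ⟨e, he⟩ := outHead_nonempty hx (h.regular hw)
  refine ⟨e, he, (h.neg_iff hx).2 ?_⟩
  rw [mem_star_inr.1 (mem_star_of_mem_outHead he)]
  exact ⟨hw, he⟩

lemma exists_ne_zero (h : I.IsRotationOf x L ρ) (hx : I.Stable x) {v : F ⊕ W} (hv : v ∈ L) :
    ∃ e ∈ I.star v, ρ e ≠ 0 := by
  cases v with
  | inl f =>
    obtain ⟨e, he, hp⟩ := h.exists_pos hx hv
    exact ⟨e, mem_star_inl.2 (firm_of_mem_potentialHead he), hp.ne'⟩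
  | inr w =>
    obtain ⟨e, he, hp⟩ := h.exists_neg hx hv
    exact ⟨e, mem_star_of_mem_outHead (v := Sum.inr w) he, hp.ne⟩

end IsRotationOf

/-! ### Feasible weights and stability of rotational shifts -/

lemma size_shift {I : SMP F W E} {ρ : E → ℤ} (hρ : I.IsPreRotation ρ) (x : E → ℝ) (t : ℝ)
    (v : F ⊕ W) : I.size (shift x t ρ) v = I.size x v := by
  have h : ((∑ e ∈ I.star v, ρ e : ℤ) : ℝ) = 0 := by rw [hρ.2.1 v]; simp
  push_cast at h
  simp only [size, shift, Finset.sum_add_distrib, ← Finset.mul_sum, h, mul_zero, add_zero]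

/-- The shift of `x` along `ρ` by `t` stays within the capacities, and the workers still refuse
the edges on which `ρ` decreases. -/
def Feasible (I : SMP F W E) (x : E → ℝ) (ρ : E → ℤ) (t : ℝ) : Prop :=
  0 ≤ shift x t ρ ∧ shift x t ρ ≤ I.b ∧
    ∀ e, ρ e < 0 → I.Refuses (Sum.inr (I.worker e)) (shift x t ρ) e

lemma shift_le_of_nonpos {x : E → ℝ} {ρ : E → ℤ} {t : ℝ} (ht : 0 ≤ t) {e : E} (h : ρ e ≤ 0) :
    shift x t ρ e ≤ x e := by
  have : (ρ e : ℝ) ≤ 0 := by exact_mod_cast h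
  unfold shift
  nlinarith

lemma le_shift_of_nonneg {x : E → ℝ} {ρ : E → ℤ} {t : ℝ} (ht : 0 ≤ t) {e : E} (h : 0 ≤ ρ e) :
    x e ≤ shift x t ρ e := by
  have : (0 : ℝ) ≤ ρ e := by exact_mod_cast h
  unfold shift
  nlinarith

lemma shift_lt_of_neg {x : E → ℝ} {ρ : E → ℤ} {t : ℝ} (ht : 0 < t) {e : E} (h : ρ e < 0) :
    shift x t ρ e < x e := by
  have : (ρ e : ℝ) < 0 := by exact_mod_cast h
  unfold shift
  nlinarith

lemma lt_shift_of_pos {x : E → ℝ} {ρ : E → ℤ} {t : ℝ} (ht : 0 < t) {e : E} (h : 0 < ρ e) :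
    x e < shift x t ρ e := by
  have : (0 : ℝ) < ρ e := by exact_mod_cast h
  unfold shift
  nlinarith

lemma shift_zero (x : E → ℝ) (ρ : E → ℤ) : shift x 0 ρ = x := by
  funext e
  simp [shift]

lemma shift_shift (x : E → ℝ) (s t : ℝ) (ρ : E → ℤ) :
    shift (shift x s ρ) t ρ = shift x (s + t) ρ := by
  funext e
  simp only [shift]
  ring

lemma shift_of_zero {x : E → ℝ} {ρ : E → ℤ} {t : ℝ} {e : E} (h : ρ e = 0) :
    shift x t ρ e = x e := by
  simp [shift, h]

namespace IsRotationOf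

variable {I : SMP F W E} {x : E → ℝ} {L : Set (F ⊕ W)} {ρ : E → ℤ} {t : ℝ}

lemma shift_eq_of_not_mem (h : I.IsRotationOf x L ρ) (hx : I.Stable x) {v : F ⊕ W} (hv : v ∉ L)
    (t : ℝ) {e : E} (he : e ∈ I.star v) : shift x t ρ e = x e :=
  shift_of_zero (by_contra fun hne => hv (h.mem_of_ne_zero hx he hne))

lemma shift_pref (h : I.Feasible x ρ t) (ht : 0 ≤ t) (w : W) :
    I.Pref (Sum.inr w) (shift x t ρ) x := by
  intro e he hlt
  rw [← mem_star_inr.1 he]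
  refine h.2.2 e ?_
  by_contra! hρ
  exact absurd (le_shift_of_nonneg ht hρ) (not_le.2 hlt)

/-- A firm raises values only in its potential head. If `e` is worse than the potential head, the
raised edges are better and do no harm. If `e` is at least as good, it belongs to the potential head
itself and grows by the same amount as every raised edge of the firm. -/
lemma refuses_firm_shift (h : I.IsRotationOf x L ρ) (hx : I.Stable x) (ht : 0 ≤ t)
    {e : E} (hlt : x e < I.b e)
    (hw : ¬ I.Refuses (Sum.inr (I.worker e)) x e) (hρe : 0 ≤ ρ e) :
    I.Refuses (Sum.inl (I.firm e)) (shift x t ρ) e := by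
  have hrf := ((stable_iff.1 hx).2.2.2 e hlt).resolve_right hw
  by_cases hL : Sum.inl (I.firm e) ∈ L
  swap
  · exact hrf.congr (I.mem_star_firm e) fun a ha => (h.shift_eq_of_not_mem hx hL t ha).symm
  obtain ⟨d, hd, hdp⟩ := h.exists_pos hx hL
  have hds : d ∈ I.star (Sum.inl (I.firm e)) := mem_star_inl.2 (firm_of_mem_potentialHead hd)
  have hes := I.mem_star_firm e
  have hall : ∀ a ∈ I.star (Sum.inl (I.firm e)), 0 < ρ a →
      a ∈ I.potentialHead x (I.firm e) := fun a ha hp => by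
    have := ((h.pos_iff hx).1 hp).2
    rwa [mem_star_inl.1 ha] at this
  have htie : ∀ a ∈ I.star (Sum.inl (I.firm e)), 0 < ρ a → I.geq (Sum.inl (I.firm e)) a d :=
    fun a ha hp => (mem_potentialHead.1 (hall a ha hp)).2.2 d (mem_potentialHead.1 hd).2.1
  refine ⟨(size_shift h.2.1 x t _).trans hrf.1, fun a ha hpos => ?_⟩
  rcases le_or_gt (ρ a) 0 with hle | hgt
  · have hax := shift_le_of_nonpos (x := x) ht hle
    have := hrf.2 a ha (hpos.trans_le hax)
    exact ⟨this.1, fun hg => hax.trans ((this.2 hg).trans (le_shift_of_nonneg ht hρe))⟩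
  · have hda := htie a ha hgt
    by_cases hed : I.geq (Sum.inl (I.firm e)) e d
    · have heD := mem_potentialHead_of_geq hx hd rfl hed hlt hw
      have hep := (h.pos_iff hx).2 ⟨hL, heD⟩
      refine ⟨(mem_potentialHead.1 (hall a ha hgt)).2.2 e (mem_potentialHead.1 heD).2.1,
        fun hg => ?_⟩
      have hρ := h.2.1.2.2.1 a e (mem_star_inl.1 ha) hgt hep
      have hxa : x a ≤ x e := by
        rcases (hx.nonneg a).lt_or_eq with hp | h0
        · exact (hrf.2 a ha hp).2 hg
        · rw [← h0]; exact hx.nonneg e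
      simp only [shift, hρ]
      linarith
    · have hde := (geq_or hes hds).resolve_left hed
      exact ⟨geq_tr ha hds hes hda hde, fun hg => absurd (geq_tr hes ha hds hg hda) hed⟩

/-- A feasible shift is stable. -/
lemma stable_shift (h : I.IsRotationOf x L ρ) (hx : I.Stable x) (ht : 0 ≤ t)
    (hF : I.Feasible x ρ t) : I.Stable (shift x t ρ) := by
  refine stable_iff.2 ⟨hF.1, hF.2.1, fun v => (size_shift h.2.1 x t v).trans_le (hx.size_le v),
    fun e he => ?_⟩
  by_cases hρ : ρ e < 0
  · exact Or.inr (hF.2.2 e hρ)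
  rw [not_lt] at hρ
  have hle := le_shift_of_nonneg (x := x) ht hρ
  by_cases hw : I.Refuses (Sum.inr (I.worker e)) x e
  · exact Or.inr ((shift_pref hF ht _).refuses hF.1 (size_shift h.2.1 x t _) (I.mem_star_worker e)
      hw hle)
  · exact Or.inl (h.refuses_firm_shift hx ht (hle.trans_lt he) hw hρ)

/-- A stable shift is feasible. -/
lemma feasible_of_stable (h : I.IsRotationOf x L ρ) (hx : I.Stable x) (ht : 0 ≤ t)
    (hS : I.Stable (shift x t ρ)) : I.Feasible x ρ t := by
  refine ⟨hS.nonneg, hS.le_cap, fun e he => ?_⟩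
  rcases ht.eq_or_lt with rfl | ht
  · rw [shift_zero]
    exact h.refuses hx he
  have hlt := shift_lt_of_neg (x := x) ht he
  refine ((stable_iff.1 hS).2.2.2 e (hlt.trans_le (hx.le_cap e))).resolve_left fun hr => ?_
  -- If the firm refused `e` after the shift, then `e` and the raised edge `d` would be tied for it.
  -- Its refusal of `d` before the shift gives `x e ≤ x d`, its refusal of `e` afterwards gives the
  -- opposite order, although `d` rose and `e` fell.
  obtain ⟨d, hd, hdp⟩ := h.exists_pos hx (h.ends_mem hx he.ne).1
  have hds : d ∈ I.star (Sum.inl (I.firm e)) := mem_star_inl.2 (firm_of_mem_potentialHead hd)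
  have hdf := firm_of_mem_potentialHead hd
  have hdx := lt_shift_of_pos (x := x) ht hdp
  have hrd := ((stable_iff.1 hx).2.2.2 d (lt_cap_of_mem_potentialHead hd)).resolve_right
    (not_refuses_of_mem_potentialHead hx hd)
  rw [hdf] at hrd
  have h1 := hrd.2 e (I.mem_star_firm e) (h.val_pos hx he)
  have h2 := hr.2 d hds ((hx.nonneg d).trans_lt hdx)
  have h3 := h1.2 h2.1
  have h4 := h2.2 h1.1
  linarith

lemma head_congr {x y : E → ℝ} (hx : I.Stable x) (hy : I.Stable y) {v : F ⊕ W}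
    (h : ∀ e ∈ I.star v, x e = y e) : I.head x v = I.head y v := by
  ext e
  rw [mem_head_iff hx, mem_head_iff hy]
  refine and_congr_right fun he => ?_
  rw [h e he]
  exact and_congr_left fun _ => ⟨fun hr => hr.congr he h, fun hr => hr.congr he fun a ha =>
    (h a ha).symm⟩

lemma crit_congr {x y : E → ℝ} {v : F ⊕ W}
    (h : ∀ e ∈ I.star v, x e = y e) : I.crit x v = I.crit y v := by
  ext e
  rw [mem_crit, mem_crit, Finset.sum_congr rfl fun a ha => h a (Finset.mem_filter.1 ha).1,
    Finset.sum_congr rfl fun a ha => h a (Finset.mem_filter.1 ha).1]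

/-- With `feasible_of_stable`, this makes admissibility automatic for a nonnegative weight whose
shift is stable, so routes can be rearranged without looking at critical ties. If some edge of the
old critical tie stays positive, the head edges, still refused by the worker, carry at least as much
and remain in the head. -/
lemma admissible_of_feasible (h : I.IsRotationOf x L ρ) (hx : I.Stable x) (ht : 0 ≤ t)
    (hF : I.Feasible x ρ t) : I.Admissible x ρ t := by
  have hS := h.stable_shift hx ht hF
  refine ⟨ht, hF.1, hF.2.1, fun w hw => ?_⟩
  by_cases hL : Sum.inr w ∈ L
  swap
  · have hcong : ∀ e ∈ I.star (Sum.inr w), x e = shift x t ρ e := fun e he =>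
      (h.shift_eq_of_not_mem hx hL t he).symm
    exact Or.inl ⟨(crit_congr hcong).symm, (head_congr hx hS hcong).subset⟩
  by_cases hvan : ∀ e ∈ I.crit x (Sum.inr w), shift x t ρ e = 0
  · exact Or.inr hvan
  push Not at hvan
  obtain ⟨a, ha, hne⟩ := hvan
  have hapos : 0 < shift x t ρ a := (hF.1 a).lt_of_ne hne.symm
  have key : ∀ e ∈ I.head x (Sum.inr w), e ∈ I.head (shift x t ρ) (Sum.inr w) := by
    intro e he
    have hes := mem_star_of_mem_outHead (v := Sum.inr w) he
    have hr : I.Refuses (Sum.inr w) (shift x t ρ) e := by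
      have hwe := mem_star_inr.1 hes
      rw [← hwe]
      exact hF.2.2 e ((h.neg_iff hx).2 ⟨by rwa [hwe], by rwa [hwe]⟩)
    refine (mem_head_iff hS).2 ⟨hes, hr, hapos.trans_le ?_⟩
    exact (hr.2 a (mem_crit.1 ha).1 hapos).2
      (geq_of_mem_crit hx.nonneg (Finset.mem_filter.1 he).1 ha)
  refine Or.inl ⟨?_, key⟩
  obtain ⟨e, he⟩ := head_nonempty hx.nonneg hw.1
  have hec := (Finset.mem_filter.1 he).1
  have hec' := (Finset.mem_filter.1 (key e he)).1
  ext c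
  rw [mem_crit_iff_tie hx.nonneg hec, mem_crit_iff_tie hF.1 hec']

end IsRotationOf

/-! ### Persistence of a rotation -/

/-- The contribution of the active edge `e` leaving `v`. -/
def activeValue (I : SMP F W E) (x : E → ℝ) (y : F ⊕ W → ℝ) (v : F ⊕ W) (e : E) : ℝ :=
  if I.Active x v e then y v else 0

lemma delta_eq {I : SMP F W E} {x : E → ℝ} (hx : I.Stable x) (y : F ⊕ W → ℝ) (e : E) :
    I.delta x y e = I.activeValue x y (Sum.inl (I.firm e)) e -
      I.activeValue x y (Sum.inr (I.worker e)) e := by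
  unfold delta activeValue
  by_cases hf : I.Active x (Sum.inl (I.firm e)) e
  · simp [hf, not_active_worker hx hf]
  · by_cases hw : I.Active x (Sum.inr (I.worker e)) e <;> simp [hf, hw]

lemma sum_activeValue_out {I : SMP F W E} {x : E → ℝ} (y : F ⊕ W → ℝ) {v : F ⊕ W}
    (hv : I.Regular x v) :
    ∑ e ∈ I.star v, I.activeValue x y v e = ((I.outHead x v).card : ℝ) * y v := by
  have : (I.star v).filter (fun e => I.Active x v e) = I.outHead x v := by
    ext e
    rw [Finset.mem_filter]
    exact ⟨fun h => h.2.2, fun h => ⟨mem_star_of_mem_outHead h, hv, h⟩⟩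
  simp only [activeValue]
  rw [← Finset.sum_filter, this, Finset.sum_const, nsmul_eq_mul]

lemma sum_activeValue_in (I : SMP F W E) (x : E → ℝ) (y : F ⊕ W → ℝ) (v : F ⊕ W) :
    ∑ e ∈ I.star v, I.activeValue x y (I.other v e) e =
      ∑ e ∈ (I.star v).filter (fun e => I.Active x (I.other v e) e), y (I.other v e) := by
  simp only [activeValue]
  rw [← Finset.sum_filter]

lemma isBalanced_iff {I : SMP F W E} {x : E → ℝ} {ε : ℝ} {y : F ⊕ W → ℝ} :
    I.IsBalanced x ε y ↔ (∀ v, 0 ≤ y v) ∧ (∀ v, ¬ I.Regular x v → y v = 0) ∧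
      (∀ v, I.Regular x v → ∑ e ∈ I.star v, I.activeValue x y v e =
        ∑ e ∈ I.star v, I.activeValue x y (I.other v e) e) ∧
      ∑ v, ((I.outHead x v).card : ℝ) * y v = ε := by
  refine and_congr_right fun _ => and_congr_right fun _ => and_congr_left fun _ => ?_
  refine forall_congr' fun v => forall_congr' fun hv => ?_
  rw [sum_activeValue_out y hv, sum_activeValue_in]

lemma filled_iff {I : SMP F W E} {x y : E → ℝ} (hx : I.Stable x) (hy : I.Stable y) (v : F ⊕ W) :
    I.Filled x v ↔ I.Filled y v := by
  rw [Filled, Filled, hx.size_eq hy]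

namespace IsRotationOf

variable {I : SMP F W E} {x : E → ℝ} {L : Set (F ⊕ W)} {ρ : E → ℤ} {t τ : ℝ}

/-- A rotation only depends on the heads and potential heads at its vertices. -/
lemma of_outHead_eq {x' : E → ℝ} (h : I.IsRotationOf x L ρ) (hx : I.Stable x)
    (hx' : I.Stable x') (heq : ∀ v ∈ L, I.outHead x' v = I.outHead x v) :
    I.IsRotationOf x' L ρ := by
  have hsing : ∀ v, I.Singular x' v → v ∉ L := by
    intro v hv
    induction hv with
    | worker w e hf he hnf =>
      intro hL
      have he' : e ∈ I.outHead x (Sum.inr w) := by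
        rw [← heq _ hL]; exact he
      exact hnf ((filled_iff hx hx' _).1 (h.regular (h.other_mem hx hL he')).1)
    | firm f hf he =>
      intro hL
      obtain ⟨e, hpe⟩ := outHead_nonempty hx (h.regular hL)
      rw [← heq _ hL] at hpe
      exact (Finset.ne_empty_of_mem hpe) he
    | step v e hf he _ ih =>
      intro hL
      rw [heq _ hL] at he
      exact ih (h.other_mem hx hL he)
  have hreg : ∀ v ∈ L, I.Regular x' v := fun v hv =>
    ⟨(filled_iff hx hx' v).1 (h.regular hv).1, fun hs => hsing v hs hv⟩
  have hact : ∀ v ∈ L, ∀ e, I.Active x' v e ↔ I.Active x v e := fun v hv e => by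
    simp only [Active, hreg v hv, h.regular hv, heq v hv]
  have hL := h.1
  have hreach : ∀ u ∈ L, ∀ v, I.Reach x u v → v ∈ L ∧ I.Reach x' u v := by
    intro u hu v huv
    induction huv with
    | refl => exact ⟨hu, Relation.ReflTransGen.refl⟩
    | tail _ ha ih =>
      refine ⟨hL.closed hx ih.1 ha, ih.2.tail ?_⟩
      obtain ⟨e, he, rfl⟩ := ha
      exact ⟨e, (hact _ ih.1 e).2 he, rfl⟩
  obtain ⟨-, hpre, ε, hε, y, hy, hyL, c, hc, hρ⟩ := h
  have hval : ∀ v e, I.activeValue x' y v e = I.activeValue x y v e := by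
    intro v e
    unfold activeValue
    by_cases hv : v ∈ L
    · rw [hact v hv e]
    · rw [hyL v hv]; simp
  refine ⟨?_, hpre, ε, hε, y, ?_, hyL, c, hc, fun e => ?_⟩
  · refine isMaxStrongComponent_of_closed hL.1.1 (fun u hu v hv =>
      (hreach u hu v (hL.1.reach hu hv)).2) fun u hu v ha => ?_
    obtain ⟨e, he, rfl⟩ := ha
    exact hL.closed hx hu ⟨e, (hact u hu e).1 he, rfl⟩
  · rw [isBalanced_iff] at hy ⊢
    refine ⟨hy.1, fun v hv => hyL v fun hvL => hv (hreg v hvL), fun v hv => ?_, ?_⟩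
    · simp_rw [hval]
      by_cases hvL : v ∈ L
      · exact hy.2.2.1 v (hL.1.regular hvL)
      · have h1 : ∀ e ∈ I.star v, I.activeValue x y v e = 0 := fun e _ => by
          simp [activeValue, hyL v hvL]
        have h2 : ∀ e ∈ I.star v, I.activeValue x y (I.other v e) e = 0 := fun e he => by
          unfold activeValue
          split_ifs with ha
          · refine hyL _ fun hoL => hvL ?_
            exact hL.closed hx hoL ⟨e, ha, (other_other he).symm⟩
          · rfl
        rw [Finset.sum_eq_zero h1, Finset.sum_eq_zero h2]
    · rw [← hy.2.2.2]
      refine Finset.sum_congr rfl fun v _ => ?_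
      by_cases hv : v ∈ L
      · rw [heq v hv]
      · rw [hyL v hv]; simp
  · rw [hρ, delta_eq hx, delta_eq hx', hval, hval]

/-- The shift by `t` is a convex combination of `x` and the shift by `τ`. The bounds and the
comparisons of values within a tie are preserved by convex combinations, and an edge carried by the
combination is carried at one of the two ends. -/
lemma feasible_of_le (h : I.IsRotationOf x L ρ) (hx : I.Stable x) (hF : I.Feasible x ρ τ)
    (ht : 0 ≤ t) (htτ : t ≤ τ) : I.Feasible x ρ t := by
  rcases ht.eq_or_lt with rfl | ht
  · refine h.feasible_of_stable hx le_rfl ?_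
    rwa [shift_zero]
  have hτ := ht.trans_le htτ
  obtain ⟨h0, hb, hr⟩ := hF
  have hconv : ∀ e, shift x t ρ e = (1 - t / τ) * x e + t / τ * shift x τ ρ e := fun e => by
    simp only [shift]
    field_simp
    ring
  have hs0 : 0 ≤ t / τ := by positivity
  have hs1 : 0 ≤ 1 - t / τ := by
    rw [sub_nonneg, div_le_one hτ]; exact htτ
  refine ⟨fun e => ?_, fun e => ?_, fun e he => ?_⟩
  · rw [hconv]
    have h1 := hx.nonneg e
    have h2 := h0 e
    simp only [Pi.zero_apply] at *
    positivity
  · rw [hconv]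
    have h1 := mul_le_mul_of_nonneg_left (hx.le_cap e) hs1
    have h2 := mul_le_mul_of_nonneg_left (hb e) hs0
    linarith
  · have hrx := h.refuses hx he
    have hrτ := hr e he
    refine ⟨(size_shift h.2.1 x t _).trans hrx.1, fun a ha hpos => ?_⟩
    have hle : I.geq (Sum.inr (I.worker e)) e a → shift x t ρ a ≤ shift x t ρ e := by
      intro hg
      have h1 : x a ≤ x e := by
        rcases (hx.nonneg a).lt_or_eq with hp | h0
        · exact (hrx.2 a ha hp).2 hg
        · rw [← h0]; exact hx.nonneg e
      have h2 : shift x τ ρ a ≤ shift x τ ρ e := by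
        rcases (h0 a).lt_or_eq with hp | h0'
        · exact (hrτ.2 a ha hp).2 hg
        · rw [← h0']; exact h0 e
      rw [hconv, hconv]
      have h3 := mul_le_mul_of_nonneg_left h1 hs1
      have h4 := mul_le_mul_of_nonneg_left h2 hs0
      linarith
    refine ⟨?_, hle⟩
    by_contra hg
    have h1 : x a ≤ 0 := not_lt.1 fun hp => hg (hrx.2 a ha hp).1
    have h2 : shift x τ ρ a ≤ 0 := not_lt.1 fun hp => hg (hrτ.2 a ha hp).1
    rw [hconv] at hpos
    have h3 := mul_nonpos_of_nonneg_of_nonpos hs1 h1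
    have h4 := mul_nonpos_of_nonneg_of_nonpos hs0 h2
    linarith

/-- Head edges stay refused, and stay positive because they still decrease between `t` and `τ`. No
edge `e` joins: if it meets a head edge `d` at weight `t` and does not exceed it at `τ`, then by
linearity it was not below `d` at weight `0`, so it was in the head already. -/
lemma head_shift (h : I.IsRotationOf x L ρ) (hx : I.Stable x) (hF : I.Feasible x ρ τ)
    (ht : 0 ≤ t) (htτ : t < τ) {w : W} (hw : Sum.inr w ∈ L) :
    I.head (shift x t ρ) (Sum.inr w) = I.head x (Sum.inr w) := by
  have hFt := h.feasible_of_le hx hF ht htτ.le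
  have hS := h.stable_shift hx ht hFt
  have hneg : ∀ e ∈ I.head x (Sum.inr w), ρ e < 0 := fun e he => by
    have := mem_star_inr.1 (mem_star_of_mem_outHead (v := Sum.inr w) he)
    exact (h.neg_iff hx).2 ⟨by rwa [this], by rwa [this]⟩
  have hsub : ∀ e ∈ I.head x (Sum.inr w), e ∈ I.head (shift x t ρ) (Sum.inr w) := by
    intro e he
    have hn := hneg e he
    have hes := mem_star_of_mem_outHead (v := Sum.inr w) he
    rw [mem_head_iff hS]
    refine ⟨hes, by rw [← mem_star_inr.1 hes]; exact hFt.2.2 e hn, ?_⟩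
    refine lt_of_le_of_lt (hF.1 e) ?_
    have := shift_lt_of_neg (x := shift x t ρ) (sub_pos.2 htτ) hn
    rwa [shift_shift, add_sub_cancel] at this
  refine Finset.Subset.antisymm (fun e he => ?_) hsub
  obtain ⟨d, hd⟩ := head_nonempty hx.nonneg (h.regular hw).1
  have hd' := (mem_head_iff hS).1 (hsub d hd)
  have hdx := (mem_head_iff hx).1 hd
  obtain ⟨hes, her, hep⟩ := (mem_head_iff hS).1 he
  have hde := hd'.2.1.2 e hes hep
  have hed := her.2 d hd'.1 hd'.2.2
  have heq : shift x t ρ e = shift x t ρ d := le_antisymm (hde.2 hed.1) (hed.2 hde.1)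
  have hdτ : I.Refuses (Sum.inr w) (shift x τ ρ) d := by
    rw [← mem_star_inr.1 hd'.1]; exact hF.2.2 d (hneg d hd)
  have hτ : shift x τ ρ e ≤ shift x τ ρ d := by
    rcases (hF.1 e).lt_or_eq with hp | h0
    · exact (hdτ.2 e hes hp).2 hed.1
    · rw [← h0]; exact hF.1 d
  have hxd : x d ≤ x e := by
    by_contra! hlt
    have h1 : x e + t * ρ e = x d + t * ρ d := heq
    have h2 : x e + τ * ρ e ≤ x d + τ * ρ d := hτ
    have h3 : 0 < t * ((ρ e : ℝ) - ρ d) := by linarith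
    have h4 : (0 : ℝ) < ρ e - ρ d := pos_of_mul_pos_right h3 ht
    nlinarith
  have hxe : 0 < x e := hdx.2.2.trans_le hxd
  refine (mem_head_iff hx).2 ⟨hes, ⟨hdx.2.1.1, fun a ha hp => ?_⟩, hxe⟩
  have had := hdx.2.1.2 a ha hp
  exact ⟨geq_tr ha hdx.1 hes had.1 hed.1, fun hg =>
    (had.2 (geq_tr hdx.1 hes ha hed.1 hg)).trans hxd⟩

lemma refuses_worker_shift_iff (h : I.IsRotationOf x L ρ) (hx : I.Stable x)
    (hF : I.Feasible x ρ τ) (ht : 0 ≤ t) (htτ : t < τ) (e : E) :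
    I.Refuses (Sum.inr (I.worker e)) (shift x t ρ) e ↔ I.Refuses (Sum.inr (I.worker e)) x e := by
  have hFt := h.feasible_of_le hx hF ht htτ.le
  have hS := h.stable_shift hx ht hFt
  have hes := I.mem_star_worker e
  constructor
  · intro hr
    by_cases hL : Sum.inr (I.worker e) ∈ L
    swap
    · exact hr.congr hes fun a ha => h.shift_eq_of_not_mem hx hL t ha
    obtain ⟨d, hd⟩ := head_nonempty hx.nonneg (h.regular hL).1
    have hd' := hd
    rw [← h.head_shift hx hF ht htτ hL] at hd'
    rw [mem_head_iff hx] at hd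
    rw [mem_head_iff hS] at hd'
    have hde := hr.2 d hd.1 hd'.2.2
    rcases better_or_geq hd.1 hes with hb | hed
    · exact refuses_of_geq hd.1 hes hd.2.1 hb
    · have hpos := hd'.2.2.trans_le (hde.2 hed)
      have : e ∈ I.head (shift x t ρ) (Sum.inr (I.worker e)) :=
        (mem_head_iff hS).2 ⟨hes, hr, hpos⟩
      rw [h.head_shift hx hF ht htτ hL, mem_head_iff hx] at this
      exact this.2.1
  · intro hr
    rcases lt_or_ge (ρ e) 0 with hn | hp
    · exact hFt.2.2 e hn
    · exact (shift_pref hFt ht _).refuses hFt.1 (size_shift h.2.1 x t _) hes hr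
        (le_shift_of_nonneg ht hp)

/-- Edges not refused by their workers never decrease, and those that increase stay unsaturated
because they have room to grow until `τ > t`. Edges to deficit workers do not change, so the
candidates are the same. -/
lemma potentialHead_shift (h : I.IsRotationOf x L ρ) (hx : I.Stable x) (hF : I.Feasible x ρ τ)
    (ht : 0 ≤ t) (htτ : t < τ) (f : F) :
    I.potentialHead (shift x t ρ) f = I.potentialHead x f := by
  have hFt := h.feasible_of_le hx hF ht htτ.le
  have hS := h.stable_shift hx ht hFt
  have hsat : ∀ e, ¬ I.Refuses (Sum.inr (I.worker e)) x e →
      (shift x t ρ e < I.b e ↔ x e < I.b e) := by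
    intro e hr
    have hn : 0 ≤ ρ e := by
      by_contra! hn
      exact hr (h.refuses hx hn)
    refine ⟨fun hlt => (le_shift_of_nonneg ht hn).trans_lt hlt, fun hlt => ?_⟩
    rcases hn.lt_or_eq with hp | h0
    · have := lt_shift_of_pos (x := shift x t ρ) (sub_pos.2 htτ) hp
      rw [shift_shift, add_sub_cancel] at this
      exact this.trans_le (hF.2.1 e)
    · rwa [shift_of_zero h0.symm]
  have hcand : ∀ e, I.Candidate (shift x t ρ) f e ↔ I.Candidate x f e := by
    intro e
    rw [candidate_iff hS, candidate_iff hx, h.refuses_worker_shift_iff hx hF ht htτ]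
    refine and_congr_right fun he => ?_
    have hdef : (∀ e', I.firm e' = f → I.geq (Sum.inl f) e' e → shift x t ρ e' < I.b e' →
        I.Filled (shift x t ρ) (Sum.inr (I.worker e'))) ↔ (∀ e', I.firm e' = f →
        I.geq (Sum.inl f) e' e → x e' < I.b e' → I.Filled x (Sum.inr (I.worker e'))) := by
      refine forall_congr' fun a => forall_congr' fun _ => forall_congr' fun _ => ?_
      rw [filled_iff hS hx]
      by_cases hL : Sum.inr (I.worker a) ∈ L
      · simp [(h.regular hL).1]
      · rw [h.shift_eq_of_not_mem hx hL t (I.mem_star_worker a)]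
    rw [hdef]
    constructor
    · rintro ⟨h1, h2, h3⟩
      exact ⟨(hsat e h2).1 h1, h2, h3⟩
    · rintro ⟨h1, h2, h3⟩
      exact ⟨(hsat e h2).2 h1, h2, h3⟩
  ext e
  rw [mem_potentialHead, mem_potentialHead, filled_iff hS hx]
  simp_rw [hcand]

/-- A rotation stays applicable until it has been applied with its maximal weight. -/
lemma shift_of_lt (h : I.IsRotationOf x L ρ) (hx : I.Stable x) (hF : I.Feasible x ρ τ)
    (ht : 0 ≤ t) (htτ : t < τ) : I.IsRotationOf (shift x t ρ) L ρ := by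
  refine h.of_outHead_eq hx (h.stable_shift hx ht (h.feasible_of_le hx hF ht htτ.le)) ?_
  rintro (f | w) hv
  · exact h.potentialHead_shift hx hF ht htτ f
  · exact h.head_shift hx hF ht htτ hv

end IsRotationOf

/-! ### Existence of rotations -/

lemma sum_star_firm_worker {R : Type*} [AddCommMonoid R] (I : SMP F W E) (g : F ⊕ W → E → R) :
    ∑ v, ∑ e ∈ I.star v, g v e =
      ∑ e, g (Sum.inl (I.firm e)) e + ∑ e, g (Sum.inr (I.worker e)) e := by
  rw [Fintype.sum_sum_type]
  congr 1
  · rw [← Finset.sum_fiberwise Finset.univ I.firm]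
    refine Finset.sum_congr rfl fun f _ => Finset.sum_congr (by ext e; simp [mem_star_inl]) ?_
    intro e he
    rw [mem_star_inl.1 (by simpa [mem_star_inl] using he)]
  · rw [← Finset.sum_fiberwise Finset.univ I.worker]
    refine Finset.sum_congr rfl fun f _ => Finset.sum_congr (by ext e; simp [mem_star_inr]) ?_
    intro e he
    rw [mem_star_inr.1 (by simpa [mem_star_inr] using he)]

lemma sum_star_other {R : Type*} [AddCommMonoid R] (I : SMP F W E) (g : F ⊕ W → E → R) :
    ∑ v, ∑ e ∈ I.star v, g (I.other v e) e = ∑ v, ∑ e ∈ I.star v, g v e := by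
  rw [sum_star_firm_worker I g, sum_star_firm_worker I fun v e => g (I.other v e) e, add_comm]
  rfl

/-- The balance equations on a maximal strong component have a nonnegative nonzero rational
solution. -/
lemma exists_stationary_rat {I : SMP F W E} {x : E → ℝ} (hx : I.Stable x) {L : Set (F ⊕ W)}
    (hL : I.IsMaxStrongComponent x L) : ∃ y : F ⊕ W → ℚ, (∀ v, 0 ≤ y v) ∧ (∀ v ∉ L, y v = 0) ∧
      (∃ v ∈ L, 0 < y v) ∧ ∀ v, ∑ e ∈ I.star v, (if I.Active x v e then y v else 0) =
        ∑ e ∈ I.star v, (if I.Active x (I.other v e) e then y (I.other v e) else 0) := by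
  let g : (F ⊕ W → ℚ) → F ⊕ W → E → ℚ := fun y v e => if v ∈ L ∧ I.Active x v e then y v else 0
  have hg_out : ∀ y, ∀ v ∉ L, ∑ e ∈ I.star v, g y v e = 0 := fun y v hv =>
    Finset.sum_eq_zero fun e _ => if_neg fun h => hv h.1
  have hg_in : ∀ y, ∀ v ∉ L, ∑ e ∈ I.star v, g y (I.other v e) e = 0 := fun y v hv =>
    Finset.sum_eq_zero fun e he => if_neg fun h =>
      hv (hL.closed hx h.1 ⟨e, h.2, (other_other he).symm⟩)
  -- Net outflow on `L`; taking the identity outside `L` makes every kernel vector vanish there.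
  let T : (F ⊕ W → ℚ) →ₗ[ℚ] (F ⊕ W → ℚ) :=
    { toFun := fun y v => if v ∈ L then
        ∑ e ∈ I.star v, g y v e - ∑ e ∈ I.star v, g y (I.other v e) e else y v
      map_add' := fun y z => by
        have hadd : ∀ v e, g (y + z) v e = g y v e + g z v e := fun v e => by
          simp only [g]; split_ifs <;> simp
        funext v
        simp only [hadd, Finset.sum_add_distrib, Pi.add_apply]
        split_ifs <;> ring
      map_smul' := fun c y => by
        have hmul : ∀ v e, g (c • y) v e = c * g y v e := fun v e => by
          simp only [g]; split_ifs <;> simp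
        funext v
        simp only [hmul, ← Finset.mul_sum, Pi.smul_apply, smul_eq_mul, RingHom.id_apply]
        split_ifs <;> ring }
  have hTL : ∀ y, ∀ v ∈ L, T y v =
      ∑ e ∈ I.star v, g y v e - ∑ e ∈ I.star v, g y (I.other v e) e := fun y v hv => if_pos hv
  have hTn : ∀ y, ∀ v ∉ L, T y v = y v := fun y v hv => if_neg hv
  obtain ⟨u, hu⟩ := hL.1.1.nonempty
  -- Every active value leaves one vertex and enters another, and no flow from `L` leaves `L`. So
  -- the entries of `T y` on `L` sum to zero and the unit vector at `u` is not attained.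
  have hnotsurj : ¬ Function.Surjective T := by
    intro hs
    obtain ⟨y, hy⟩ := hs (Pi.single u 1)
    have h1 : ∑ v, (∑ e ∈ I.star v, g y v e - ∑ e ∈ I.star v, g y (I.other v e) e) = 0 := by
      rw [Finset.sum_sub_distrib, sum_star_other I (g y), sub_self]
    have h2 : ∀ v, ∑ e ∈ I.star v, g y v e - ∑ e ∈ I.star v, g y (I.other v e) e =
        (Pi.single u 1 : F ⊕ W → ℚ) v := by
      intro v
      by_cases hv : v ∈ L
      · rw [← hTL y v hv, hy]
      · rw [hg_out y v hv, hg_in y v hv, Pi.single_eq_of_ne (show v ≠ u from fun h => hv (h.symm ▸ hu)), sub_zero]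
    simp_rw [h2] at h1
    simp at h1
  have hninj : ¬ Function.Injective T := fun h => hnotsurj (LinearMap.injective_iff_surjective.1 h)
  rw [injective_iff_map_eq_zero] at hninj
  push Not at hninj
  obtain ⟨y, hTy, hy⟩ := hninj
  have hy0 : ∀ v ∉ L, y v = 0 := fun v hv => by rw [← hTn y v hv, hTy]; rfl
  have hyL : ∀ v, ∑ e ∈ I.star v, g y v e = ∑ e ∈ I.star v, g y (I.other v e) e := fun v => by
    by_cases hv : v ∈ L
    · rw [← sub_eq_zero, ← hTL y v hv, hTy]; rfl
    · rw [hg_out y v hv, hg_in y v hv]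
  have habs : ∀ v e, g (fun v => |y v|) v e = |g y v e| := fun v e => by
    simp only [g]; split_ifs <;> simp
  have hconst : ∀ v, |∑ e ∈ I.star v, g y v e| = ∑ e ∈ I.star v, g (fun v => |y v|) v e := by
    intro v
    simp only [g, ← Finset.sum_filter, Finset.sum_const, nsmul_eq_mul, abs_mul, Nat.abs_cast]
  -- Passing to absolute values gives nonnegativity. All outgoing terms at `v` are equal, so the
  -- outflow of `|y|` is the absolute value of the outflow of `y`, at most the inflow of `|y|`. Both
  -- sides have the same sum over all vertices, so equality holds everywhere.
  have hle : ∀ v, ∑ e ∈ I.star v, g (fun v => |y v|) v e ≤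
      ∑ e ∈ I.star v, g (fun v => |y v|) (I.other v e) e := by
    intro v
    rw [← hconst, hyL]
    simp_rw [habs]
    exact Finset.abs_sum_le_sum_abs _ _
  have heq : ∀ v, ∑ e ∈ I.star v, g (fun v => |y v|) v e =
      ∑ e ∈ I.star v, g (fun v => |y v|) (I.other v e) e := fun v =>
    (Finset.sum_eq_sum_iff_of_le fun v _ => hle v).1
      (sum_star_other I (g fun v => |y v|)).symm v (Finset.mem_univ v)
  refine ⟨fun v => |y v|, fun v => abs_nonneg _, fun v hv => by simp [hy0 v hv], ?_, fun v => ?_⟩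
  · by_contra! hcon
    refine hy (funext fun v => ?_)
    by_cases hv : v ∈ L
    · exact abs_nonpos_iff.1 (hcon v hv)
    · exact hy0 v hv
  · have hg : ∀ v e, g (fun v => |y v|) v e = if I.Active x v e then |y v| else 0 := fun v e => by
      by_cases hv : v ∈ L
      · simp [g, hv]
      · simp [g, hv, hy0 v hv]
    have := heq v
    simp_rw [hg] at this
    exact this

lemma exists_primitive_multiple {d : E → ℚ} (hd : ∃ e, d e ≠ 0) :
    ∃ ρ : E → ℤ, Finset.univ.gcd ρ = 1 ∧ ∃ c > (0 : ℚ), ∀ e, (ρ e : ℚ) = c * d e := by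
  obtain ⟨e₀, he₀⟩ := hd
  let D : ℕ := ∏ e, (d e).den
  have hD : 0 < D := Finset.prod_pos fun e _ => (d e).den_pos
  have hz : ∀ e, ∃ z : ℤ, (z : ℚ) = D * d e := by
    intro e
    obtain ⟨k, hk⟩ : (d e).den ∣ D := Finset.dvd_prod_of_mem _ (Finset.mem_univ e)
    refine ⟨k * (d e).num, ?_⟩
    rw [hk]
    push_cast
    rw [← Rat.mul_den_eq_num (d e)]
    ring
  choose z hz using hz
  obtain ⟨ρ, hρ, hgcd⟩ := Finset.extract_gcd z (s := Finset.univ) ⟨e₀, Finset.mem_univ _⟩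
  set G := Finset.univ.gcd z with hG
  have hDq : (0 : ℚ) < D := by exact_mod_cast hD
  have hG0 : 0 ≤ G := by
    rw [hG, ← Finset.normalize_gcd]
    exact Int.nonneg_of_normalize_eq_self (normalize_idem _)
  have hGpos : 0 < G := by
    refine hG0.lt_of_ne fun h => ?_
    have h1 := hρ e₀ (Finset.mem_univ _)
    rw [← h, zero_mul] at h1
    have h2 := hz e₀
    rw [h1, Int.cast_zero] at h2
    exact (mul_ne_zero hDq.ne' he₀) h2.symm
  have hGq : (0 : ℚ) < G := by exact_mod_cast hGpos
  refine ⟨ρ, hgcd, D / G, by positivity, fun e => ?_⟩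
  have h1 := hρ e (Finset.mem_univ _)
  have h2 := hz e
  rw [h1] at h2
  push_cast at h2
  field_simp
  linarith

lemma adjacent_of_mem_star {I : SMP F W E} {v : F ⊕ W} {a c : E} (ha : a ∈ I.star v)
    (hc : c ∈ I.star v) : I.firm a = I.firm c ∨ I.worker a = I.worker c := by
  cases v
  · exact Or.inl ((mem_star_inl.1 ha).trans (mem_star_inl.1 hc).symm)
  · exact Or.inr ((mem_star_inr.1 ha).trans (mem_star_inr.1 hc).symm)

/-- Every maximal strong component has a rotation. -/
lemma exists_rotation {I : SMP F W E} {x : E → ℝ} (hx : I.Stable x) {L : Set (F ⊕ W)}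
    (hL : I.IsMaxStrongComponent x L) : ∃ ρ, I.IsRotationOf x L ρ := by
  obtain ⟨y, hy0, hyL, ⟨u, huL, hu⟩, hbal⟩ := exists_stationary_rat hx hL
  let Y : F ⊕ W → ℝ := fun v => (y v : ℝ)
  have hbalR : ∀ v, ∑ e ∈ I.star v, I.activeValue x Y v e =
      ∑ e ∈ I.star v, I.activeValue x Y (I.other v e) e := fun v => by
    have hcast : ∀ v e, ((if I.Active x v e then y v else 0 : ℚ) : ℝ) =
        I.activeValue x Y v e := fun v e => by
      simp only [activeValue, Y]; split_ifs <;> simp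
    simp_rw [← hcast]
    exact_mod_cast hbal v
  have hYreg : ∀ v, ¬ I.Regular x v → Y v = 0 := fun v hv => by
    have := hyL v fun h => hv (hL.1.regular h)
    simp [Y, this]
  have hY0 : ∀ v, 0 ≤ Y v := fun v => Rat.cast_nonneg.2 (hy0 v)
  have hB : I.IsBalanced x (∑ v, ((I.outHead x v).card : ℝ) * Y v) Y :=
    isBalanced_iff.2 ⟨hY0, hYreg, fun v _ => hbalR v, rfl⟩
  have hYpos : ∀ v ∈ L, 0 < Y v := fun v hv =>
    hB.pos_of_reach hx (hL.1.reach huL hv) (Rat.cast_pos.2 hu)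
  let A : F ⊕ W → E → ℚ := fun v e => if I.Active x v e then y v else 0
  have hA : ∀ v e, (A v e : ℝ) = I.activeValue x Y v e := fun v e => by
    simp only [A, activeValue, Y]; split_ifs <;> simp
  let d : E → ℚ := fun e => A (Sum.inl (I.firm e)) e - A (Sum.inr (I.worker e)) e
  have hd : ∀ e, (d e : ℝ) = I.delta x Y e := fun e => by
    rw [delta_eq hx, ← hA, ← hA]; simp [d]
  have hdelta : ∀ v ∈ L, ∀ e ∈ I.outHead x v, I.delta x Y e ≠ 0 := by
    intro v hv e he
    have hact : I.Active x v e := ⟨hL.1.regular hv, he⟩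
    cases v with
    | inl f =>
      obtain rfl := firm_of_mem_potentialHead he
      simp [delta, hact, (hYpos _ hv).ne']
    | inr w =>
      obtain rfl := mem_star_inr.1 (mem_star_of_mem_outHead he)
      have hnf : ¬ I.Active x (Sum.inl (I.firm e)) e := fun h => not_active_worker hx h hact
      simp [delta, hact, hnf, (hYpos _ hv).ne']
  obtain ⟨e₁, he₁⟩ := outHead_nonempty hx (hL.1.regular huL)
  have hd1 : d e₁ ≠ 0 := fun h => hdelta u huL e₁ he₁ (by rw [← hd, h]; simp)
  obtain ⟨ρ, hgcd, c, hc, hρ⟩ := exists_primitive_multiple ⟨e₁, hd1⟩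
  have hρR : ∀ e, (ρ e : ℝ) = c * I.delta x Y e := fun e => by
    rw [← hd]; exact_mod_cast hρ e
  have hcR : (0 : ℝ) < c := by exact_mod_cast hc
  have hρne : ∀ e, ρ e ≠ 0 ↔ I.delta x Y e ≠ 0 := fun e => by
    rw [← Int.cast_ne_zero (α := ℝ), hρR, mul_ne_zero_iff]
    exact and_iff_right hcR.ne'
  have hpos : ∀ e, 0 < ρ e → ρ e = (c : ℝ) * Y (Sum.inl (I.firm e)) := fun e he => by
    rw [hρR]
    have : 0 < I.delta x Y e := by
      rw [← Int.cast_pos (R := ℝ), hρR] at he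
      exact pos_of_mul_pos_right he hcR.le
    unfold delta at this ⊢
    split_ifs at this ⊢ with h1 h2
    · rfl
    · linarith [hY0 (Sum.inr (I.worker e))]
    · exact absurd this (lt_irrefl _)
  have hneg : ∀ e, ρ e < 0 → ρ e = (c : ℝ) * -Y (Sum.inr (I.worker e)) := fun e he => by
    rw [hρR]
    have : I.delta x Y e < 0 := by
      rw [← Int.cast_lt_zero (R := ℝ), hρR] at he
      by_contra! h
      exact absurd (mul_nonneg hcR.le h) (not_le.2 he)
    unfold delta at this ⊢
    split_ifs at this ⊢ with h1 h2
    · linarith [hY0 (Sum.inl (I.firm e))]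
    · rfl
    · exact absurd this (lt_irrefl _)
  have hsupp : ∀ e, ρ e ≠ 0 → ∃ v ∈ L, I.Active x v e := by
    intro e he
    rw [hρne, delta] at he
    split_ifs at he with h1 h2
    · refine ⟨_, by_contra fun hn => he ?_, h1⟩
      simp [Y, hyL _ hn]
    · refine ⟨_, by_contra fun hn => he ?_, h2⟩
      simp [Y, hyL _ hn]
    · exact absurd rfl he
  refine ⟨ρ, hL, ⟨?_, fun v => ?_, fun e e' hf he he' => ?_, fun e e' hw he he' => ?_, hgcd,
    fun e e' he he' => ?_⟩, _, ?_, Y, hB, fun v hv => by simp [Y, hyL v hv], c, hcR, hρR⟩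
  · intro h
    exact (hρne e₁).2 (hdelta u huL e₁ he₁) (congrFun h e₁)
  · have : ∑ e ∈ I.star v, (ρ e : ℝ) = 0 := by
      simp_rw [hρR, ← Finset.mul_sum, delta_eq hx, Finset.sum_sub_distrib]
      refine mul_eq_zero_of_right _ ?_
      have h := hbalR v
      cases v with
      | inl f =>
        rw [sub_eq_zero]
        refine Eq.trans (Finset.sum_congr rfl fun e he => ?_) h
        rw [mem_star_inl.1 he]
      | inr w =>
        rw [sub_eq_zero, eq_comm]
        refine Eq.trans (Finset.sum_congr rfl fun e he => ?_) h
        rw [mem_star_inr.1 he]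
    exact_mod_cast this
  · have h1 := hpos e he
    have h2 := hpos e' he'
    rw [hf, ← h2] at h1
    exact_mod_cast h1
  · have h1 := hneg e he
    have h2 := hneg e' he'
    rw [hw, ← h2] at h1
    exact_mod_cast h1
  · obtain ⟨v, hv, hve⟩ := hsupp e he
    obtain ⟨v', hv', hve'⟩ := hsupp e' he'
    -- Connectedness of the support: each arc of a walk inside `L` is carried by an edge with
    -- nonzero `ρ`, and consecutive ones share a vertex.
    have key : ∀ a, I.Reach x v a → a ∈ L ∧ ∀ k ∈ I.star a, ρ k ≠ 0 →
        Relation.ReflTransGen (fun a c => ρ a ≠ 0 ∧ ρ c ≠ 0 ∧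
          (I.firm a = I.firm c ∨ I.worker a = I.worker c)) e k := by
      intro a ha
      induction ha with
      | refl => exact ⟨hv, fun k hk hk0 => Relation.ReflTransGen.single ⟨he, hk0,
          adjacent_of_mem_star (mem_star_of_mem_outHead hve.2) hk⟩⟩
      | tail _ harc ih =>
        refine ⟨hL.closed hx ih.1 harc, fun k hk hk0 => ?_⟩
        obtain ⟨j, hj, rfl⟩ := harc
        have hj0 : ρ j ≠ 0 := (hρne j).2 (hdelta _ ih.1 j hj.2)
        exact (ih.2 j (mem_star_of_mem_outHead hj.2) hj0).tail ⟨hj0, hk0,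
          adjacent_of_mem_star (other_mem_star _ j) hk⟩
    exact (key v' (hL.1.reach hv hv')).2 e' (mem_star_of_mem_outHead hve'.2) he'
  · refine Finset.sum_pos' (fun v _ => mul_nonneg (Nat.cast_nonneg _) (hY0 v))
      ⟨u, Finset.mem_univ u, mul_pos ?_ (hYpos u huL)⟩
    exact_mod_cast Finset.card_pos.2 ⟨e₁, he₁⟩

/-! ### Rotations between comparable stable assignments -/

/-- Strict inequalities persist for small weights. At a worker, edges worse than a decreasing edge
`e` are refused and hence not raised, and edges of the tie that equal `x e` lie in the head, where
they decrease at the same rate as `e`. -/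
lemma IsRotationOf.eventually_feasible {I : SMP F W E} {x : E → ℝ} {L : Set (F ⊕ W)} {ρ : E → ℤ}
    (h : I.IsRotationOf x L ρ) (hx : I.Stable x) :
    ∀ᶠ t in nhdsWithin (0 : ℝ) (Set.Ioi 0), I.Feasible x ρ t := by
  have hlim : ∀ e, Filter.Tendsto (fun t => shift x t ρ e) (nhdsWithin (0 : ℝ) (Set.Ioi 0))
      (nhds (x e)) := fun e => by
    have hc : Continuous fun t : ℝ => shift x t ρ e := by unfold shift; fun_prop
    have := hc.tendsto 0
    rw [shift_zero] at this
    exact this.mono_left nhdsWithin_le_nhds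
  have hpos : ∀ᶠ t in nhdsWithin (0 : ℝ) (Set.Ioi 0), (0 : ℝ) < t := self_mem_nhdsWithin
  have h0 : ∀ᶠ t in nhdsWithin (0 : ℝ) (Set.Ioi 0), ∀ e, 0 ≤ shift x t ρ e := by
    rw [Filter.eventually_all]
    intro e
    rcases lt_or_ge (ρ e) 0 with hn | hp
    · exact ((hlim e).eventually_const_lt (h.val_pos hx hn)).mono fun t ht => ht.le
    · exact hpos.mono fun t ht => (hx.nonneg e).trans (le_shift_of_nonneg ht.le hp)
  have hb : ∀ᶠ t in nhdsWithin (0 : ℝ) (Set.Ioi 0), ∀ e, shift x t ρ e ≤ I.b e := by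
    rw [Filter.eventually_all]
    intro e
    rcases lt_or_ge 0 (ρ e) with hp | hn
    · exact ((hlim e).eventually_lt_const (lt_cap_of_mem_potentialHead
        ((h.pos_iff hx).1 hp).2)).mono fun t ht => ht.le
    · exact hpos.mono fun t ht => (shift_le_of_nonpos ht.le hn).trans (hx.le_cap e)
  have hlt : ∀ᶠ t in nhdsWithin (0 : ℝ) (Set.Ioi 0), ∀ a e, x a < x e →
      shift x t ρ a < shift x t ρ e := by
    rw [Filter.eventually_all]
    intro a
    rw [Filter.eventually_all]
    intro e
    by_cases hae : x a < x e
    · exact ((hlim a).eventually_lt (hlim e) hae).mono fun t ht _ => ht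
    · exact Filter.Eventually.of_forall fun t ht => absurd ht hae
  filter_upwards [hpos, h0, hb, hlt] with t ht h0 hb hlt
  refine ⟨h0, hb, fun e he => ?_⟩
  have hr := h.refuses hx he
  have hes := I.mem_star_worker e
  refine ⟨(size_shift h.2.1 x t _).trans hr.1, fun a ha hap => ?_⟩
  have hae : I.geq (Sum.inr (I.worker e)) a e := by
    by_contra hn
    have hb : I.better (Sum.inr (I.worker e)) e a := (better_or_geq hes ha).resolve_right hn
    have hρa : ρ a ≤ 0 := by
      by_contra! hp
      refine h.not_refuses hx hp ?_
      rw [mem_star_inr.1 ha]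
      exact refuses_of_geq hes ha hr hb
    exact hn (hr.2 a ha (hap.trans_le (shift_le_of_nonpos ht.le hρa))).1
  refine ⟨hae, fun hea => ?_⟩
  have hxa : x a ≤ x e := by
    rcases (hx.nonneg a).lt_or_eq with hp | h0
    · exact (hr.2 a ha hp).2 hea
    · rw [← h0]; exact hx.nonneg e
  rcases hxa.lt_or_eq with hl | heq
  · exact (hlt a e hl).le
  · have hah : a ∈ I.head x (Sum.inr (I.worker e)) := by
      refine (mem_head_iff hx).2 ⟨ha, ⟨hr.1, fun k hk hkp => ?_⟩, heq ▸ h.val_pos hx he⟩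
      have := hr.2 k hk hkp
      exact ⟨geq_tr hk hes ha this.1 hea, fun hg => heq ▸ this.2 (geq_tr hes ha hk hea hg)⟩
    have hρa : ρ a < 0 := by
      have hwa := mem_star_inr.1 ha
      refine (h.neg_iff hx).2 ?_
      rw [hwa]
      exact ⟨((h.neg_iff hx).1 he).1, hah⟩
    have := h.2.1.2.2.2.1 a e (mem_star_inr.1 ha) hρa he
    simp [shift, this, heq]

/-- The vertices at which two assignments differ. -/
def changed (I : SMP F W E) (x y : E → ℝ) : Set (F ⊕ W) := {v | ∃ e ∈ I.star v, x e ≠ y e}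

lemma eq_of_not_mem_changed {I : SMP F W E} {x y : E → ℝ} {v : F ⊕ W} (h : v ∉ I.changed x y)
    {e : E} (he : e ∈ I.star v) : x e = y e :=
  by_contra fun hne => h ⟨e, he, hne⟩

namespace StableAssignment

variable {I : SMP F W E} {z y : I.StableAssignment}

lemma size_eq (z y : I.StableAssignment) (v : F ⊕ W) : I.size z.val v = I.size y.val v :=
  z.stable.size_eq y.stable v

lemma refuses_worker_of_lt (h : z ≤ y) {e : E} (he : y.val e < z.val e) :
    I.Refuses (Sum.inr (I.worker e)) y.val e :=
  le_iff_refuses.1 h e he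

lemma refuses_firm_of_lt (h : z ≤ y) {e : E} (he : z.val e < y.val e) :
    I.Refuses (Sum.inl (I.firm e)) z.val e :=
  le_iff_pref_firm.1 h e e (I.mem_star_side true e) he

lemma exists_lt_of_mem_changed {v : F ⊕ W} (hv : v ∈ I.changed z.val y.val) :
    (∃ e ∈ I.star v, z.val e < y.val e) ∧ ∃ e ∈ I.star v, y.val e < z.val e := by
  obtain ⟨e, he, hne⟩ := hv
  rcases lt_or_gt_of_ne hne with h | h
  · exact ⟨⟨e, he, h⟩, exists_gt_of_exists_lt (size_eq y z v).le he h⟩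
  · exact ⟨exists_gt_of_exists_lt (size_eq z y v).le he h, e, he, h⟩

lemma not_refuses_worker_of_lt (h : z ≤ y) {e : E} (he : z.val e < y.val e) :
    ¬ I.Refuses (Sum.inr (I.worker e)) z.val e := fun hr =>
  absurd ((h e).le_of_refuses y.stable.nonneg z.stable.nonneg (size_eq y z _)
    (I.mem_star_worker e) hr) (not_le.2 he)

lemma filled_of_mem_changed (h : z ≤ y) {v : F ⊕ W} (hv : v ∈ I.changed z.val y.val) :
    I.Filled z.val v := by
  obtain ⟨⟨e, he, hlt⟩, e', he', hlt'⟩ := exists_lt_of_mem_changed hv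
  cases v with
  | inl f =>
    have := (refuses_firm_of_lt h hlt).1
    rwa [mem_star_inl.1 he] at this
  | inr w =>
    have := (refuses_worker_of_lt h hlt').1
    rw [mem_star_inr.1 he', size_eq y z] at this
    exact this

lemma lt_of_mem_head (h : z ≤ y) {w : W} (hw : Sum.inr w ∈ I.changed z.val y.val) {e : E}
    (he : e ∈ I.head z.val (Sum.inr w)) : y.val e < z.val e := by
  obtain ⟨hes, hr, hp⟩ := (mem_head_iff z.stable).1 he
  have hP : I.Pref (Sum.inr w) y.val z.val := by
    have := h e
    rwa [side, mem_star_inr.1 hes] at this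
  by_contra! hle
  have hle' := hP.le_of_refuses y.stable.nonneg z.stable.nonneg (size_eq y z _) hes hr
  have hry := hP.refuses y.stable.nonneg (size_eq y z _) hes hr hle
  obtain ⟨a, ha, hlt⟩ := (exists_lt_of_mem_changed hw).2
  have h1 := hr.2 a ha ((y.stable.nonneg a).trans_lt hlt)
  have h2 := (hP a ha hlt).2 e hes (hp.trans_le hle)
  have h3 := h1.2 h2.1
  have h4 := h2.2 h1.1
  linarith

/-- By polarity the firm refuses the growing edge `a` under `z`. If it also refused `e` under `y`,
then `a` and `e` would be tied and `z e ≤ z a < y a ≤ y e`, against `y e ≤ z e`. So stability of `y`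
leaves the worker. -/
lemma refuses_worker_of_geq (h : z ≤ y) {e a : E} (ha : z.val a < y.val a)
    (hf : I.firm e = I.firm a) (hg : I.geq (Sum.inl (I.firm a)) e a) (hle : y.val e ≤ z.val e)
    (hlt : y.val e < I.b e) : I.Refuses (Sum.inr (I.worker e)) y.val e := by
  refine ((stable_iff.1 y.stable).2.2.2 e hlt).resolve_left fun hr => ?_
  have hra := refuses_firm_of_lt h ha
  rw [hf] at hr
  have hes : e ∈ I.star (Sum.inl (I.firm a)) := mem_star_inl.2 hf
  have hap := (z.stable.nonneg a).trans_lt ha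
  have h1 := hr.2 a (I.mem_star_firm a) hap
  have h2 := h1.2 hg
  have h3 := hra.2 e hes (hap.trans_le (h2.trans hle))
  have h4 := h3.2 h1.1
  linarith

lemma candidate_of_lt (h : z ≤ y) {a : E} (ha : z.val a < y.val a) :
    I.Candidate z.val (I.firm a) a := by
  refine (candidate_iff z.stable).2 ⟨rfl, ha.trans_le (y.stable.le_cap a),
    not_refuses_worker_of_lt h ha, fun e hf hg hlt => ?_⟩
  by_contra hnf
  have hnc : Sum.inr (I.worker e) ∉ I.changed z.val y.val :=
    fun hc => hnf (filled_of_mem_changed h hc)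
  have heq := eq_of_not_mem_changed hnc (I.mem_star_worker e)
  have := refuses_worker_of_geq h ha hf hg heq.ge (heq ▸ hlt)
  exact hnf ((size_eq z y _).trans this.1)

lemma exists_geq_of_mem_potentialHead (h : z ≤ y) {f : F}
    (hf : Sum.inl f ∈ I.changed z.val y.val) {e : E} (he : e ∈ I.potentialHead z.val f) :
    ∃ a, I.firm a = f ∧ z.val a < y.val a ∧ I.geq (Sum.inl f) e a := by
  obtain ⟨a, ha, hlt⟩ := (exists_lt_of_mem_changed hf).1
  obtain rfl := mem_star_inl.1 ha
  exact ⟨a, rfl, hlt, (mem_potentialHead.1 he).2.2 a (candidate_of_lt h hlt)⟩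

/-- An edge of the potential head of a changed firm is at least as good as some growing edge. If its
worker were unchanged, the worker would refuse it under `y`, hence under `z`, which is excluded for
the potential head. At a changed worker every head edge strictly decreases. -/
lemma other_mem_changed (h : z ≤ y) {v : F ⊕ W} (hv : v ∈ I.changed z.val y.val) {e : E}
    (he : e ∈ I.outHead z.val v) : I.other v e ∈ I.changed z.val y.val := by
  cases v with
  | inl f =>
    obtain ⟨a, rfl, hlt, hg⟩ := exists_geq_of_mem_potentialHead h hv he
    by_contra hn
    have heq : ∀ k ∈ I.star (Sum.inr (I.worker e)), z.val k = y.val k :=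
      fun k hk => eq_of_not_mem_changed hn hk
    have hes := I.mem_star_worker e
    have hr := refuses_worker_of_geq h hlt (firm_of_mem_potentialHead he) hg (heq e hes).ge
      (heq e hes ▸ lt_cap_of_mem_potentialHead he)
    exact not_refuses_of_mem_potentialHead z.stable he
      (hr.congr hes fun k hk => (heq k hk).symm)
  | inr w => exact ⟨e, I.mem_star_firm e, (lt_of_mem_head h hv he).ne'⟩

/-- The cleaning procedure never reaches a changed vertex: changed vertices are filled, growing
edges are candidates for their firms, and active arcs lead to changed vertices only. -/
lemma regular_of_mem_changed (h : z ≤ y) {v : F ⊕ W} (hv : v ∈ I.changed z.val y.val) :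
    I.Regular z.val v := by
  refine ⟨filled_of_mem_changed h hv, fun hs => ?_⟩
  induction hs with
  | worker w e _ he hnf => exact hnf (filled_of_mem_changed h (other_mem_changed h hv he))
  | firm f hf hemp =>
    obtain ⟨a, ha, hlt⟩ := (exists_lt_of_mem_changed hv).1
    let C := (I.star (Sum.inl f)).filter fun e => I.Candidate z.val f e
    have hC : C.Nonempty := ⟨a, Finset.mem_filter.2 ⟨ha, by
      rw [← mem_star_inl.1 ha]; exact candidate_of_lt h hlt⟩⟩
    obtain ⟨m, hm, hmax⟩ := exists_best C (Finset.filter_subset _ _) hC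
    refine Finset.ne_empty_of_mem (a := m) ?_ hemp
    exact mem_potentialHead.2 ⟨hf, (Finset.mem_filter.1 hm).2, fun e he =>
      hmax e (Finset.mem_filter.2 ⟨he.1, he⟩)⟩
  | step v e _ he _ ih => exact ih (other_mem_changed h hv he)

lemma mem_changed_of_reach (h : z ≤ y) {u v : F ⊕ W} (hu : u ∈ I.changed z.val y.val)
    (hr : I.Reach z.val u v) : v ∈ I.changed z.val y.val := by
  induction hr with
  | refl => exact hu
  | tail _ ha ih =>
    obtain ⟨e, he, rfl⟩ := ha
    exact other_mem_changed h ih he.2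

/-- A rotation of a component on which `z` and `y` differ leads from `z` towards `y`. -/
lemma eventually_shift_le (h : z ≤ y) {L : Set (F ⊕ W)} {ρ : E → ℤ}
    (hρ : I.IsRotationOf z.val L ρ) (hL : L ⊆ I.changed z.val y.val) :
    ∀ᶠ t in nhdsWithin (0 : ℝ) (Set.Ioi 0),
      ∀ e, y.val e < shift z.val t ρ e → I.Refuses (Sum.inr (I.worker e)) y.val e := by
  have hlim : ∀ e, Filter.Tendsto (fun t => shift z.val t ρ e) (nhdsWithin (0 : ℝ) (Set.Ioi 0))
      (nhds (z.val e)) := fun e => by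
    have hc : Continuous fun t : ℝ => shift z.val t ρ e := by unfold shift; fun_prop
    have := hc.tendsto 0
    rw [shift_zero] at this
    exact this.mono_left nhdsWithin_le_nhds
  rw [Filter.eventually_all]
  intro e
  rcases lt_or_ge 0 (ρ e) with hp | hn
  · obtain ⟨hfL, heD⟩ := (hρ.pos_iff z.stable).1 hp
    rcases lt_or_ge (z.val e) (y.val e) with hlt | hle
    · filter_upwards [(hlim e).eventually_lt_const hlt] with t ht hlt'
      exact absurd ht hlt'.not_gt
    · obtain ⟨a, haf, halt, hg⟩ := exists_geq_of_mem_potentialHead h (hL hfL) heD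
      have := refuses_worker_of_geq h halt haf.symm (by rwa [haf]) hle
        (hle.trans_lt (lt_cap_of_mem_potentialHead heD))
      exact Filter.Eventually.of_forall fun _ _ => this
  · filter_upwards [self_mem_nhdsWithin] with t ht hlt
    exact refuses_worker_of_lt h (hlt.trans_le (shift_le_of_nonpos (le_of_lt ht) hn))

/-- A maximal component reached from a changed vertex consists of changed vertices, so its rotation
can be applied with a small positive weight without leaving the region below `y`. -/
lemma exists_rotation_of_lt (h : z < y) : ∃ L ρ, I.IsRotationOf z.val L ρ ∧
    ∃ t > 0, ∃ z' : I.StableAssignment, z'.val = shift z.val t ρ ∧ z' ≤ y := by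
  obtain ⟨e, he⟩ : ∃ e, z.val e ≠ y.val e := by
    by_contra! hcon
    exact h.ne (eq_of_val_eq (funext hcon))
  have hc : Sum.inl (I.firm e) ∈ I.changed z.val y.val := ⟨e, I.mem_star_firm e, he⟩
  obtain ⟨L, hL, hreach⟩ := exists_maxStrongComponent z.stable (regular_of_mem_changed h.le hc)
  obtain ⟨ρ, hρ⟩ := exists_rotation z.stable hL
  have hsub : L ⊆ I.changed z.val y.val := fun v hv => mem_changed_of_reach h.le hc (hreach v hv)
  obtain ⟨t, ⟨hF, hle⟩, ht⟩ := ((hρ.eventually_feasible z.stable).and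
    (eventually_shift_le h.le hρ hsub)).and self_mem_nhdsWithin |>.exists
  have ht' : 0 < t := ht
  exact ⟨L, ρ, hρ, t, ht', ⟨_, hρ.stable_shift z.stable ht'.le hF⟩, rfl, le_iff_refuses.2 hle⟩

lemma le_of_shift {z' : I.StableAssignment} {L : Set (F ⊕ W)} {ρ : E → ℤ} {t : ℝ}
    (hρ : I.IsRotationOf z.val L ρ) (ht : 0 ≤ t) (hz' : z'.val = shift z.val t ρ) : z ≤ z' := by
  have hF := hρ.feasible_of_stable z.stable ht (hz' ▸ z'.stable)
  refine le_def.2 fun e => ?_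
  rw [hz']
  exact IsRotationOf.shift_pref hF ht _

/-- The stable assignments between `z` and a rotational shift of `z` are rotational shifts. -/
lemma exists_shift_of_between {z' : I.StableAssignment} {L : Set (F ⊕ W)} {ρ : E → ℤ} {τ : ℝ}
    (hρ : I.IsRotationOf z.val L ρ) (hτ : 0 ≤ τ) (hz' : z'.val = shift z.val τ ρ) (hzy : z ≤ y)
    (hyz' : y ≤ z') : ∃ t, 0 ≤ t ∧ t ≤ τ ∧ y.val = shift z.val t ρ := by
  have hF := hρ.feasible_of_stable z.stable hτ (hz' ▸ z'.stable)
  let A : Set ℝ := Set.Icc 0 τ ∩ {t | ∀ e, y.val e < shift z.val t ρ e →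
    I.Refuses (Sum.inr (I.worker e)) y.val e}
  have hclosed : IsClosed {t : ℝ | ∀ e, y.val e < shift z.val t ρ e →
      I.Refuses (Sum.inr (I.worker e)) y.val e} := by
    rw [Set.ofPred_forall]
    refine isClosed_iInter fun e => ?_
    by_cases hr : I.Refuses (Sum.inr (I.worker e)) y.val e
    · simp [hr]
    · simp only [hr, imp_false, not_lt]
      exact isClosed_le (by unfold shift; fun_prop) continuous_const
  have hA : IsCompact A := isCompact_Icc.inter_right hclosed
  obtain ⟨t, ⟨⟨ht0, htτ⟩, htA⟩, hmax⟩ := hA.exists_isGreatest ⟨0, ⟨le_rfl, hτ⟩, by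
    rw [Set.mem_ofPred_eq, shift_zero]; exact le_iff_refuses.1 hzy⟩
  refine ⟨t, ht0, htτ, ?_⟩
  have hSt := hρ.stable_shift z.stable ht0 (hρ.feasible_of_le z.stable hF ht0 htτ)
  let s : I.StableAssignment := ⟨shift z.val t ρ, hSt⟩
  have hsy : s ≤ y := le_iff_refuses.2 htA
  rcases htτ.eq_or_lt with rfl | hlt
  · have : s = z' := eq_of_val_eq hz'.symm
    rw [this] at hsy
    rw [le_antisymm hyz' hsy, hz']
  by_contra hne
  have hρs : I.IsRotationOf s.val L ρ := hρ.shift_of_lt z.stable hF ht0 hlt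
  -- Off `L` the assignments `s` and `z'` agree, and `y` is squeezed between them. So `s` and `y`
  -- differ only on `L`, and by strong connectivity on all of `L`. A further small step along `ρ`
  -- then stays below `y`, against maximality of `t`.
  have hsub : I.changed s.val y.val ⊆ L := by
    intro v hv
    by_contra hvL
    obtain ⟨e, he, hne⟩ := hv
    have heq : ∀ k ∈ I.star v, s.val k = z'.val k := fun k hk => by
      rw [hz']
      exact (hρ.shift_eq_of_not_mem z.stable hvL t hk).trans
        (hρ.shift_eq_of_not_mem z.stable hvL τ hk).symm
    refine hne ?_
    rcases mem_star.1 he with rfl | rfl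
    · have h1 := le_iff_pref_firm.1 hsy e
      have h2 := le_iff_pref_firm.1 hyz' e
      refine h1.antisymm (fun a ha hlt => ?_) s.stable.nonneg y.stable.nonneg (size_eq _ _ _) he
      exact h2 a ha (hlt.trans_eq (heq a ha))
    · have h1 := hsy e
      have h2 := hyz' e
      refine (h1.antisymm (fun a ha hlt => ?_) y.stable.nonneg s.stable.nonneg
        (size_eq _ _ _) he).symm
      exact (h2 a ha (by rwa [← heq a ha])).congr ha fun k hk => (heq k hk).symm
  obtain ⟨e, he⟩ : ∃ e, s.val e ≠ y.val e := by
    by_contra! hcon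
    exact hne (funext hcon).symm
  have hc : Sum.inl (I.firm e) ∈ I.changed s.val y.val := ⟨e, I.mem_star_firm e, he⟩
  have hLsub : L ⊆ I.changed s.val y.val := fun v hv =>
    mem_changed_of_reach hsy hc (hρs.1.1.reach (hsub hc) hv)
  obtain ⟨r, ⟨hle, hrτ⟩, hr⟩ := ((eventually_shift_le hsy hρs hLsub).and
    (nhdsWithin_le_nhds (Iio_mem_nhds (sub_pos.2 hlt)))).and self_mem_nhdsWithin |>.exists
  have hr' : 0 < r := hr
  have hrτ' : r < τ - t := hrτ
  have hmem : t + r ∈ A := by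
    refine ⟨⟨by linarith, by linarith⟩, ?_⟩
    rw [Set.mem_ofPred_eq, ← shift_shift]
    exact hle
  have := hmax hmem
  linarith

end StableAssignment

/-! ### Rotational steps in the lattice of stable assignments -/

/-- Cross multiplication and the gcd condition give equal absolute values; the signs of `a` and `c`
exclude opposite nonzero entries. Allowing `c = 0` saves the users a separate case. -/
lemma eq_of_proportional {ρ σ : E → ℤ} (hρ : Finset.univ.gcd ρ = 1) (hσ : Finset.univ.gcd σ = 1)
    {a c : ℝ} (ha : 0 < a) (hc : 0 ≤ c) (h : ∀ e, a * ρ e = c * σ e) : ρ = σ := by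
  funext e₀
  have hcross : ∀ e, ρ e * σ e₀ = σ e * ρ e₀ := fun e => by
    have : a * (ρ e * σ e₀ : ℝ) = a * (σ e * ρ e₀) := by
      linear_combination (σ e₀ : ℝ) * h e - (σ e : ℝ) * h e₀
    exact_mod_cast mul_left_cancel₀ ha.ne' this
  have hg : normalize (σ e₀) = normalize (ρ e₀) := by
    have h1 := Finset.gcd_mul_right (s := Finset.univ) (f := ρ) (a := σ e₀)
    have h2 := Finset.gcd_mul_right (s := Finset.univ) (f := σ) (a := ρ e₀)
    rw [hρ, one_mul] at h1
    rw [hσ, one_mul] at h2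
    rw [← h1, ← h2]
    exact Finset.gcd_congr rfl fun e _ => hcross e
  rw [← Int.abs_eq_normalize, ← Int.abs_eq_normalize] at hg
  rcases abs_eq_abs.1 hg with hg | hg
  · exact hg.symm
  · have h0 := h e₀
    rw [hg] at h0
    push_cast at h0
    have h1 : (a + c) * (ρ e₀ : ℝ) = 0 := by linarith
    have h2 : (ρ e₀ : ℝ) = 0 := (mul_eq_zero.1 h1).resolve_left (by linarith)
    have h3 : ρ e₀ = 0 := by exact_mod_cast h2
    rw [hg, h3, neg_zero]

lemma shift_injective {x : E → ℝ} {ρ : E → ℤ} (hρ : ρ ≠ 0) {s t : ℝ}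
    (h : shift x s ρ = shift x t ρ) : s = t := by
  obtain ⟨e, he⟩ := Function.ne_iff.1 hρ
  have h1 := congrFun h e
  simp only [shift, add_right_inj] at h1
  exact mul_right_cancel₀ (Int.cast_ne_zero.2 he) h1

namespace StableAssignment

variable {I : SMP F W E}

/-- `x'` arises from `x` by applying the rotation `ρ` with weight `t`. -/
def RotStep (x : I.StableAssignment) (ρ : E → ℤ) (t : ℝ) (x' : I.StableAssignment) : Prop :=
  (∃ L, I.IsRotationOf x.val L ρ) ∧ 0 ≤ t ∧ x'.val = shift x.val t ρ

variable {x x' a c g u u' y : I.StableAssignment} {ρ σ π : E → ℤ} {s t r : ℝ}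

lemma RotStep.ne_zero (h : x.RotStep ρ t x') : ρ ≠ 0 := by
  obtain ⟨⟨L, hL⟩, -⟩ := h
  exact hL.2.1.1

lemma RotStep.gcd (h : x.RotStep ρ t x') : Finset.univ.gcd ρ = 1 := by
  obtain ⟨⟨L, hL⟩, -⟩ := h
  exact hL.2.1.2.2.2.2.1

lemma RotStep.le (h : x.RotStep ρ t x') : x ≤ x' := by
  obtain ⟨⟨L, hL⟩, ht, hx'⟩ := h
  exact le_of_shift hL ht hx'

lemma RotStep.between (h : x.RotStep ρ t x') (h1 : x ≤ y) (h2 : y ≤ x') :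
    ∃ s, 0 ≤ s ∧ s ≤ t ∧ y.val = shift x.val s ρ := by
  obtain ⟨⟨L, hL⟩, ht, hx'⟩ := h
  exact exists_shift_of_between hL ht hx' h1 h2

lemma RotStep.le_of_le (h : x.RotStep ρ t x') {s r : ℝ} (hs0 : 0 ≤ s) (hr0 : 0 ≤ r)
    (ha : a.val = shift x.val s ρ) (hc : c.val = shift x.val r ρ) (hle : a ≤ c) : s ≤ r := by
  by_contra! hlt
  have hne := h.ne_zero
  obtain ⟨⟨L, hL⟩, ht, hx'⟩ := h
  have hF := hL.feasible_of_stable x.stable hs0 (ha ▸ a.stable)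
  have hLc : I.IsRotationOf c.val L ρ := hc ▸ hL.shift_of_lt x.stable hF hr0 hlt
  have hca : c ≤ a := le_of_shift hLc (sub_pos.2 hlt).le (by
    rw [hc, shift_shift, add_sub_cancel, ha])
  have heq : a = c := le_antisymm hle hca
  rw [heq, hc] at ha
  exact hlt.ne (shift_injective hne ha)

lemma val_sup_add (a c : I.StableAssignment) (e : E) :
    (a ⊔ c).val e + (a ⊓ c).val e = a.val e + c.val e :=
  congrFun (sup_add_inf a c) e

/-- Meeting both ends of a rotational step with `x`. -/
lemma RotStep.inf (h : u.RotStep ρ t u') (x : I.StableAssignment) :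
    ∃ s, 0 ≤ s ∧ s ≤ t ∧ (x ⊓ u').val = shift (x ⊓ u).val s ρ ∧
      (x ⊓ u' ⊔ u).val = shift u.val s ρ := by
  -- The join of `x ⊓ u'` with `u` lies between `u` and `u'`, hence is a shift of `u`; the identity
  -- for sums of join and meet transfers the displacement to the meets.
  obtain ⟨s, hs, hst, heq⟩ := h.between (y := x ⊓ u' ⊔ u) le_sup_right
    (sup_le inf_le_right h.le)
  refine ⟨s, hs, hst, funext fun e => ?_, heq⟩
  have h1 := val_sup_add (x ⊓ u') u e
  rw [inf_assoc, inf_eq_right.2 h.le, heq] at h1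
  simp only [shift] at h1 ⊢
  linarith

lemma RotStep.inf_left (h : x.RotStep ρ t x') (u : I.StableAssignment) :
    ∃ s, 0 ≤ s ∧ s ≤ t ∧ (x' ⊓ u).val = shift (x ⊓ u).val s ρ ∧
      (x' ⊓ u ⊔ x).val = shift x.val s ρ := by
  obtain ⟨s, h1, h2, h3, h4⟩ := h.inf u
  exact ⟨s, h1, h2, by rwa [inf_comm x', inf_comm x], by rwa [inf_comm x']⟩

/-- Steps along different rotations do not interact. -/
lemma RotStep.inf_sub_inf (h : x.RotStep σ t x') (h' : u.RotStep ρ s u') (hne : σ ≠ ρ) (e : E) :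
    (x' ⊓ u').val e - (x ⊓ u').val e = (x' ⊓ u).val e - (x ⊓ u).val e := by
  obtain ⟨r₁, h10, h11, h12, h13⟩ := h.inf_left u
  obtain ⟨r₂, h20, h21, h22, h23⟩ := h.inf_left u'
  obtain ⟨s₁, k10, k11, k12, k13⟩ := h'.inf x
  obtain ⟨s₂, k20, k21, k22, k23⟩ := h'.inf x'
  have hr : r₁ ≤ r₂ := h.le_of_le h10 h20 h13 h23
    (sup_le_sup_right (inf_le_inf_left _ h'.le) _)
  have hs : s₁ ≤ s₂ := h'.le_of_le k10 k20 k13 k23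
    (sup_le_sup_right (inf_le_inf_right _ h.le) _)
  -- The mixed difference of the four meets is a nonnegative multiple of `σ` and also of `ρ`, so it
  -- vanishes.
  have hprop : ∀ e, (r₂ - r₁) * (σ e : ℝ) = (s₂ - s₁) * ρ e := fun e => by
    have e1 := congrFun h12 e
    have e2 := congrFun h22 e
    have e3 := congrFun k12 e
    have e4 := congrFun k22 e
    simp only [shift] at e1 e2 e3 e4
    linarith
  have hr' : r₁ = r₂ := by
    by_contra hn
    exact hne (eq_of_proportional h.gcd h'.gcd (sub_pos.2 (hr.lt_of_ne hn)) (sub_nonneg.2 hs)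
      hprop)
  rw [h12, h22, hr']
  simp only [shift]
  ring

/-- Opposite sides of a lattice rectangle have equal displacement. A rotation leading from `x`
towards `a` gives, after joining with `c`, a point between `c` and `g`, so it is proportional to `σ`
and equals it. `applicable_sup` is dual. -/
lemma RotStep.applicable_inf (h : c.RotStep σ r g) (hr : 0 < r) (hinf : a ⊓ c = x)
    (hsup : a ⊔ c = g) : ∃ L, I.IsRotationOf x.val L σ := by
  have hxa : x ≤ a := hinf ▸ inf_le_left
  have hlt : x < a := by
    refine hxa.lt_of_ne fun heq => ?_
    have hgc : g = c := by
      rw [← hsup, ← heq, ← hinf, sup_eq_right]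
      exact inf_le_right
    have h2 := h.2.2
    rw [hgc, ← shift_zero c.val σ, shift_shift, zero_add] at h2
    exact hr.ne (shift_injective h.ne_zero h2)
  obtain ⟨L, σ', hσ', t, ht, z, hz, hza⟩ := exists_rotation_of_lt hlt
  have hxz : x ≤ z := le_of_shift hσ' ht.le hz
  obtain ⟨s, hs, -, heq⟩ := h.between (y := z ⊔ c) le_sup_right
    (hsup ▸ sup_le_sup_right hza c)
  have hzc : z ⊓ c = x := le_antisymm (hinf ▸ inf_le_inf_right c hza)
    (le_inf hxz (hinf ▸ inf_le_right))
  have : σ' = σ := by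
    refine eq_of_proportional hσ'.2.1.2.2.2.2.1 h.gcd ht hs fun e => ?_
    have h1 := val_sup_add z c e
    rw [hzc, heq, hz] at h1
    simp only [shift] at h1
    linarith
  exact ⟨L, this ▸ hσ'⟩

lemma RotStep.applicable_sup (h : x.RotStep σ s c) (hs : 0 < s) (hinf : a ⊓ c = x)
    (hsup : a ⊔ c = g) : ∃ L, I.IsRotationOf a.val L σ := by
  have hag : a ≤ g := hsup ▸ le_sup_left
  have hcg : c ≤ g := hsup ▸ le_sup_right
  have hlt : a < g := by
    refine hag.lt_of_ne fun heq => ?_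
    have hcx : c = x := by
      rw [← hinf, eq_comm, inf_eq_right, heq]
      exact hcg
    have h2 := h.2.2
    rw [hcx, ← shift_zero x.val σ, shift_shift, zero_add] at h2
    exact hs.ne (shift_injective h.ne_zero h2)
  obtain ⟨L, σ', hσ', t, ht, z, hz, hzg⟩ := exists_rotation_of_lt hlt
  have haz : a ≤ z := le_of_shift hσ' ht.le hz
  obtain ⟨r, hr, -, heq⟩ := h.between (y := z ⊓ c) (hinf ▸ inf_le_inf_right c haz) inf_le_right
  have hzc : z ⊔ c = g := le_antisymm (sup_le hzg hcg) (hsup ▸ sup_le_sup_right haz c)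
  have : σ' = σ := by
    refine eq_of_proportional hσ'.2.1.2.2.2.2.1 h.gcd ht hr fun e => ?_
    have h1 := val_sup_add z c e
    have h2 := val_sup_add a c e
    rw [hzc, heq, hz] at h1
    rw [hsup, hinf] at h2
    simp only [shift] at h1
    linarith
  exact ⟨L, this ▸ hσ'⟩

/-- If the components met they would coincide, and a small step along `π` would stay below `a`. But
only multiples of `σ` occur between `x` and `a`. -/
lemma disjoint_components {L L' : Set (F ⊕ W)} (h : x.RotStep σ t a) (ht : 0 < t)
    (hL : I.IsRotationOf x.val L σ) (hL' : I.IsRotationOf x.val L' π) (hne : σ ≠ π) :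
    Disjoint L L' := by
  rw [Set.disjoint_left]
  intro v hv hv'
  obtain rfl := hL.1.1.eq hL'.1.1 hv hv'
  have hsub : L ⊆ I.changed x.val a.val := fun u hu => by
    obtain ⟨e, he, hρ⟩ := hL.exists_ne_zero x.stable hu
    refine ⟨e, he, fun heq => ?_⟩
    rw [h.2.2, shift, left_eq_add] at heq
    rcases mul_eq_zero.1 heq with h0 | h0
    · exact ht.ne' h0
    · exact hρ (by exact_mod_cast h0)
  obtain ⟨r, ⟨hF, hle⟩, hr⟩ := ((hL'.eventually_feasible x.stable).and
    (eventually_shift_le h.le hL' hsub)).and self_mem_nhdsWithin |>.exists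
  have hr' : 0 < r := hr
  let z : I.StableAssignment := ⟨_, hL'.stable_shift x.stable hr'.le hF⟩
  obtain ⟨s, hs, -, heq⟩ := h.between (y := z) (le_of_shift hL' hr'.le rfl)
    (le_iff_refuses.2 hle)
  refine hne (eq_of_proportional hL'.2.1.2.2.2.2.1 h.gcd hr' hs fun e => ?_).symm
  have h1 : shift x.val r π e = shift x.val s σ e := congrFun heq e
  simpa [shift] using h1

/-- Two consecutive steps along different rotations commute if the second rotation is already
applicable before the first step. -/
lemma RotStep.swap (h : x.RotStep σ t a) (ht : 0 < t) (h' : a.RotStep π s g) (hs : 0 < s)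
    (hne : σ ≠ π) (hπ : ∃ L, I.IsRotationOf x.val L π) :
    ∃ c, x.RotStep π s c ∧ c.RotStep σ t g := by
  obtain ⟨L, hL⟩ := h.1
  obtain ⟨L', hL'⟩ := hπ
  obtain ⟨L'', hL''⟩ := h'.1
  have hd := disjoint_components h ht hL hL' hne
  have hFa := hL''.feasible_of_stable a.stable hs.le (h'.2.2 ▸ g.stable)
  have hax : ∀ v ∈ L', ∀ e ∈ I.star v, a.val e = x.val e := fun v hv e he => by
    rw [h.2.2]
    exact hL.shift_eq_of_not_mem x.stable (Set.disjoint_right.1 hd hv) t he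
  have hval : ∀ v ∈ L', ∀ e ∈ I.star v, shift a.val s π e = shift x.val s π e :=
    fun v hv e he => by rw [shift, shift, hax v hv e he]
  -- The step along `σ` leaves the vertices of `L'` untouched, so feasibility of `π` at `a` carries
  -- over to `x`.
  have hF : I.Feasible x.val π s := by
    refine ⟨fun e => ?_, fun e => ?_, fun e he => ?_⟩
    · by_cases h0 : π e = 0
      · rw [shift_of_zero h0]; exact x.stable.nonneg e
      · rw [← hval _ (hL'.ends_mem x.stable h0).1 e (I.mem_star_firm e)]
        exact hFa.1 e
    · by_cases h0 : π e = 0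
      · rw [shift_of_zero h0]; exact x.stable.le_cap e
      · rw [← hval _ (hL'.ends_mem x.stable h0).1 e (I.mem_star_firm e)]
        exact hFa.2.1 e
    · exact (hFa.2.2 e he).congr (I.mem_star_worker e)
        (hval _ (hL'.ends_mem x.stable he.ne).2)
  let c : I.StableAssignment := ⟨_, hL'.stable_shift x.stable hs.le hF⟩
  have hc : x.RotStep π s c := ⟨⟨L', hL'⟩, hs.le, rfl⟩
  have hcval : c.val = shift x.val s π := rfl
  -- The meet lies below both `a` and `c`, so its displacement from `x` is a multiple of `σ` and of
  -- `π`.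
  have hinf : c ⊓ a = x := by
    obtain ⟨r₁, hr₁, -, e₁⟩ := h.between (y := c ⊓ a) (le_inf hc.le h.le) inf_le_right
    obtain ⟨r₂, hr₂, -, e₂⟩ := hc.between (y := c ⊓ a) (le_inf hc.le h.le) inf_le_left
    rcases hr₁.eq_or_lt with rfl | hpos
    · exact eq_of_val_eq (by rw [e₁, shift_zero])
    · refine absurd (eq_of_proportional h.gcd hc.gcd hpos hr₂ fun e => ?_) hne
      have := congrFun (e₁.symm.trans e₂) e
      simpa [shift] using this
  have hsup : c ⊔ a = g := by
    refine eq_of_val_eq (funext fun e => ?_)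
    have h1 := val_sup_add c a e
    rw [hinf, hcval] at h1
    rw [h'.2.2]
    simp only [shift] at h1 ⊢
    linarith
  refine ⟨c, hc, h.applicable_sup ht hinf hsup, ht.le, funext fun e => ?_⟩
  rw [h'.2.2, h.2.2, hcval]
  simp only [shift]
  ring

end StableAssignment

/-! ### Routes -/

lemma IsShiftSequence.stable_left {I : SMP F W E} {x z : E → ℝ} {T : List (ℝ × (E → ℤ))}
    (h : I.IsShiftSequence x T z) : I.Stable x := by
  cases h with
  | nil _ h => exact h
  | cons _ _ _ _ _ h => exact h.1

lemma IsShiftSequence.split {I : SMP F W E} {x z : E → ℝ} {A B : List (ℝ × (E → ℤ))}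
    (h : I.IsShiftSequence x (A ++ B) z) :
    ∃ y, I.IsShiftSequence x A y ∧ I.IsShiftSequence y B z := by
  induction A generalizing x with
  | nil => exact ⟨x, IsShiftSequence.nil x h.stable_left, h⟩
  | cons p A ih =>
    cases h with
    | cons _ t ρ _ _ h1 h2 h3 h4 =>
      obtain ⟨y, hA, hB⟩ := ih h4
      exact ⟨y, IsShiftSequence.cons x t ρ A y h1 h2 h3 hA, hB⟩

/-- A step of a shift sequence as a step in the lattice of stable assignments. -/
lemma exists_rotStep {I : SMP F W E} {x z : E → ℝ} {t : ℝ} {ρ : E → ℤ}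
    {T : List (ℝ × (E → ℤ))} (h : I.IsShiftSequence x ((t, ρ) :: T) z) :
    0 < t ∧ ∃ u u' : I.StableAssignment, u.val = x ∧ u.RotStep ρ t u' ∧
      I.IsShiftSequence u'.val T z := by
  cases h with
  | cons _ _ _ _ _ h1 h2 _ h4 =>
    exact ⟨h2, ⟨x, h1.1⟩, ⟨_, h4.stable_left⟩, rfl, ⟨h1.2, h2.le, rfl⟩, h4⟩

lemma isShiftSequence_cons {I : SMP F W E} {u u' : I.StableAssignment} {t : ℝ} {ρ : E → ℤ}
    {T : List (ℝ × (E → ℤ))} {z : E → ℝ} (h : u.RotStep ρ t u') (ht : 0 < t)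
    (hT : I.IsShiftSequence u'.val T z) : I.IsShiftSequence u.val ((t, ρ) :: T) z := by
  obtain ⟨⟨L, hL⟩, -, hu'⟩ := h
  rw [hu'] at hT
  exact IsShiftSequence.cons _ t ρ T z ⟨u.stable, L, hL⟩ ht
    (hL.admissible_of_feasible u.stable ht.le
      (hL.feasible_of_stable u.stable ht.le hT.stable_left)) hT

/-- The trace of a step along `σ` below `u` is invariant while `u` moves along other rotations. -/
lemma inf_sub_inf_of_sequence {I : SMP F W E} {x x' : I.StableAssignment} {σ : E → ℤ} {t : ℝ}
    (h : x.RotStep σ t x') {T : List (ℝ × (E → ℤ))} {z : E → ℝ} (u v : I.StableAssignment)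
    (hz : v.val = z) (hT : I.IsShiftSequence u.val T z) (hσ : σ ∉ T.map Prod.snd) (e : E) :
    (x' ⊓ v).val e - (x ⊓ v).val e = (x' ⊓ u).val e - (x ⊓ u).val e := by
  induction T generalizing u with
  | nil =>
    have : v = u := StableAssignment.eq_of_val_eq (by rw [hz]; cases hT; rfl)
    rw [this]
  | cons p T ih =>
    obtain ⟨r, ρ⟩ := p
    obtain ⟨-, w, w', hw, hstep, hT'⟩ := exists_rotStep hT
    obtain rfl := StableAssignment.eq_of_val_eq hw
    rw [List.map_cons, List.mem_cons, not_or] at hσ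
    rw [ih w' hT' hσ.2, h.inf_sub_inf hstep hσ.1]

lemma IsRoute.exists_ends {I : SMP F W E} {T : List (ℝ × (E → ℤ))} (h : I.IsRoute T) :
    ∃ x z : I.StableAssignment, (∀ y, x ≤ y) ∧ (∀ y, y ≤ z) ∧
      I.IsShiftSequence x.val T z.val := by
  obtain ⟨-, x, z, hx, hz, hT⟩ := h
  refine ⟨⟨x, hx.1⟩, ⟨z, hz.1⟩, fun y e => ?_, fun y e => ?_, hT⟩
  · exact (revPref_iff y.stable hx.1 _).1 (hx.2 y.val y.stable (I.worker e))
  · exact (revPref_iff hz.1 y.stable _).1 (hz.2 y.val y.stable (I.worker e))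

/-- The trace of the given step is `0` below the minimal assignment and `tσ` below the maximal one.
Only the route's step along `σ` can change it, and by at most its own weight. -/
lemma IsRoute.exists_weight_ge {I : SMP F W E} {T : List (ℝ × (E → ℤ))} (hT : I.IsRoute T)
    {x x' : I.StableAssignment} {σ : E → ℤ} {t : ℝ} (h : x.RotStep σ t x') (ht : 0 < t) :
    ∃ τ, (τ, σ) ∈ T ∧ t ≤ τ := by
  obtain ⟨lo, hi, hlo, hhi, hseq⟩ := hT.exists_ends
  obtain ⟨e, he⟩ := Function.ne_iff.1 h.ne_zero
  have heR : (σ e : ℝ) ≠ 0 := Int.cast_ne_zero.2 he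
  have hbot : (x' ⊓ lo).val e - (x ⊓ lo).val e = 0 := by
    rw [inf_eq_right.2 (hlo _), inf_eq_right.2 (hlo _), sub_self]
  have htop : (x' ⊓ hi).val e - (x ⊓ hi).val e = t * σ e := by
    rw [inf_eq_left.2 (hhi _), inf_eq_left.2 (hhi _), h.2.2, shift, add_sub_cancel_left]
  by_cases hσ : σ ∈ T.map Prod.snd
  swap
  · have := inf_sub_inf_of_sequence h lo hi rfl hseq hσ e
    rw [hbot, htop] at this
    exact absurd this (mul_ne_zero ht.ne' heR)
  obtain ⟨⟨τ, σ'⟩, hp, hσ'⟩ := List.mem_map.1 hσ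
  rw [show σ' = σ from hσ'] at hp
  refine ⟨τ, hp, ?_⟩
  obtain ⟨A, B, rfl⟩ := List.append_of_mem hp
  have hnd := hT.1
  rw [List.map_append, List.map_cons, List.nodup_append, List.nodup_cons] at hnd
  obtain ⟨y, hA, hB⟩ := hseq.split
  obtain ⟨-, u, u', rfl, hstep, hB'⟩ := exists_rotStep hB
  have h1 := inf_sub_inf_of_sequence h lo u rfl hA
    (fun hm => hnd.2.2 _ hm _ (List.mem_cons_self ..) rfl) e
  have h2 := inf_sub_inf_of_sequence h u' hi rfl hB' hnd.2.1.1 e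
  rw [hbot] at h1
  rw [htop] at h2
  obtain ⟨s₁, k10, k11, k12, -⟩ := hstep.inf x
  obtain ⟨s₂, k20, k21, k22, -⟩ := hstep.inf x'
  rw [k12, k22] at h2
  simp only [shift] at h2
  have h3 : t * (σ e : ℝ) = (s₂ - s₁) * σ e := by linarith
  have h4 := mul_right_cancel₀ heR h3
  linarith

lemma IsShiftSequence.exists_step_of_mem {I : SMP F W E} {x z : E → ℝ} {t : ℝ} {ρ : E → ℤ}
    {T : List (ℝ × (E → ℤ))} (h : I.IsShiftSequence x T z) (hm : (t, ρ) ∈ T) :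
    0 < t ∧ ∃ u u' : I.StableAssignment, u.RotStep ρ t u' := by
  obtain ⟨A, B, rfl⟩ := List.append_of_mem hm
  obtain ⟨y, -, hB⟩ := h.split
  obtain ⟨ht, u, u', -, hs, -⟩ := exists_rotStep hB
  exact ⟨ht, u, u', hs⟩

lemma weight_eq_of_nodup {T : List (ℝ × (E → ℤ))} (hT : (T.map Prod.snd).Nodup) {s t : ℝ}
    {ρ : E → ℤ} (hs : (s, ρ) ∈ T) (ht : (t, ρ) ∈ T) : s = t :=
  congrArg Prod.fst (List.inj_on_of_nodup_map hT hs ht rfl)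

/-- By `exists_weight_ge` in both directions any two routes use `ρ` with the same weight, so the
supremum defining `tau` is over a singleton. -/
lemma IsRoute.tau_eq {I : SMP F W E} {T : List (ℝ × (E → ℤ))} (hT : I.IsRoute T) {t : ℝ}
    {ρ : E → ℤ} (hm : (t, ρ) ∈ T) : I.tau ρ = t := by
  have aux : ∀ {T T' : List (ℝ × (E → ℤ))}, I.IsRoute T → I.IsRoute T' → ∀ {t s : ℝ},
      (t, ρ) ∈ T → (s, ρ) ∈ T' → t ≤ s := by
    intro T T' hT hT' t s ht hs
    obtain ⟨_, _, -, -, hseq⟩ := hT.exists_ends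
    obtain ⟨hpos, u, u', hstep⟩ := hseq.exists_step_of_mem ht
    obtain ⟨τ, hτ, hle⟩ := hT'.exists_weight_ge hstep hpos
    rwa [weight_eq_of_nodup hT'.1 hs hτ]
  have : {s | ∃ T, I.IsRoute T ∧ (s, ρ) ∈ T} = {t} := by
    ext s
    constructor
    · rintro ⟨T', hT', hs⟩
      exact le_antisymm (aux hT' hT hs hm) (aux hT hT' hm hs)
    · rintro rfl
      exact ⟨T, hT, hm⟩
  rw [tau, this, csSup_singleton]

/-- If applying `ρ` makes `ρ'` applicable at some stable assignment, then every route uses `ρ`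
before `ρ'`. -/
lemma HEdge.sublist {I : SMP F W E} {ρ ρ' : E → ℤ} (h : I.HEdge ρ ρ') {T : List (ℝ × (E → ℤ))}
    (hT : I.IsRoute T) : List.Sublist [ρ, ρ'] (T.map Prod.snd) := by
  obtain ⟨-, -, x₀, hx₀, hρ, hnρ', hρ'⟩ := h
  have hne : ρ ≠ ρ' := fun heq => hnρ' (heq ▸ hρ)
  let x : I.StableAssignment := ⟨x₀, hx₀⟩
  let x' : I.StableAssignment := ⟨_, hρ'.1⟩
  have hτ : 0 ≤ I.tau ρ := by
    refine Real.sSup_nonneg ?_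
    rintro t ⟨T, hT, hm⟩
    obtain ⟨_, _, -, -, hseq⟩ := hT.exists_ends
    exact (hseq.exists_step_of_mem hm).1.le
  have hx : x.RotStep ρ (I.tau ρ) x' := ⟨hρ.2, hτ, rfl⟩
  obtain ⟨L, hL⟩ := hρ'.2
  obtain ⟨r, hF, hr⟩ := ((hL.eventually_feasible hρ'.1).and self_mem_nhdsWithin).exists
  have hr' : 0 < r := hr
  let u : I.StableAssignment := ⟨_, hL.stable_shift hρ'.1 hr'.le hF⟩
  have hu : x'.RotStep ρ' r u := ⟨⟨L, hL⟩, hr'.le, rfl⟩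
  have hτpos : 0 < I.tau ρ := by
    refine hτ.lt_of_ne fun h0 => hnρ' ?_
    rwa [← h0, shift_zero] at hρ'
  obtain ⟨lo, hi, hlo, hhi, hseq⟩ := hT.exists_ends
  obtain ⟨s, hs, -⟩ := hT.exists_weight_ge hu hr'
  obtain ⟨s', hs', -⟩ := hT.exists_weight_ge hx hτpos
  obtain ⟨A, B, rfl⟩ := List.append_of_mem hs
  have hnd := hT.1
  rw [List.map_append, List.map_cons, List.nodup_append, List.nodup_cons] at hnd
  rw [List.map_append, List.map_cons]
  by_cases hA : ρ ∈ A.map Prod.snd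
  · exact List.Sublist.append (l₁ := [ρ]) (r₁ := [ρ']) (List.singleton_sublist.2 hA)
      (List.singleton_sublist.2 (List.mem_cons_self ..))
  exfalso
  obtain ⟨y, hseqA, hseqB⟩ := hseq.split
  obtain ⟨-, v, z, rfl, hstep, hseqB'⟩ := exists_rotStep hseqB
  -- `z` is the route's term just after `ρ'`, before any use of `ρ`, so the step along `ρ` has no
  -- trace below `z`. Since `ρ'` is not used again, the step from `x'` to `u` has its full trace
  -- there.
  have hxz : x' ⊓ z = x ⊓ z := by
    refine StableAssignment.eq_of_val_eq (funext fun e => ?_)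
    have h1 := inf_sub_inf_of_sequence hx lo v rfl hseqA hA e
    have h2 := hx.inf_sub_inf hstep hne e
    rw [h1, inf_eq_right.2 (hlo _), inf_eq_right.2 (hlo _), sub_self] at h2
    linarith
  have huz : ∀ e, (u ⊓ z).val e = (x' ⊓ z).val e + r * ρ' e := fun e => by
    have h1 := inf_sub_inf_of_sequence hu z hi rfl hseqB' hnd.2.1.1 e
    rw [inf_eq_left.2 (hhi _), inf_eq_left.2 (hhi _), hu.2.2, shift] at h1
    linarith
  -- This stable assignment turns out to be `x + rρ'`. It completes a rectangle with `x`, `x'` and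
  -- `u`, which makes `ρ'` applicable to `x`.
  let m : I.StableAssignment := x ⊔ u ⊓ z
  have hm : ∀ e, m.val e = x.val e + r * ρ' e := fun e => by
    have h1 := StableAssignment.val_sup_add x (u ⊓ z) e
    rw [← inf_assoc, inf_eq_left.2 (hx.le.trans hu.le), ← hxz, huz] at h1
    change (x ⊔ u ⊓ z).val e = _
    linarith
  have hsup : m ⊔ x' = u := by
    have h0 : m ⊔ x' = x' ⊔ u ⊓ z := by
      change x ⊔ u ⊓ z ⊔ x' = _
      rw [sup_comm, ← sup_assoc, sup_eq_left.2 hx.le]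
    rw [h0]
    refine StableAssignment.eq_of_val_eq (funext fun e => ?_)
    have h1 := StableAssignment.val_sup_add x' (u ⊓ z) e
    rw [← inf_assoc, inf_eq_left.2 hu.le, huz] at h1
    rw [hu.2.2, shift]
    linarith
  have hinf : m ⊓ x' = x := by
    refine StableAssignment.eq_of_val_eq (funext fun e => ?_)
    have h1 := StableAssignment.val_sup_add m x' e
    rw [hsup, hm, hu.2.2, shift] at h1
    linarith
  exact hnρ' ⟨hx₀, hu.applicable_inf hr' hinf hsup⟩

/-! ### Precedence and rearrangement of routes -/

lemma sublist_pair_trans {α : Type*} {a b c : α} {l : List α} (hl : l.Nodup)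
    (hab : List.Sublist [a, b] l) (hbc : List.Sublist [b, c] l) : List.Sublist [a, c] l := by
  induction l with
  | nil => cases hab
  | cons h l ih =>
    rw [List.nodup_cons] at hl
    rw [List.cons_sublist_cons'] at hab hbc ⊢
    rw [List.singleton_sublist] at hab hbc ⊢
    rcases hab with hab | ⟨rfl, hb⟩
    · rcases hbc with hbc | ⟨rfl, -⟩
      · exact Or.inl (ih hl.2 hab hbc)
      · exact absurd (hab.subset (by simp)) hl.1
    · rcases hbc with hbc | ⟨rfl, -⟩
      · exact Or.inr ⟨rfl, hbc.subset (by simp)⟩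
      · exact absurd hb hl.1

lemma HEdge.precedes {I : SMP F W E} {ρ ρ' : E → ℤ} (h : I.HEdge ρ ρ') : I.Precedes ρ ρ' :=
  ⟨h.1, h.2.1, fun _ hT => h.sublist hT⟩

lemma Precedes.trans {I : SMP F W E} {ρ σ π : E → ℤ} (h : I.Precedes ρ σ) (h' : I.Precedes σ π) :
    I.Precedes ρ π :=
  ⟨h.1, h'.2.1, fun T hT => sublist_pair_trans hT.1 (h.2.2 T hT) (h'.2.2 T hT)⟩

lemma Precedes.ne {I : SMP F W E} {ρ ρ' : E → ℤ} (h : I.Precedes ρ ρ') : ρ ≠ ρ' := by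
  rintro rfl
  obtain ⟨T, hT, -⟩ := h.1
  have := hT.1.sublist (h.2.2 T hT)
  simp at this

lemma IsShiftSequence.swap {I : SMP F W E} {x z : E → ℝ} {t s : ℝ} {σ π : E → ℤ}
    {T : List (ℝ × (E → ℤ))} (h : I.IsShiftSequence x ((t, σ) :: (s, π) :: T) z) (hne : σ ≠ π)
    (hπ : I.Applicable x π) : I.IsShiftSequence x ((s, π) :: (t, σ) :: T) z := by
  obtain ⟨ht, u, a, rfl, hua, h'⟩ := exists_rotStep h
  obtain ⟨hs, a', g, ha', hag, hT⟩ := exists_rotStep h'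
  obtain rfl := StableAssignment.eq_of_val_eq ha'
  obtain ⟨c, huc, hcg⟩ := hua.swap ht hag hs hne hπ.2
  exact isShiftSequence_cons huc hs (isShiftSequence_cons hcg ht hT)

/-- Moving a rotation in `P` behind the rotations outside `P`, if no edge of the graph prevents
this. -/
lemma exists_sorted_cons {I : SMP F W E} {P : (E → ℤ) → Prop}
    (hP : ∀ σ π, P σ → ¬ P π → ¬ I.HEdge σ π) {t : ℝ} {σ : E → ℤ} (hσ : P σ)
    (hσR : σ ∈ I.rotations) (hτ : I.tau σ = t) {T : List (ℝ × (E → ℤ))} {z : E → ℝ}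
    (hR : ∀ p ∈ T, p.2 ∈ I.rotations) (hT : T.Pairwise fun p p' => P p.2 → P p'.2) {x : E → ℝ}
    (h : I.IsShiftSequence x ((t, σ) :: T) z) :
    ∃ T', T'.Perm ((t, σ) :: T) ∧ T'.Pairwise (fun p p' => P p.2 → P p'.2) ∧
      I.IsShiftSequence x T' z := by
  induction T generalizing x with
  | nil => exact ⟨_, List.Perm.refl _, List.pairwise_singleton _ _, h⟩
  | cons p T ih =>
    obtain ⟨s, π⟩ := p
    rw [List.pairwise_cons] at hT
    by_cases hπ : P π
    · refine ⟨_, List.Perm.refl _, ?_, h⟩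
      rw [List.pairwise_cons, List.pairwise_cons]
      refine ⟨fun p hp _ => ?_, hT⟩
      rcases List.mem_cons.1 hp with rfl | hp
      · exact hπ
      · exact hT.1 p hp hπ
    -- Otherwise the current assignment `x` witnesses an edge from `σ` to `π`; the weight of the
    -- step is `I.tau σ`, as the definition of `HEdge` requires.
    · have happ : I.Applicable x π := by
        by_contra hn
        refine hP σ π hσ hπ ⟨hσR, hR _ (List.mem_cons_self ..), x, h.stable_left, ?_, hn, ?_⟩
        · cases h with
          | cons _ _ _ _ _ h1 _ _ _ => exact h1
        · rw [hτ]
          cases h with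
          | cons _ _ _ _ _ _ _ _ h4 =>
            cases h4 with
            | cons _ _ _ _ _ h1 _ _ _ => exact h1
      have hne : σ ≠ π := fun heq => hπ (heq ▸ hσ)
      obtain ⟨hs, u, u', rfl, hu, hseq⟩ := exists_rotStep (h.swap hne happ)
      obtain ⟨T', hperm, hpw, hT'⟩ := ih (fun p hp => hR p (List.mem_cons_of_mem _ hp)) hT.2 hseq
      refine ⟨(s, π) :: T', (hperm.cons _).trans (List.Perm.swap _ _ _), ?_,
        isShiftSequence_cons hu hs hT'⟩
      exact List.pairwise_cons.2 ⟨fun _ _ h => absurd h hπ, hpw⟩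

/-- Insertion sort by exchanges of neighbours: the tail is sorted first, and then its predecessor is
moved to its place. Endpoints and weights are kept. -/
lemma exists_sorted {I : SMP F W E} {P : (E → ℤ) → Prop}
    (hP : ∀ σ π, P σ → ¬ P π → ¬ I.HEdge σ π) {T : List (ℝ × (E → ℤ))} {x z : E → ℝ}
    (hR : ∀ p ∈ T, p.2 ∈ I.rotations ∧ I.tau p.2 = p.1) (h : I.IsShiftSequence x T z) :
    ∃ T', T'.Perm T ∧ T'.Pairwise (fun p p' => P p.2 → P p'.2) ∧ I.IsShiftSequence x T' z := by
  induction T generalizing x with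
  | nil => exact ⟨[], List.Perm.refl _, List.Pairwise.nil, h⟩
  | cons p T ih =>
    obtain ⟨t, σ⟩ := p
    obtain ⟨ht, u, u', rfl, hu, hseq⟩ := exists_rotStep h
    obtain ⟨T', hperm, hpw, hT'⟩ := ih (fun p hp => hR p (List.mem_cons_of_mem _ hp)) hseq
    have hT'' := isShiftSequence_cons hu ht hT'
    by_cases hσ : P σ
    · have hσR := hR _ (List.mem_cons_self ..)
      obtain ⟨T'', hperm', hpw', hseq'⟩ := exists_sorted_cons hP hσ hσR.1 hσR.2
        (fun p hp => (hR p (List.mem_cons_of_mem _ (hperm.subset hp))).1) hpw hT''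
      exact ⟨T'', hperm'.trans (hperm.cons _), hpw', hseq'⟩
    · exact ⟨_, hperm.cons _, List.pairwise_cons.2 ⟨fun _ _ h => absurd h hσ, hpw⟩, hT''⟩

lemma Precedes.transGen {I : SMP F W E} {ρ ρ' : E → ℤ} (h : I.Precedes ρ ρ') :
    Relation.TransGen I.HEdge ρ ρ' := by
  -- No edge leaves the set of rotations reachable from `ρ`, so a route can be sorted with the
  -- members of `P` last. In the sorted route `ρ'` still comes after `ρ`, hence belongs to `P`.
  let P : (E → ℤ) → Prop := fun σ => Relation.ReflTransGen I.HEdge ρ σ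
  obtain ⟨T, hT, -⟩ := h.1
  obtain ⟨hnd, x, z, hx, hz, hseq⟩ := id hT
  obtain ⟨T', hperm, hpw, hseq'⟩ := exists_sorted (P := P)
    (fun σ π hσ hπ hE => hπ (Relation.ReflTransGen.tail hσ hE))
    (fun p hp => ⟨⟨T, hT, List.mem_map_of_mem hp⟩, hT.tau_eq hp⟩) hseq
  have hT' : I.IsRoute T' := ⟨(hperm.map _).nodup_iff.2 hnd, x, z, hx, hz, hseq'⟩
  have hpw' : (T'.map Prod.snd).Pairwise fun σ π => P σ → P π := List.pairwise_map.2 hpw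
  have hρ' : P ρ' := by
    have := hpw'.sublist (h.2.2 T' hT')
    simp only [List.pairwise_cons, List.mem_singleton, forall_eq] at this
    exact this.1 Relation.ReflTransGen.refl
  exact (Relation.reflTransGen_iff_eq_or_transGen.1 hρ').resolve_left fun heq => h.ne heq.symm

end

end SMP

theorem mainTheorem8 {F W E : Type*} [Fintype F] [Fintype W] [Fintype E] (I : SMP F W E)
    (ρ ρ' : E → ℤ) (hρ : ρ ∈ I.rotations) (hρ' : ρ' ∈ I.rotations) :
    I.Precedes ρ ρ' ↔ Relation.TransGen I.HEdge ρ ρ' := by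
  refine ⟨SMP.Precedes.transGen, fun h => ?_⟩
  induction h with
  | single h => exact h.precedes
  | tail _ h ih => exact (ih h.1).trans h.precedes
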